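/- \textbf{Conventions.} Manifolds and maps are $C^\infty$. For a Riemannian manifold $(N,h)$, $\Delta = d^*d=-\operatorname{div}\operatorname{grad}$ on functions, $R(X,Y)=[\nabla_X,\nabla_Y]-\nabla_{[X,Y]}$, and $\mathrm{Ric}(Y,Z)=\operatorname{tr}(X\mapsto R(X,Y)Z)$. A smooth map $\phi:(M,g)\to(N,h)$ has tension field $\tau(\phi)=\operatorname{trace}_g\nabla d\phi$ and is \emph{biharmonic} if its bitension field vanishes, $$\tau_2(\phi)=\operatorname{trace}_g(\nabla^\phi)^2\tau(\phi)-\operatorname{trace}_g R^N(d\phi\,\cdot,\tau(\phi))\,d\phi\,\cdot=0 .$$ For $f\in C^\infty(N)$ and an open set $U\subseteq N$ let $U_f=\{p\in U: df_p\neq 0\}$. We say that $f$ is \emph{isoparametric on $U$} if there are real functions $\gamma,\sigma$, smooth on the open set $f(U_f)\subseteq\mathbb R$, with $$|df|^2=\gamma\circ f,\qquad \Delta f=\sigma\circ f\qquad\text{at all points of } U_f .$$ \textbf{Theorem.} Let $(N^n,h)$, $n>2$, $n\neq4$, be an Einstein manifold, $\mathrm{Ric}=c\,h$ with $c\in\mathbb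 R$. (1) Let $\rho\in C^\infty(N)$ be such that the identity $\mathbf 1:(N,h)\to(N,e^{2\rho}h)$ is biharmonic. Then $\rho$ is isoparametric, in the following (local) sense: every point $q$ with $d\rho_q\neq0$ has an open neighbourhood on which $\rho$ is isoparametric. If moreover, for every $t\in\mathbb R$, the level $\{p\in N: d\rho_p\neq0,\ \rho(p)=t\}$ is connected or empty, then $\rho$ is isoparametric on the whole of $N$. (2) Conversely, let $f\in C^\infty(N)$ be isoparametric on an open set $U\subseteq N$ (for instance $U=N$), and let $q\in U$ with $df_q\neq0$. Then there are $\varepsilon>0$ and $r\in C^\infty(\mathbb R)$ with $r'\neq0$ on $J=(f(q)-\varepsilon,f(q)+\varepsilon)$ such that, for $\rho=r\circ f$, the identity $\mathbf 1:(N,h)\to(N,e^{2\rho}h)$ is biharmonic on the open set $\{p\in U: df_p\neq0,\ f(p)\in J\}$. (3) Let $U\subseteq N$ be open and let $s\in C^\infty(N)$ satisfy $|ds|^2=1$ and $\Delta s=\sigma\circ s$ on $U$, with $\sigma$ smooth on $s(U)$. Let $r\in C^\infty(\mathbb R)$, $y=r'$. Then, for $\rho=r\circ s$, the identity $\mathbf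 1:(N,h)\to(N,e^{2\rho}h)$ is biharmonic on $U$ if and only if, on $s(U)$, $$y''-\sigma y'+(4-n)\,y\,y'+(2c-\sigma')\,y+2\sigma y^2+(2-n)\,y^3=0 .$$ -/

import Mathlib

open Set Topology
open scoped Manifold ContDiff Bundle

noncomputable section

namespace Biharm

/-! ### Tensor calculus in coordinates

A metric on (an open part of) `ℝⁿ` is given by its matrix of components `g x i j = g_{ij}(x)`. -/

/-- Coordinate space. -/
abbrev Coord (n : ℕ) := EuclideanSpace ℝ (Fin n)

/-- The partial derivative `∂_i u (x)`. -/
def pd {n : ℕ} (i : Fin n) (u : Coord n → ℝ) (x : Coord n) : ℝ :=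
  fderiv ℝ u x (EuclideanSpace.single i 1)

/-- The Christoffel symbol `Γ^k_{ij}` of the Levi-Civita connection of `g`. -/
def christoffel {n : ℕ} (g : Coord n → Matrix (Fin n) (Fin n) ℝ) (k i j : Fin n)
    (x : Coord n) : ℝ :=
  (1 / 2) * ∑ l, (g x)⁻¹ k l *
    (pd i (fun y => g y j l) x + pd j (fun y => g y i l) x - pd l (fun y => g y i j) x)

/-- The components `R^l_{kij}` of the curvature, `R(∂_i, ∂_j) ∂_k = ∑_l R^l_{kij} ∂_l`, where
`R(X, Y) = [∇_X, ∇_Y] - ∇_{[X, Y]}`. -/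
def curvature {n : ℕ} (g : Coord n → Matrix (Fin n) (Fin n) ℝ) (l k i j : Fin n)
    (x : Coord n) : ℝ :=
  pd i (christoffel g l j k) x - pd j (christoffel g l i k) x
    + ∑ m, (christoffel g l i m x * christoffel g m j k x
        - christoffel g l j m x * christoffel g m i k x)

/-- The Ricci tensor `Ric_{jk}`: the trace of `X ↦ R(X, ∂_j) ∂_k`. -/
def ricci {n : ℕ} (g : Coord n → Matrix (Fin n) (Fin n) ℝ) (j k : Fin n) (x : Coord n) : ℝ :=
  ∑ i, curvature g i k i j x

/-- `|du|²` for the metric `g`. -/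
def coordGradNormSq {n : ℕ} (g : Coord n → Matrix (Fin n) (Fin n) ℝ) (u : Coord n → ℝ)
    (x : Coord n) : ℝ :=
  ∑ i, ∑ j, (g x)⁻¹ i j * (pd i u x * pd j u x)

/-- The Laplacian `Δu = d^* d u = - trace ∇ du`. -/
def coordLaplacian {n : ℕ} (g : Coord n → Matrix (Fin n) (Fin n) ℝ) (u : Coord n → ℝ)
    (x : Coord n) : ℝ :=
  -∑ i, ∑ j, (g x)⁻¹ i j * (pd i (pd j u) x - ∑ k, christoffel g k i j x * pd k u x)

/-- The component `τ^a` of the tension field `τ(φ) = trace_g ∇dφ` of `φ`, for the metric `g` on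
the domain and the metric `h` on the codomain. -/
def tension {m n : ℕ} (g : Coord m → Matrix (Fin m) (Fin m) ℝ)
    (h : Coord n → Matrix (Fin n) (Fin n) ℝ) (φ : Coord m → Coord n) (a : Fin n)
    (x : Coord m) : ℝ :=
  ∑ i, ∑ j, (g x)⁻¹ i j *
    (pd i (pd j (fun y => φ y a)) x
      - ∑ k, christoffel g k i j x * pd k (fun y => φ y a) x
      + ∑ b, ∑ c, christoffel h a b c (φ x)
          * (pd i (fun y => φ y b) x * pd j (fun y => φ y c) x))

/-- The component `a` of `∇^φ_{∂_i} V`, for a section `V` of the pull-back `φ^{-1} TN`. -/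
def pullbackDeriv {m n : ℕ} (h : Coord n → Matrix (Fin n) (Fin n) ℝ) (φ : Coord m → Coord n)
    (i : Fin m) (V : Fin n → Coord m → ℝ) (a : Fin n) (x : Coord m) : ℝ :=
  pd i (V a) x + ∑ b, ∑ c, christoffel h a b c (φ x) * (pd i (fun y => φ y b) x * V c x)

/-- The component `a` of `trace_g (∇^φ)² V`, for a section `V` of the pull-back `φ^{-1} TN`. -/
def traceSecondDeriv {m n : ℕ} (g : Coord m → Matrix (Fin m) (Fin m) ℝ)
    (h : Coord n → Matrix (Fin n) (Fin n) ℝ) (φ : Coord m → Coord n)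
    (V : Fin n → Coord m → ℝ) (a : Fin n) (x : Coord m) : ℝ :=
  ∑ i, ∑ j, (g x)⁻¹ i j *
    (pullbackDeriv h φ i (fun b => pullbackDeriv h φ j V b) a x
      - ∑ k, christoffel g k i j x * pullbackDeriv h φ k V a x)

/-- The component `a` of the bitension field
`τ₂(φ) = trace_g (∇^φ)² τ(φ) - trace_g R^h(dφ ·, τ(φ)) dφ ·`. -/
def bitension {m n : ℕ} (g : Coord m → Matrix (Fin m) (Fin m) ℝ)
    (h : Coord n → Matrix (Fin n) (Fin n) ℝ) (φ : Coord m → Coord n) (a : Fin n)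
    (x : Coord m) : ℝ :=
  traceSecondDeriv g h φ (fun b => tension g h φ b) a x
    - ∑ i, ∑ j, (g x)⁻¹ i j * ∑ b, ∑ c, ∑ d, curvature h a d b c (φ x)
        * (pd i (fun y => φ y b) x * tension g h φ c x * pd j (fun y => φ y d) x)

/-! ### Riemannian manifolds -/

/-- Smooth Riemannian metrics on an `n`-dimensional smooth manifold `N`. -/
abbrev Metric (n : ℕ) (N : Type*) [TopologicalSpace N] [ChartedSpace (Coord n) N]
    [IsManifold (𝓡 n) ∞ N] :=
  Bundle.ContMDiffRiemannianMetric (𝓡 n) ∞ (Coord n) (fun p : N => TangentSpace (𝓡 n) p)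

section Manifold

variable {n : ℕ} {N : Type*} [TopologicalSpace N] [ChartedSpace (Coord n) N]
  [IsManifold (𝓡 n) ∞ N]

/-- The coordinate vector field `∂_i` of the chart around `p₀`, at the point with coordinates `x`
in the target of that chart. -/
def coordVector (p₀ : N) (i : Fin n) (x : Coord n) :
    TangentSpace (𝓡 n) ((extChartAt (𝓡 n) p₀).symm x) :=
  mfderiv 𝓘(ℝ, Coord n) (𝓡 n) (extChartAt (𝓡 n) p₀).symm x
    (EuclideanSpace.single i 1 : Coord n)

/-- The components `h_{ij}` of the metric `h` in the chart around `p₀`. -/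
def components (h : Metric n N) (p₀ : N) (x : Coord n) : Matrix (Fin n) (Fin n) ℝ :=
  Matrix.of fun i j =>
    h.inner ((extChartAt (𝓡 n) p₀).symm x) (coordVector p₀ i x) (coordVector p₀ j x)

/-- `h` is an Einstein metric with Einstein constant `c`, that is, `Ric = c h`. -/
def IsEinsteinWith (h : Metric n N) (c : ℝ) : Prop :=
  ∀ p₀ : N, ∀ x ∈ (extChartAt (𝓡 n) p₀).target, ∀ i j : Fin n,
    ricci (components h p₀) i j x = c * components h p₀ x i j

/-- `|df|²` at the point `p`. -/
def gradNormSq (h : Metric n N) (f : N → ℝ) (p : N) : ℝ :=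
  coordGradNormSq (components h p) (f ∘ (extChartAt (𝓡 n) p).symm) (extChartAt (𝓡 n) p p)

/-- The Laplacian `Δf = d^* d f` at the point `p`. -/
def laplacian (h : Metric n N) (f : N → ℝ) (p : N) : ℝ :=
  coordLaplacian (components h p) (f ∘ (extChartAt (𝓡 n) p).symm) (extChartAt (𝓡 n) p p)

/-- The points of `U` at which `df ≠ 0`. -/
def regularPoints (n : ℕ) {N : Type*} [TopologicalSpace N] [ChartedSpace (Coord n) N]
    (f : N → ℝ) (U : Set N) : Set N :=
  {p | p ∈ U ∧ mfderiv (𝓡 n) 𝓘(ℝ, ℝ) f p ≠ 0}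

/-- `f` is isoparametric on the open set `U`: there are functions `γ`, `σ`, smooth on the (open)
set of values of `f` at regular points in `U`, with `|df|² = γ ∘ f` and `Δf = σ ∘ f` at all points
of `U` where `df ≠ 0`. -/
def IsIsoparametricOn (h : Metric n N) (f : N → ℝ) (U : Set N) : Prop :=
  ∃ γ σ : ℝ → ℝ, ContDiffOn ℝ ∞ γ (f '' regularPoints n f U) ∧
    ContDiffOn ℝ ∞ σ (f '' regularPoints n f U) ∧
    ∀ p ∈ regularPoints n f U, gradNormSq h f p = γ (f p) ∧ laplacian h f p = σ (f p)

set_option synthInstance.maxHeartbeats 400000 in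
set_option maxHeartbeats 1000000 in
/-- The conformally changed metric `e^{2ρ} h`. -/
def conformal (h : Metric n N) (ρ : C^∞⟮𝓡 n, N; ℝ⟯) : Metric n N where
  inner p := Real.exp (2 * ρ p) • h.inner p
  symm p v w := by simp [h.symm p v w]
  pos p v hv := by simpa using mul_pos (Real.exp_pos _) (h.pos p v hv)
  isVonNBounded p := by
    refine ((h.isVonNBounded p).image
      ((Real.exp (ρ p))⁻¹ • ContinuousLinearMap.id ℝ (TangentSpace (𝓡 n) p))).subset ?_
    intro v hv
    have h2 : Real.exp (2 * ρ p) = Real.exp (ρ p) * Real.exp (ρ p) := by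
      rw [← Real.exp_add, two_mul]
    refine ⟨Real.exp (ρ p) • v, ?_, ?_⟩
    · simpa [h2, mul_assoc] using hv
    · simp [smul_smul, (Real.exp_pos (ρ p)).ne']
  contMDiff := by
    have h1 : ContMDiff (𝓡 n) 𝓘(ℝ, ℝ) ∞ (fun p => Real.exp (2 * ρ p)) :=
      (Real.contDiff_exp.comp (contDiff_const.mul contDiff_id) :
        ContDiff ℝ ∞ (fun t : ℝ => Real.exp (2 * t))).contMDiff.comp ρ.contMDiff
    exact h1.smul_section h.contMDiff

end Manifold

/-- The map `φ : (M, g) → (N, h)` is biharmonic on the open set `U`: it is smooth on `U` and its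
bitension field vanishes there. The bitension field is computed, around each point `p₀` of `U`, in
the charts around `p₀` and `φ p₀`, on the whole domain of the coordinate expression of `φ`. -/
def IsBiharmonicOn {m n : ℕ} {M N : Type*} [TopologicalSpace M] [ChartedSpace (Coord m) M]
    [IsManifold (𝓡 m) ∞ M] [TopologicalSpace N] [ChartedSpace (Coord n) N]
    [IsManifold (𝓡 n) ∞ N] (g : Metric m M) (h : Metric n N) (φ : M → N) (U : Set M) : Prop :=
  ContMDiffOn (𝓡 m) (𝓡 n) ∞ φ U ∧
  ∀ p₀ ∈ U, ∀ p ∈ U, p ∈ (extChartAt (𝓡 m) p₀).source →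
    φ p ∈ (extChartAt (𝓡 n) (φ p₀)).source → ∀ a : Fin n,
      bitension (components g p₀) (components h (φ p₀))
        (writtenInExtChartAt (𝓡 m) (𝓡 n) p₀ φ) a (extChartAt (𝓡 m) p₀ p) = 0

/-- The map `φ : (M, g) → (N, h)` is biharmonic. -/
def IsBiharmonic {m n : ℕ} {M N : Type*} [TopologicalSpace M] [ChartedSpace (Coord m) M]
    [IsManifold (𝓡 m) ∞ M] [TopologicalSpace N] [ChartedSpace (Coord n) N]
    [IsManifold (𝓡 n) ∞ N] (g : Metric m M) (h : Metric n N) (φ : M → N) : Prop :=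
  IsBiharmonicOn g h φ univ

end Biharm

end

noncomputable section

namespace Biharm

/-! ### Partial derivatives of scalar, vector and matrix valued functions -/

section PartialDerivatives

variable {n : ℕ} {Ω : Set (Coord n)} {x : Coord n} {u v : Coord n → ℝ}

/-! The tension field of the identity `(N, h) → (N, e^{2ρ} h)` is `(2 - n) grad ρ`. Combining the
Bochner formula with the conformal transformation of connection and curvature, its bitension field
for Einstein `h` is `2 - n` times the metric dual of the one-form `-dΔρ + ((6 - n)/2) d|dρ|² + (2Δρ
+ (2 - n)|dρ|² + 2c) dρ` (`bitension_conformal`, `conformalForm`). As `n > 2`, biharmonicity means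
that this form vanishes (`bitension_eq_zero_iff`).

If it does, its exterior derivative gives `2 dΔρ ∧ dρ + (2 - n) d|dρ|² ∧ dρ = 0`, while its wedge
product with `dρ` gives `dΔρ ∧ dρ = ((6 - n)/2) d|dρ|² ∧ dρ`. Together, `(8 - 2n) d|dρ|² ∧ dρ = 0`.
For `n ≠ 4` both `d|dρ|²` and `dΔρ` are therefore multiples of `dρ` (`pd_mul_pd_of_conformalForm`).
Where `dρ ≠ 0`, straightening `ρ` turns this into smooth dependence on `ρ` (`exists_factorization`).
On a connected regular level the local functions of `ρ` must agree, which gives the global statement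
(`exists_global_factorization`).

Conversely, if `|df|² = γ ∘ f` and `Δf = σ ∘ f`, the one-form of `r ∘ f` is a function of `f` times
`df` (`conformalForm_comp`). At regular points, biharmonicity is thus an ordinary differential
equation of second order for `r'`, with leading coefficient `γ > 0`. It is locally solvable with `r'
≠ 0` (`exists_contDiff_deriv_eq`), and `γ = 1` gives the equation of the third part.

All computations are made in charts. Since `|df|²` and `Δf` are defined at each point by the chart
around that very point, their invariance under changes of charts is needed; it follows from the
uniqueness of the Levi-Civita connection. -/

lemma pd_congr_of_eventuallyEq (i : Fin n) (h : u =ᶠ[𝓝 x] v) : pd i u x = pd i v x := by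
  rw [pd, pd, h.fderiv_eq]

/-- The functions below are total, but their identities hold only on an open set; this lets such
identities be differentiated. -/
lemma pd_congr (hΩ : IsOpen Ω) (hx : x ∈ Ω) (i : Fin n) (h : ∀ y ∈ Ω, u y = v y) :
    pd i u x = pd i v x :=
  pd_congr_of_eventuallyEq i (Filter.eventuallyEq_of_mem (hΩ.mem_nhds hx) h)

@[simp] lemma pd_const (i : Fin n) (c : ℝ) : pd i (fun _ => c) x = 0 := by
  simp [pd]

lemma pd_add (i : Fin n) (hu : DifferentiableAt ℝ u x) (hv : DifferentiableAt ℝ v x) :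
    pd i (fun y => u y + v y) x = pd i u x + pd i v x := by
  simp [pd, fderiv_fun_add hu hv]

lemma pd_sub (i : Fin n) (hu : DifferentiableAt ℝ u x) (hv : DifferentiableAt ℝ v x) :
    pd i (fun y => u y - v y) x = pd i u x - pd i v x := by
  simp [pd, fderiv_fun_sub hu hv]

lemma pd_neg (i : Fin n) : pd i (fun y => - u y) x = - pd i u x := by
  simp [pd, fderiv_fun_neg]

lemma pd_mul (i : Fin n) (hu : DifferentiableAt ℝ u x) (hv : DifferentiableAt ℝ v x) :
    pd i (fun y => u y * v y) x = pd i u x * v x + u x * pd i v x := by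
  simp [pd, fderiv_fun_mul hu hv]
  ring

lemma pd_const_mul (i : Fin n) (c : ℝ) (hv : DifferentiableAt ℝ v x) :
    pd i (fun y => c * v y) x = c * pd i v x := by
  simp [pd, fderiv_const_mul hv]

lemma pd_sum {ι : Type*} (s : Finset ι) {w : ι → Coord n → ℝ} (i : Fin n)
    (hw : ∀ k ∈ s, DifferentiableAt ℝ (w k) x) :
    pd i (fun y => ∑ k ∈ s, w k y) x = ∑ k ∈ s, pd i (w k) x := by
  simp [pd, fderiv_fun_sum hw]

lemma pd_comp (i : Fin n) {r : ℝ → ℝ} (hr : DifferentiableAt ℝ r (u x))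
    (hu : DifferentiableAt ℝ u x) :
    pd i (fun y => r (u y)) x = deriv r (u x) * pd i u x := by
  have := (hr.hasDerivAt.comp_hasFDerivAt x hu.hasFDerivAt).fderiv
  simp only [pd]
  erw [this]
  simp

lemma pd_coord (i b : Fin n) : pd i (fun y : Coord n => y b) x = if i = b then 1 else 0 := by
  have h : HasFDerivAt (fun y : Coord n => y b)
      (EuclideanSpace.proj b : Coord n →L[ℝ] ℝ) x :=
    (EuclideanSpace.proj b : Coord n →L[ℝ] ℝ).hasFDerivAt
  simp [pd, h.fderiv, eq_comm]

lemma fderiv_eq_sum_pd (w : Coord n) : fderiv ℝ u x w = ∑ i, w i * pd i u x := by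
  conv_lhs => rw [show w = ∑ i, w i • (EuclideanSpace.single i (1 : ℝ) : Coord n) by
    ext j; simp [Pi.single_apply]]
  simp [pd]

lemma contDiffOn_pd (hΩ : IsOpen Ω) (hu : ContDiffOn ℝ ∞ u Ω) (i : Fin n) :
    ContDiffOn ℝ ∞ (pd i u) Ω :=
  (hu.fderiv_of_isOpen hΩ (by simp)).clm_apply contDiffOn_const

lemma differentiableAt_of_contDiffOn {E F : Type*} [NormedAddCommGroup E] [NormedSpace ℝ E]
    [NormedAddCommGroup F] [NormedSpace ℝ F] {Ω : Set E} {u : E → F} {x : E}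
    (hu : ContDiffOn ℝ ∞ u Ω) (hΩ : IsOpen Ω) (hx : x ∈ Ω) : DifferentiableAt ℝ u x :=
  (hu.contDiffAt (hΩ.mem_nhds hx)).differentiableAt (by simp)

lemma pd_comm (hΩ : IsOpen Ω) (hu : ContDiffOn ℝ ∞ u Ω) (hx : x ∈ Ω) (i j : Fin n) :
    pd i (pd j u) x = pd j (pd i u) x := by
  have h2 : ContDiffAt ℝ ∞ u x := hu.contDiffAt (hΩ.mem_nhds hx)
  have hs := h2.isSymmSndFDerivAt (n := ∞) (by simpa using WithTop.coe_le_coe.2 (le_top : (2 : ℕ∞) ≤ ⊤))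
  have hd : DifferentiableAt ℝ (fderiv ℝ u) x :=
    differentiableAt_of_contDiffOn (hu.fderiv_of_isOpen hΩ (m := ∞) (by simp)) hΩ hx
  have key : ∀ a b : Fin n, pd a (pd b u) x =
      fderiv ℝ (fderiv ℝ u) x (EuclideanSpace.single a 1) (EuclideanSpace.single b 1) := by
    intro a b
    have := (hd.hasFDerivAt.clm_apply (hasFDerivAt_const
      (EuclideanSpace.single b (1 : ℝ) : Coord n) x)).fderiv
    change fderiv ℝ (fun y => fderiv ℝ u y (EuclideanSpace.single b 1)) x _ = _
    rw [this]
    simp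
  rw [key, key, hs.eq]

/-- The partial derivative of a matrix of functions. -/
def pdMat {m k : ℕ} (i : Fin n) (M : Coord n → Matrix (Fin m) (Fin k) ℝ) (x : Coord n) :
    Matrix (Fin m) (Fin k) ℝ :=
  Matrix.of fun a b => pd i (fun y => M y a b) x

/-- The partial derivative of a vector of functions. -/
def pdVec {m : ℕ} (i : Fin n) (V : Coord n → Fin m → ℝ) (x : Coord n) : Fin m → ℝ :=
  fun a => pd i (fun y => V y a) x

/-- A matrix of smooth functions. -/
def SmoothMat {m k : ℕ} (M : Coord n → Matrix (Fin m) (Fin k) ℝ) (Ω : Set (Coord n)) : Prop :=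
  ∀ a b, ContDiffOn ℝ ∞ (fun y => M y a b) Ω

/-- A vector of smooth functions. -/
def SmoothVec {m : ℕ} (V : Coord n → Fin m → ℝ) (Ω : Set (Coord n)) : Prop :=
  ∀ a, ContDiffOn ℝ ∞ (fun y => V y a) Ω

variable {m k l : ℕ} {M M' : Coord n → Matrix (Fin m) (Fin k) ℝ}
  {P : Coord n → Matrix (Fin k) (Fin l) ℝ} {V W : Coord n → Fin k → ℝ}

lemma SmoothMat.mul (hM : SmoothMat M Ω) (hP : SmoothMat P Ω) :
    SmoothMat (fun y => M y * P y) Ω := fun a b => by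
  simp only [Matrix.mul_apply]
  exact ContDiffOn.sum fun c _ => (hM a c).mul (hP c b)

lemma SmoothMat.transpose (hM : SmoothMat M Ω) : SmoothMat (fun y => (M y).transpose) Ω :=
  fun a b => hM b a

lemma SmoothMat.mulVec (hM : SmoothMat M Ω) (hV : SmoothVec V Ω) :
    SmoothVec (fun y => (M y).mulVec (V y)) Ω := fun a => by
  simp only [Matrix.mulVec, dotProduct]
  exact ContDiffOn.sum fun c _ => (hM a c).mul (hV c)

lemma SmoothMat.pdMat (hΩ : IsOpen Ω) (hM : SmoothMat M Ω) (i : Fin n) :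
    SmoothMat (pdMat i M) Ω := fun a b => contDiffOn_pd hΩ (hM a b) i

lemma SmoothVec.pdVec (hΩ : IsOpen Ω) (hV : SmoothVec V Ω) (i : Fin n) :
    SmoothVec (pdVec i V) Ω := fun a => contDiffOn_pd hΩ (hV a) i

lemma SmoothVec.sub (hV : SmoothVec V Ω) (hW : SmoothVec W Ω) :
    SmoothVec (fun y => V y - W y) Ω := fun a => (hV a).sub (hW a)

lemma contDiffOn_det {M : Coord n → Matrix (Fin m) (Fin m) ℝ} (hM : SmoothMat M Ω) :
    ContDiffOn ℝ ∞ (fun y => (M y).det) Ω := by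
  simp only [Matrix.det_apply']
  exact ContDiffOn.sum fun σ _ => contDiffOn_const.mul (contDiffOn_prod fun i _ => hM _ _)

/-- Cramer's rule: each entry of the inverse is a quotient of determinants of smooth matrices. -/
lemma SmoothMat.inv {M : Coord n → Matrix (Fin m) (Fin m) ℝ} (hM : SmoothMat M Ω)
    (hdet : ∀ y ∈ Ω, (M y).det ≠ 0) : SmoothMat (fun y => (M y)⁻¹) Ω := fun a b => by
  simp only [Matrix.inv_def, Ring.inverse_eq_inv', Matrix.smul_apply, smul_eq_mul,
    Matrix.adjugate_apply]
  refine ((contDiffOn_det hM).inv hdet).mul (contDiffOn_det fun c d => ?_)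
  by_cases h : c = b
  · subst h; simpa using contDiffOn_const
  · simpa [Matrix.updateRow_ne h] using hM c d

lemma pdMat_congr (hΩ : IsOpen Ω) (hx : x ∈ Ω) (i : Fin n) (h : ∀ y ∈ Ω, M y = M' y) :
    pdMat i M x = pdMat i M' x := by
  ext a b
  exact pd_congr hΩ hx i fun y hy => by rw [h y hy]

lemma pdVec_congr (hΩ : IsOpen Ω) (hx : x ∈ Ω) (i : Fin n) (h : ∀ y ∈ Ω, V y = W y) :
    pdVec i V x = pdVec i W x := by
  ext a
  exact pd_congr hΩ hx i fun y hy => by rw [h y hy]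

lemma pdMat_add (hΩ : IsOpen Ω) (hx : x ∈ Ω) (i : Fin n) (hM : SmoothMat M Ω)
    (hM' : SmoothMat M' Ω) : pdMat i (fun y => M y + M' y) x = pdMat i M x + pdMat i M' x := by
  ext a b
  exact pd_add i (differentiableAt_of_contDiffOn (hM a b) hΩ hx)
    (differentiableAt_of_contDiffOn (hM' a b) hΩ hx)

lemma pdMat_mul (hΩ : IsOpen Ω) (hx : x ∈ Ω) (i : Fin n) (hM : SmoothMat M Ω)
    (hP : SmoothMat P Ω) :
    pdMat i (fun y => M y * P y) x = pdMat i M x * P x + M x * pdMat i P x := by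
  ext a b
  simp only [pdMat, Matrix.of_apply, Matrix.mul_apply, Matrix.add_apply]
  have hM' := fun a b => differentiableAt_of_contDiffOn (hM a b) hΩ hx
  have hP' := fun a b => differentiableAt_of_contDiffOn (hP a b) hΩ hx
  rw [pd_sum _ _ fun c _ => (hM' a c).fun_mul (hP' c b), ← Finset.sum_add_distrib]
  exact Finset.sum_congr rfl fun c _ => pd_mul i (hM' a c) (hP' c b)

lemma pdVec_mulVec (hΩ : IsOpen Ω) (hx : x ∈ Ω) (i : Fin n) (hM : SmoothMat M Ω)
    (hV : SmoothVec V Ω) :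
    pdVec i (fun y => (M y).mulVec (V y)) x =
      (pdMat i M x).mulVec (V x) + (M x).mulVec (pdVec i V x) := by
  ext a
  simp only [pdMat, pdVec, Matrix.of_apply, Matrix.mulVec, dotProduct, Pi.add_apply]
  have hM' := fun a b => differentiableAt_of_contDiffOn (hM a b) hΩ hx
  have hV' := fun a => differentiableAt_of_contDiffOn (hV a) hΩ hx
  rw [pd_sum _ _ fun c _ => (hM' a c).fun_mul (hV' c), ← Finset.sum_add_distrib]
  exact Finset.sum_congr rfl fun c _ => pd_mul i (hM' a c) (hV' c)

lemma pdVec_add (hΩ : IsOpen Ω) (hx : x ∈ Ω) (i : Fin n) (hV : SmoothVec V Ω)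
    (hW : SmoothVec W Ω) : pdVec i (fun y => V y + W y) x = pdVec i V x + pdVec i W x := by
  ext a
  exact pd_add i (differentiableAt_of_contDiffOn (hV a) hΩ hx)
    (differentiableAt_of_contDiffOn (hW a) hΩ hx)

lemma pdVec_comm (hΩ : IsOpen Ω) (hx : x ∈ Ω) (hV : SmoothVec V Ω) (i j : Fin n) :
    pdVec i (pdVec j V) x = pdVec j (pdVec i V) x := by
  ext a
  exact pd_comm hΩ (hV a) hx i j

lemma pdMat_comm (hΩ : IsOpen Ω) (hx : x ∈ Ω) (hM : SmoothMat M Ω) (i j : Fin n) :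
    pdMat i (pdMat j M) x = pdMat j (pdMat i M) x := by
  ext a b
  exact pd_comm hΩ (hM a b) hx i j

end PartialDerivatives

/-! ### The Levi-Civita connection in coordinates -/

/-- `g` is a smooth nondegenerate symmetric matrix of functions on the open set `Ω`. -/
structure IsMetricOn {n : ℕ} (g : Coord n → Matrix (Fin n) (Fin n) ℝ) (Ω : Set (Coord n)) :
    Prop where
  isOpen : IsOpen Ω
  smooth : SmoothMat g Ω
  symm : ∀ y ∈ Ω, (g y).transpose = g y
  det_ne : ∀ y ∈ Ω, (g y).det ≠ 0

/-- The matrix `(Γ^a_{ib})_{ab}` of the connection in the direction `∂_i`. -/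
def connMat {n : ℕ} (g : Coord n → Matrix (Fin n) (Fin n) ℝ) (i : Fin n) (x : Coord n) :
    Matrix (Fin n) (Fin n) ℝ :=
  Matrix.of fun a b => christoffel g a i b x

/-- The matrix `(R^a_{bij})_{ab}` of the curvature operator `R(∂_i, ∂_j)`. -/
def curvMat {n : ℕ} (g : Coord n → Matrix (Fin n) (Fin n) ℝ) (i j : Fin n) (x : Coord n) :
    Matrix (Fin n) (Fin n) ℝ :=
  Matrix.of fun a b => curvature g a b i j x

namespace IsMetricOn

variable {n : ℕ} {g : Coord n → Matrix (Fin n) (Fin n) ℝ} {Ω : Set (Coord n)} {x : Coord n}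

lemma apply_symm (hg : IsMetricOn g Ω) (hx : x ∈ Ω) (i j : Fin n) : g x i j = g x j i :=
  congr_fun (congr_fun (hg.symm x hx) j) i

lemma inv_mul (hg : IsMetricOn g Ω) (hx : x ∈ Ω) : (g x)⁻¹ * g x = 1 :=
  Matrix.nonsing_inv_mul _ (hg.det_ne x hx).isUnit

lemma mul_inv (hg : IsMetricOn g Ω) (hx : x ∈ Ω) : g x * (g x)⁻¹ = 1 :=
  Matrix.mul_nonsing_inv _ (hg.det_ne x hx).isUnit

lemma inv_symm (hg : IsMetricOn g Ω) (hx : x ∈ Ω) : ((g x)⁻¹).transpose = (g x)⁻¹ := by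
  rw [Matrix.transpose_nonsing_inv, hg.symm x hx]

lemma inv_apply_symm (hg : IsMetricOn g Ω) (hx : x ∈ Ω) (i j : Fin n) :
    (g x)⁻¹ i j = (g x)⁻¹ j i :=
  congr_fun (congr_fun (hg.inv_symm hx) j) i

lemma smooth_inv (hg : IsMetricOn g Ω) : SmoothMat (fun y => (g y)⁻¹) Ω :=
  hg.smooth.inv hg.det_ne

lemma contDiffOn_christoffel (hg : IsMetricOn g Ω) (k i j : Fin n) :
    ContDiffOn ℝ ∞ (christoffel g k i j) Ω := by
  unfold christoffel
  refine contDiffOn_const.mul (ContDiffOn.sum fun l _ => (hg.smooth_inv k l).mul ?_)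
  exact ((contDiffOn_pd hg.isOpen (hg.smooth j l) i).add
    (contDiffOn_pd hg.isOpen (hg.smooth i l) j)).sub (contDiffOn_pd hg.isOpen (hg.smooth i j) l)

lemma smooth_connMat (hg : IsMetricOn g Ω) (i : Fin n) : SmoothMat (connMat g i) Ω :=
  fun a b => hg.contDiffOn_christoffel a i b

lemma pd_symm (hg : IsMetricOn g Ω) (hx : x ∈ Ω) (k i j : Fin n) :
    pd k (fun y => g y i j) x = pd k (fun y => g y j i) x :=
  pd_congr hg.isOpen hx k fun _ hy => hg.apply_symm hy i j

lemma christoffel_symm (hg : IsMetricOn g Ω) (hx : x ∈ Ω) (k i j : Fin n) :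
    christoffel g k i j x = christoffel g k j i x := by
  simp only [christoffel]
  congr 1
  refine Finset.sum_congr rfl fun l _ => ?_
  rw [hg.pd_symm hx l i j]
  ring

/-- The Christoffel symbols with a lowered index. -/
lemma sum_mul_christoffel (hg : IsMetricOn g Ω) (hx : x ∈ Ω) (m i j : Fin n) :
    ∑ k, g x m k * christoffel g k i j x = (1 / 2) *
      (pd i (fun y => g y j m) x + pd j (fun y => g y i m) x - pd m (fun y => g y i j) x) := by
  let w : Fin n → ℝ := fun l =>
    pd i (fun y => g y j l) x + pd j (fun y => g y i l) x - pd l (fun y => g y i j) x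
  have h : (g x).mulVec ((g x)⁻¹.mulVec w) = w := by
    rw [Matrix.mulVec_mulVec, hg.mul_inv hx, Matrix.one_mulVec]
  have h' := congr_fun h m
  simp only [Matrix.mulVec, dotProduct, w] at h'
  simp only [christoffel]
  rw [← h', Finset.mul_sum]
  exact Finset.sum_congr rfl fun k _ => by ring

/-- The connection is compatible with the metric. -/
lemma pdMat_metric (hg : IsMetricOn g Ω) (hx : x ∈ Ω) (i : Fin n) :
    pdMat i g x = (connMat g i x).transpose * g x + g x * connMat g i x := by
  ext a b
  have h1 := hg.sum_mul_christoffel hx a i b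
  have h2 := hg.sum_mul_christoffel hx b i a
  have h3 : ∑ k, christoffel g k i a x * g x k b = ∑ k, g x b k * christoffel g k i a x :=
    Finset.sum_congr rfl fun k _ => by rw [hg.apply_symm hx k b]; ring
  simp only [pdMat, connMat, Matrix.of_apply, Matrix.add_apply, Matrix.mul_apply,
    Matrix.transpose_apply]
  rw [h3, h1, h2, hg.pd_symm hx i b a]
  ring

/-- Differentiate `g⁻¹ g = 1` and insert the compatibility of the connection with `g`. -/
lemma pdMat_inv (hg : IsMetricOn g Ω) (hx : x ∈ Ω) (i : Fin n) :
    pdMat i (fun y => (g y)⁻¹) x =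
      -((g x)⁻¹ * (connMat g i x).transpose) - connMat g i x * (g x)⁻¹ := by
  have h0 : pdMat i (fun y => (g y)⁻¹ * g y) x = 0 := by
    rw [pdMat_congr (M' := fun _ => 1) hg.isOpen hx i fun y hy => hg.inv_mul hy]
    ext a b
    simp [pdMat]
  rw [pdMat_mul hg.isOpen hx i hg.smooth_inv hg.smooth, hg.pdMat_metric hx] at h0
  have h1 := eq_neg_of_add_eq_zero_left h0
  calc pdMat i (fun y => (g y)⁻¹) x
      = (pdMat i (fun y => (g y)⁻¹) x * g x) * (g x)⁻¹ := by
        rw [mul_assoc, hg.mul_inv hx, mul_one]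
    _ = -((g x)⁻¹ * (connMat g i x).transpose * (g x * (g x)⁻¹))
          - (g x)⁻¹ * g x * connMat g i x * (g x)⁻¹ := by
        rw [h1]; noncomm_ring
    _ = _ := by rw [hg.mul_inv hx, hg.inv_mul hx, mul_one, one_mul]

/-- The matrix form `dA + A ∧ A` of the curvature, which lets noncommutative matrix algebra replace
index sums. -/
lemma _root_.Biharm.curvMat_eq (g : Coord n → Matrix (Fin n) (Fin n) ℝ) (x : Coord n) (i j : Fin n) :
    curvMat g i j x = pdMat i (connMat g j) x - pdMat j (connMat g i) x
      + connMat g i x * connMat g j x - connMat g j x * connMat g i x := by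
  ext a b
  simp [curvMat, curvature, pdMat, connMat, Matrix.mul_apply, Finset.sum_sub_distrib]
  ring

/-- `R(∂_i, ∂_j)` is skew-symmetric for the metric. -/
lemma curvMat_skew (hg : IsMetricOn g Ω) (hx : x ∈ Ω) (i j : Fin n) :
    (curvMat g i j x).transpose * g x + g x * curvMat g i j x = 0 := by
  -- Differentiate the compatibility relation once more; the symmetry of second derivatives in `i`
  -- and `j` then leaves exactly the curvature terms.
  have key : ∀ i j : Fin n, pdMat i (pdMat j g) x =
      (pdMat i (connMat g j) x).transpose * g x
        + (connMat g j x).transpose * ((connMat g i x).transpose * g x + g x * connMat g i x)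
        + ((connMat g i x).transpose * g x + g x * connMat g i x) * connMat g j x
        + g x * pdMat i (connMat g j) x := by
    intro i j
    have hC := hg.smooth_connMat j
    rw [pdMat_congr hg.isOpen hx i fun y hy => hg.pdMat_metric hy j,
      pdMat_add hg.isOpen hx i (hC.transpose.mul hg.smooth) (hg.smooth.mul hC),
      pdMat_mul hg.isOpen hx i hC.transpose hg.smooth, pdMat_mul hg.isOpen hx i hg.smooth hC,
      hg.pdMat_metric hx i]
    have : pdMat i (fun y => (connMat g j y).transpose) x =
      (pdMat i (connMat g j) x).transpose := rfl
    rw [this]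
    abel
  have h := pdMat_comm hg.isOpen hx hg.smooth i j
  rw [key, key] at h
  rw [curvMat_eq, ← sub_eq_zero.mpr h]
  simp only [Matrix.transpose_sub, Matrix.transpose_add, Matrix.transpose_mul]
  noncomm_ring

end IsMetricOn

end Biharm

end

noncomputable section

namespace Biharm

/-! ### Gradient and Hessian in coordinates -/

section Hessian

variable {n : ℕ}

/-- The Kronecker symbol. -/
def delta (a b : Fin n) : ℝ := if a = b then 1 else 0

lemma sum_delta_mul (a : Fin n) (f : Fin n → ℝ) : ∑ m, delta a m * f m = f a := by
  simp [delta]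

lemma sum_delta_mul' (a : Fin n) (f : Fin n → ℝ) : ∑ m, delta m a * f m = f a := by
  simp [delta]

lemma sum_mul_delta' (a : Fin n) (f : Fin n → ℝ) : ∑ m, f m * delta m a = f a := by
  simp [delta]

/-- The components of the differential `du`. -/
def diffVec (u : Coord n → ℝ) (x : Coord n) : Fin n → ℝ := fun i => pd i u x

/-- The components of the gradient of `u`. -/
def gradVec (g : Coord n → Matrix (Fin n) (Fin n) ℝ) (u : Coord n → ℝ) (x : Coord n) :
    Fin n → ℝ := (g x)⁻¹.mulVec (diffVec u x)

/-- The components `(∇du)_{ij}` of the Hessian of `u`, for a fixed `i`. -/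
def hessVec (g : Coord n → Matrix (Fin n) (Fin n) ℝ) (u : Coord n → ℝ) (i : Fin n) (x : Coord n) :
    Fin n → ℝ := pdVec i (diffVec u) x - (connMat g i x).transpose.mulVec (diffVec u x)

/-- The components of `∇_{∂_i} grad u`. -/
def hessEnd (g : Coord n → Matrix (Fin n) (Fin n) ℝ) (u : Coord n → ℝ) (i : Fin n) (x : Coord n) :
    Fin n → ℝ := (g x)⁻¹.mulVec (hessVec g u i x)

lemma hessVec_apply (g : Coord n → Matrix (Fin n) (Fin n) ℝ) (u : Coord n → ℝ) (i j : Fin n)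
    (x : Coord n) :
    hessVec g u i x j = pd i (pd j u) x - ∑ k, christoffel g k i j x * pd k u x := rfl

lemma coordLaplacian_eq (g : Coord n → Matrix (Fin n) (Fin n) ℝ) (u : Coord n → ℝ)
    (x : Coord n) : coordLaplacian g u x = -∑ i, hessEnd g u i x i := rfl

lemma coordGradNormSq_eq (g : Coord n → Matrix (Fin n) (Fin n) ℝ) (u : Coord n → ℝ)
    (x : Coord n) : coordGradNormSq g u x = ∑ a, pd a u x * gradVec g u x a := by
  simp only [coordGradNormSq, gradVec, Matrix.mulVec, dotProduct, diffVec, Finset.mul_sum]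
  exact Finset.sum_congr rfl fun i _ => Finset.sum_congr rfl fun j _ => by ring

variable {g : Coord n → Matrix (Fin n) (Fin n) ℝ} {u : Coord n → ℝ} {Ω : Set (Coord n)}
  {x : Coord n}

lemma smooth_diffVec (hΩ : IsOpen Ω) (hu : ContDiffOn ℝ ∞ u Ω) : SmoothVec (diffVec u) Ω :=
  fun i => contDiffOn_pd hΩ hu i

namespace IsMetricOn

lemma smooth_gradVec (hg : IsMetricOn g Ω) (hu : ContDiffOn ℝ ∞ u Ω) :
    SmoothVec (gradVec g u) Ω :=
  hg.smooth_inv.mulVec (smooth_diffVec hg.isOpen hu)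

lemma smooth_hessVec (hg : IsMetricOn g Ω) (hu : ContDiffOn ℝ ∞ u Ω) (i : Fin n) :
    SmoothVec (hessVec g u i) Ω :=
  ((smooth_diffVec hg.isOpen hu).pdVec hg.isOpen i).sub
    ((hg.smooth_connMat i).transpose.mulVec (smooth_diffVec hg.isOpen hu))

lemma smooth_hessEnd (hg : IsMetricOn g Ω) (hu : ContDiffOn ℝ ∞ u Ω) (i : Fin n) :
    SmoothVec (hessEnd g u i) Ω :=
  hg.smooth_inv.mulVec (hg.smooth_hessVec hu i)

lemma contDiffOn_coordGradNormSq (hg : IsMetricOn g Ω) (hu : ContDiffOn ℝ ∞ u Ω) :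
    ContDiffOn ℝ ∞ (coordGradNormSq g u) Ω := by
  unfold coordGradNormSq
  exact ContDiffOn.sum fun i _ => ContDiffOn.sum fun j _ => (hg.smooth_inv i j).mul
    ((contDiffOn_pd hg.isOpen hu i).mul (contDiffOn_pd hg.isOpen hu j))

lemma contDiffOn_coordLaplacian (hg : IsMetricOn g Ω) (hu : ContDiffOn ℝ ∞ u Ω) :
    ContDiffOn ℝ ∞ (coordLaplacian g u) Ω :=
  (ContDiffOn.sum fun i _ => hg.smooth_hessEnd hu i i).neg

/-- Symmetry of second derivatives, and absence of torsion. -/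
lemma hessVec_symm (hg : IsMetricOn g Ω) (hu : ContDiffOn ℝ ∞ u Ω) (hx : x ∈ Ω) (i j : Fin n) :
    hessVec g u i x j = hessVec g u j x i := by
  rw [hessVec_apply, hessVec_apply, pd_comm hg.isOpen hu hx i j]
  congr 1
  exact Finset.sum_congr rfl fun k _ => by rw [hg.christoffel_symm hx]

/-- Raising an index commutes with covariant differentiation. -/
lemma covDeriv_raise (hg : IsMetricOn g Ω) (hx : x ∈ Ω) {V : Coord n → Fin n → ℝ}
    (hV : SmoothVec V Ω) (i : Fin n) :
    pdVec i (fun y => (g y)⁻¹.mulVec (V y)) x + (connMat g i x).mulVec ((g x)⁻¹.mulVec (V x)) =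
      (g x)⁻¹.mulVec (pdVec i V x - (connMat g i x).transpose.mulVec (V x)) := by
  rw [pdVec_mulVec hg.isOpen hx i hg.smooth_inv hV, hg.pdMat_inv hx, Matrix.sub_mulVec,
    Matrix.neg_mulVec, Matrix.mulVec_sub, Matrix.mulVec_mulVec, Matrix.mulVec_mulVec]
  abel

lemma covDeriv_gradVec (hg : IsMetricOn g Ω) (hu : ContDiffOn ℝ ∞ u Ω) (hx : x ∈ Ω)
    (i : Fin n) :
    pdVec i (gradVec g u) x + (connMat g i x).mulVec (gradVec g u x) = hessEnd g u i x :=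
  hg.covDeriv_raise hx (smooth_diffVec hg.isOpen hu) i

lemma metric_mulVec_raise (hg : IsMetricOn g Ω) (hx : x ∈ Ω) (w : Fin n → ℝ) :
    (g x).mulVec ((g x)⁻¹.mulVec w) = w := by
  rw [Matrix.mulVec_mulVec, hg.mul_inv hx, Matrix.one_mulVec]

lemma dotProduct_raise (hg : IsMetricOn g Ω) (hx : x ∈ Ω) (w z : Fin n → ℝ) :
    dotProduct w ((g x)⁻¹.mulVec z) = dotProduct ((g x)⁻¹.mulVec w) z := by
  rw [Matrix.dotProduct_mulVec, ← Matrix.mulVec_transpose, hg.inv_symm hx]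

/-- `d|du|² = 2 ⟨grad u, ∇ du⟩`. -/
lemma pd_coordGradNormSq (hg : IsMetricOn g Ω) (hu : ContDiffOn ℝ ∞ u Ω) (hx : x ∈ Ω)
    (i : Fin n) :
    pd i (coordGradNormSq g u) x = 2 * ∑ a, gradVec g u x a * hessVec g u i x a := by
  have hd := fun a => differentiableAt_of_contDiffOn (contDiffOn_pd hg.isOpen hu a) hg.isOpen hx
  have hv := fun a => differentiableAt_of_contDiffOn (hg.smooth_gradVec hu a) hg.isOpen hx
  have h1 : pd i (coordGradNormSq g u) x =
      ∑ a, (pd i (pd a u) x * gradVec g u x a + pd a u x * pdVec i (gradVec g u) x a) := by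
    rw [show coordGradNormSq g u = fun y => ∑ a, pd a u y * gradVec g u y a from
      funext (coordGradNormSq_eq g u), pd_sum _ _ fun a _ => (hd a).fun_mul (hv a)]
    exact Finset.sum_congr rfl fun a _ => pd_mul i (hd a) (hv a)
  -- Differentiating `du` and `grad u` produces the same connection term with opposite signs, so the
  -- two cancel in the sum.
  have h2 : dotProduct (diffVec u x) (pdVec i (gradVec g u) x) =
      dotProduct (gradVec g u x) (hessVec g u i x)
        - dotProduct (gradVec g u x) ((connMat g i x).transpose.mulVec (diffVec u x)) := by
    rw [eq_sub_of_add_eq (hg.covDeriv_gradVec hu hx i), dotProduct_sub, hessEnd,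
      hg.dotProduct_raise hx, Matrix.dotProduct_mulVec (diffVec u x), Matrix.mulVec_transpose,
      dotProduct_comm (Matrix.vecMul _ _)]
    rfl
  have h3 : dotProduct (gradVec g u x) (pdVec i (diffVec u) x) =
      dotProduct (gradVec g u x) (hessVec g u i x)
        + dotProduct (gradVec g u x) ((connMat g i x).transpose.mulVec (diffVec u x)) := by
    rw [hessVec, dotProduct_sub]; ring
  have h4 : ∑ a, pd i (pd a u) x * gradVec g u x a =
      dotProduct (gradVec g u x) (pdVec i (diffVec u) x) :=
    Finset.sum_congr rfl fun a _ => mul_comm _ _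
  have h5 : ∑ a, pd a u x * pdVec i (gradVec g u) x a =
      dotProduct (diffVec u x) (pdVec i (gradVec g u) x) := rfl
  rw [h1, Finset.sum_add_distrib, h4, h5, h2, h3]
  simp only [dotProduct]
  ring

/-- The second covariant derivative of the gradient of `u`, in the directions `∂_i`, `∂_j`. -/
def _root_.Biharm.secondCovDeriv (g : Coord n → Matrix (Fin n) (Fin n) ℝ) (u : Coord n → ℝ)
    (i j : Fin n) (x : Coord n) : Fin n → ℝ :=
  pdVec i (hessEnd g u j) x + (connMat g i x).mulVec (hessEnd g u j x)
    - ∑ k, christoffel g k i j x • hessEnd g u k x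

/-- The Ricci identity: the part symmetric in `i` and `j` drops out, by equality of mixed partials
and absence of torsion, and the rest is the matrix form of the curvature. -/
lemma secondCovDeriv_sub (hg : IsMetricOn g Ω) (hu : ContDiffOn ℝ ∞ u Ω) (hx : x ∈ Ω)
    (i j : Fin n) :
    secondCovDeriv g u i j x - secondCovDeriv g u j i x =
      (curvMat g i j x).mulVec (gradVec g u x) := by
  have hv := hg.smooth_gradVec hu
  have key : ∀ i j, pdVec i (hessEnd g u j) x + (connMat g i x).mulVec (hessEnd g u j x) =
      pdVec i (pdVec j (gradVec g u)) x + (pdMat i (connMat g j) x).mulVec (gradVec g u x)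
        + (connMat g j x).mulVec (pdVec i (gradVec g u) x)
        + (connMat g i x).mulVec (pdVec j (gradVec g u) x)
        + (connMat g i x * connMat g j x).mulVec (gradVec g u x) := by
    intro i j
    rw [pdVec_congr hg.isOpen hx i fun y hy => (hg.covDeriv_gradVec hu hy j).symm,
      pdVec_add hg.isOpen hx i (hv.pdVec hg.isOpen j) ((hg.smooth_connMat j).mulVec hv),
      pdVec_mulVec hg.isOpen hx i (hg.smooth_connMat j) hv, ← hg.covDeriv_gradVec hu hx j,
      Matrix.mulVec_add, Matrix.mulVec_mulVec]
    abel
  have hs : ∑ k, christoffel g k i j x • hessEnd g u k x =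
      ∑ k, christoffel g k j i x • hessEnd g u k x :=
    Finset.sum_congr rfl fun k _ => by rw [hg.christoffel_symm hx]
  rw [secondCovDeriv, secondCovDeriv, key, key, hs, pdVec_comm hg.isOpen hx hv i j, curvMat_eq,
    Matrix.sub_mulVec, Matrix.add_mulVec, Matrix.sub_mulVec]
  abel

/-- The second covariant derivative with all indices lowered. -/
def _root_.Biharm.thirdDeriv (g : Coord n → Matrix (Fin n) (Fin n) ℝ) (u : Coord n → ℝ)
    (i j b : Fin n) (x : Coord n) : ℝ :=
  pd i (fun y => hessVec g u j y b) x - ∑ k, christoffel g k i b x * hessVec g u j x k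
    - ∑ k, christoffel g k i j x * hessVec g u k x b

/-- Lowering the vector index makes the symmetry of the Hessian usable in third derivatives. -/
lemma secondCovDeriv_apply (hg : IsMetricOn g Ω) (hu : ContDiffOn ℝ ∞ u Ω) (hx : x ∈ Ω)
    (i j a : Fin n) :
    secondCovDeriv g u i j x a = ∑ b, (g x)⁻¹ a b * thirdDeriv g u i j b x := by
  have h1 := congr_fun (hg.covDeriv_raise hx (hg.smooth_hessVec hu j) i) a
  have h2 : (∑ k, christoffel g k i j x • hessEnd g u k x) a =
      ∑ b, (g x)⁻¹ a b * ∑ k, christoffel g k i j x * hessVec g u k x b := by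
    simp only [Finset.sum_apply, Pi.smul_apply, smul_eq_mul, hessEnd, Matrix.mulVec, dotProduct,
      Finset.mul_sum]
    rw [Finset.sum_comm]
    exact Finset.sum_congr rfl fun b _ => Finset.sum_congr rfl fun k _ => by ring
  have h3 : secondCovDeriv g u i j x a =
      (pdVec i (fun y => (g y)⁻¹.mulVec (hessVec g u j y)) x +
        (connMat g i x).mulVec ((g x)⁻¹.mulVec (hessVec g u j x))) a
        - (∑ k, christoffel g k i j x • hessEnd g u k x) a := rfl
  rw [h3, h1, h2]
  simp only [Matrix.mulVec, dotProduct]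
  rw [← Finset.sum_sub_distrib]
  refine Finset.sum_congr rfl fun b _ => ?_
  rw [← mul_sub]
  rfl

/-- The covariant derivative of the symmetric tensor `∇du` is again symmetric in its two slots. -/
lemma thirdDeriv_symm (hg : IsMetricOn g Ω) (hu : ContDiffOn ℝ ∞ u Ω) (hx : x ∈ Ω)
    (i j b : Fin n) : thirdDeriv g u i j b x = thirdDeriv g u i b j x := by
  have h1 : ∀ k, hessVec g u j x k = hessVec g u k x j := hg.hessVec_symm hu hx j
  have h2 : ∀ k, hessVec g u k x b = hessVec g u b x k := fun k => hg.hessVec_symm hu hx k b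
  rw [thirdDeriv, thirdDeriv, pd_congr hg.isOpen hx i fun y hy => hg.hessVec_symm hu hy j b]
  simp only [h1, h2]
  ring

/-- The trace of `∇_{∂_b} ∇ grad u` is the derivative of the trace of `∇ grad u`. -/
lemma sum_secondCovDeriv (hg : IsMetricOn g Ω) (hu : ContDiffOn ℝ ∞ u Ω) (hx : x ∈ Ω)
    (b : Fin n) : ∑ i, secondCovDeriv g u b i x i = - pd b (coordLaplacian g u) x := by
  have h1 : pd b (coordLaplacian g u) x = - ∑ i, pd b (fun y => hessEnd g u i y i) x := by
    rw [show coordLaplacian g u = fun y => -∑ i, hessEnd g u i y i from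
      funext (coordLaplacian_eq g u), pd_neg, pd_sum _ _ fun i _ =>
        differentiableAt_of_contDiffOn (hg.smooth_hessEnd hu i i) hg.isOpen hx]
  -- After tracing, the connection acts on the two slots of the endomorphism `∇ grad u` by opposite
  -- amounts.
  have h2 : ∑ i, ∑ m, christoffel g i b m x * hessEnd g u i x m =
      ∑ i, ∑ k, christoffel g k b i x * hessEnd g u k x i := Finset.sum_comm
  rw [h1, neg_neg]
  simp only [secondCovDeriv, Pi.add_apply, Pi.sub_apply, Finset.sum_apply, Pi.smul_apply,
    smul_eq_mul, Matrix.mulVec, dotProduct, Finset.sum_add_distrib, Finset.sum_sub_distrib]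
  have h4 : ∑ i, ∑ m, connMat g b x i m * hessEnd g u i x m =
    ∑ i, ∑ k, christoffel g k b i x * hessEnd g u k x i := h2
  rw [h4]
  simp [pdVec]

/-- The Bochner formula: `trace ∇² grad u = - grad Δu + Ric(grad u)`. -/
lemma trace_secondCovDeriv (hg : IsMetricOn g Ω) (hu : ContDiffOn ℝ ∞ u Ω) (hx : x ∈ Ω)
    (a : Fin n) :
    ∑ i, ∑ j, (g x)⁻¹ i j * secondCovDeriv g u i j x a =
      ∑ b, (g x)⁻¹ a b * (- pd b (coordLaplacian g u) x
        + ∑ k, ricci g b k x * gradVec g u x k) := by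
  -- Commuting the two derivatives before tracing produces the Ricci term; the trace in the other
  -- order is already known.
  have h1 : ∀ b, ∑ i, secondCovDeriv g u i b x i =
      - pd b (coordLaplacian g u) x + ∑ k, ricci g b k x * gradVec g u x k := by
    intro b
    rw [← hg.sum_secondCovDeriv hu hx b]
    have : ∀ i, secondCovDeriv g u i b x i = secondCovDeriv g u b i x i
        + ∑ k, curvature g i k i b x * gradVec g u x k := fun i => by
      have := congr_fun (hg.secondCovDeriv_sub hu hx i b) i
      simp only [Pi.sub_apply, Matrix.mulVec, dotProduct, curvMat, Matrix.of_apply] at this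
      linarith
    simp only [this, Finset.sum_add_distrib, ricci, Finset.sum_mul]
    rw [Finset.sum_comm (f := fun i k => curvature g i k i b x * gradVec g u x k)]
  simp only [← h1, hg.secondCovDeriv_apply hu hx, Finset.mul_sum]
  rw [Finset.sum_comm_cycle]
  refine Finset.sum_congr rfl fun b _ => Finset.sum_congr rfl fun i _ =>
    Finset.sum_congr rfl fun j _ => ?_
  -- This symmetry exchanges the direction of differentiation with the free index, so that the trace
  -- over `i` and `j` becomes the contraction in `h1`.
  rw [hg.thirdDeriv_symm hu hx i j b]
  ring

end IsMetricOn

end Hessian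

end Biharm

end

noncomputable section

namespace Biharm

/-! ### Conformal change of the metric -/

section Conformal

variable {n : ℕ} {g gt : Coord n → Matrix (Fin n) (Fin n) ℝ} {ρ : Coord n → ℝ}
  {Ω : Set (Coord n)} {x : Coord n}

namespace IsMetricOn

lemma sum_inv_mul (hg : IsMetricOn g Ω) (hx : x ∈ Ω) (i j : Fin n) :
    ∑ l, (g x)⁻¹ i l * g x l j = delta i j := by
  rw [← Matrix.mul_apply, hg.inv_mul hx, Matrix.one_apply, delta]

lemma sum_metric_mul_gradVec (hg : IsMetricOn g Ω) (hx : x ∈ Ω) (u : Coord n → ℝ) (i : Fin n) :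
    ∑ m, g x i m * gradVec g u x m = pd i u x :=
  congr_fun (hg.metric_mulVec_raise hx (diffVec u x)) i

lemma sum_metric_mul_hessEnd (hg : IsMetricOn g Ω) (hx : x ∈ Ω) (u : Coord n → ℝ)
    (i j : Fin n) : ∑ m, g x i m * hessEnd g u j x m = hessVec g u j x i :=
  congr_fun (hg.metric_mulVec_raise hx (hessVec g u j x)) i

lemma conformal_inv (hg : IsMetricOn g Ω) (hgt : ∀ y ∈ Ω, gt y = Real.exp (2 * ρ y) • g y)
    (hx : x ∈ Ω) : (gt x)⁻¹ = Real.exp (-(2 * ρ x)) • (g x)⁻¹ := by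
  refine Matrix.inv_eq_left_inv ?_
  rw [hgt x hx, smul_mul_smul_comm, ← Real.exp_add, hg.inv_mul hx]
  simp

lemma pd_conformal (hg : IsMetricOn g Ω) (hρ : ContDiffOn ℝ ∞ ρ Ω)
    (hgt : ∀ y ∈ Ω, gt y = Real.exp (2 * ρ y) • g y) (hx : x ∈ Ω) (k i j : Fin n) :
    pd k (fun y => gt y i j) x =
      Real.exp (2 * ρ x) * (2 * pd k ρ x * g x i j + pd k (fun y => g y i j) x) := by
  have hd := differentiableAt_of_contDiffOn hρ hg.isOpen hx
  have he : DifferentiableAt ℝ (fun t : ℝ => Real.exp (2 * t)) (ρ x) := by fun_prop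
  rw [pd_congr (v := fun y => Real.exp (2 * ρ y) * g y i j) hg.isOpen hx k
      fun y hy => by rw [hgt y hy]; rfl,
    pd_mul k (by fun_prop) (differentiableAt_of_contDiffOn (hg.smooth i j) hg.isOpen hx),
    pd_comp k (r := fun t => Real.exp (2 * t)) he hd]
  have : deriv (fun t : ℝ => Real.exp (2 * t)) (ρ x) = 2 * Real.exp (2 * ρ x) := by
    have h := ((hasDerivAt_id (ρ x)).const_mul 2).exp.deriv
    simp only [id] at h
    rw [h]
    ring
  rw [this]
  ring

/-- Each of the three derivatives of `e^{2ρ} g` contributes a term `2 dρ ⊗ g`, and the exponential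
cancels against that of the inverse metric. -/
lemma christoffel_conformal (hg : IsMetricOn g Ω) (hρ : ContDiffOn ℝ ∞ ρ Ω)
    (hgt : ∀ y ∈ Ω, gt y = Real.exp (2 * ρ y) • g y) (hx : x ∈ Ω) (k i j : Fin n) :
    christoffel gt k i j x = christoffel g k i j x + delta k i * pd j ρ x + delta k j * pd i ρ x
      - g x i j * gradVec g ρ x k := by
  have h1 := hg.sum_inv_mul hx k i
  have h2 := hg.sum_inv_mul hx k j
  have he : Real.exp (-(2 * ρ x)) * Real.exp (2 * ρ x) = 1 := by
    rw [← Real.exp_add]; simp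
  have h3 : ∀ l, (gt x)⁻¹ k l * (pd i (fun y => gt y j l) x + pd j (fun y => gt y i l) x
        - pd l (fun y => gt y i j) x) =
      (g x)⁻¹ k l * (pd i (fun y => g y j l) x + pd j (fun y => g y i l) x
        - pd l (fun y => g y i j) x) + 2 * pd i ρ x * ((g x)⁻¹ k l * g x l j)
        + 2 * pd j ρ x * ((g x)⁻¹ k l * g x l i) - 2 * g x i j * ((g x)⁻¹ k l * pd l ρ x) := by
    intro l
    rw [hg.conformal_inv hgt hx, hg.pd_conformal hρ hgt hx, hg.pd_conformal hρ hgt hx,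
      hg.pd_conformal hρ hgt hx, hg.apply_symm hx l j, hg.apply_symm hx l i,
      Matrix.smul_apply, smul_eq_mul]
    linear_combination ((g x)⁻¹ k l * (2 * pd i ρ x * g x j l + pd i (fun y => g y j l) x
      + (2 * pd j ρ x * g x i l + pd j (fun y => g y i l) x)
      - (2 * pd l ρ x * g x i j + pd l (fun y => g y i j) x))) * he
  rw [christoffel, christoffel]
  simp only [h3, Finset.sum_add_distrib, Finset.sum_sub_distrib, ← Finset.mul_sum, h1, h2]
  simp only [gradVec, Matrix.mulVec, dotProduct, diffVec]
  ring

end IsMetricOn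

/-- The algebra behind the quadratic part of the curvature of `e^{2ρ} g`. It is applied with `A =
Γ^a_{i·}`, `B = Γ^·_{jb}`, `p = dρ`, `G = g_{i·}` and `v = grad ρ`. -/
lemma sum_perturbed_mul (A B p G v : Fin n → ℝ) (a i j b : Fin n) (pi pj pb va gjb : ℝ) :
    ∑ m, (A m + delta a i * p m + delta a m * pi - G m * va)
        * (B m + delta m j * pb + delta m b * pj - gjb * v m) =
      ∑ m, A m * B m + A j * pb + A b * pj - gjb * ∑ m, A m * v m
      + delta a i * (∑ m, p m * B m + p j * pb + p b * pj - gjb * ∑ m, p m * v m)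
      + pi * (B a + delta a j * pb + delta a b * pj - gjb * v a)
      - va * (∑ m, G m * B m + G j * pb + G b * pj - gjb * ∑ m, G m * v m) := by
  have h : ∀ m, (A m + delta a i * p m + delta a m * pi - G m * va)
        * (B m + delta m j * pb + delta m b * pj - gjb * v m) =
      A m * B m + pb * (delta m j * A m) + pj * (delta m b * A m) - gjb * (A m * v m)
      + delta a i * (p m * B m) + delta a i * pb * (delta m j * p m)
      + delta a i * pj * (delta m b * p m) - delta a i * gjb * (p m * v m)
      + pi * (delta a m * (B m + delta m j * pb + delta m b * pj - gjb * v m))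
      - va * (G m * B m) - va * pb * (delta m j * G m) - va * pj * (delta m b * G m)
      + va * gjb * (G m * v m) := fun m => by ring
  simp only [h, Finset.sum_add_distrib, Finset.sum_sub_distrib, ← Finset.mul_sum, sum_delta_mul,
    sum_delta_mul']
  ring

namespace IsMetricOn

/-- The curvature of a conformally changed metric. -/
lemma curvature_conformal (hg : IsMetricOn g Ω) (hρ : ContDiffOn ℝ ∞ ρ Ω)
    (hgt : ∀ y ∈ Ω, gt y = Real.exp (2 * ρ y) • g y) (hx : x ∈ Ω) (a b i j : Fin n) :
    curvature gt a b i j x = curvature g a b i j x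
      + delta a j * hessVec g ρ i x b - g x j b * hessEnd g ρ i x a
      - delta a i * hessVec g ρ j x b + g x i b * hessEnd g ρ j x a
      + (delta a i * (pd j ρ x * pd b ρ x - g x j b * coordGradNormSq g ρ x)
        - delta a j * (pd i ρ x * pd b ρ x - g x i b * coordGradNormSq g ρ x)
        + gradVec g ρ x a * (g x j b * pd i ρ x - g x i b * pd j ρ x)) := by
  -- Derivatives of `dρ`, `grad ρ` and `g` are written as Hessians plus Christoffel terms; after
  -- antisymmetrisation in `i` and `j` the latter cancel against those in `hquad`.
  have hpd : ∀ i j : Fin n, pd i (christoffel gt a j b) x = pd i (christoffel g a j b) x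
      + delta a j * (hessVec g ρ i x b + ∑ m, christoffel g m i b x * pd m ρ x)
      + delta a b * pd i (pd j ρ) x
      - ((∑ m, christoffel g m i j x * g x m b + ∑ m, g x j m * christoffel g m i b x)
          * gradVec g ρ x a
        + g x j b * (hessEnd g ρ i x a - ∑ m, christoffel g a i m x * gradVec g ρ x m)) := by
    intro i j
    have d1 := differentiableAt_of_contDiffOn (hg.contDiffOn_christoffel a j b) hg.isOpen hx
    have d2 := fun i => differentiableAt_of_contDiffOn (contDiffOn_pd hg.isOpen hρ i) hg.isOpen hx
    have d3 := differentiableAt_of_contDiffOn (hg.smooth j b) hg.isOpen hx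
    have d4 := differentiableAt_of_contDiffOn (hg.smooth_gradVec hρ a) hg.isOpen hx
    have e1 : pd i (fun y => gradVec g ρ y a) x =
        hessEnd g ρ i x a - ∑ m, christoffel g a i m x * gradVec g ρ x m :=
      eq_sub_of_add_eq (congr_fun (hg.covDeriv_gradVec hρ hx i) a)
    have e2 : pd i (fun y => g y j b) x =
        ∑ m, christoffel g m i j x * g x m b + ∑ m, g x j m * christoffel g m i b x :=
      congr_fun (congr_fun (hg.pdMat_metric hx i) j) b
    rw [pd_congr hg.isOpen hx i fun y hy => hg.christoffel_conformal hρ hgt hy a j b,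
      pd_sub i (by fun_prop) (by fun_prop), pd_add i (by fun_prop) (by fun_prop),
      pd_add i d1 (by fun_prop), pd_const_mul i _ (d2 b), pd_const_mul i _ (d2 j),
      pd_mul i d3 d4, e1, e2, hessVec_apply]
    ring
  have hquad : ∀ i j : Fin n, ∑ m, christoffel gt a i m x * christoffel gt m j b x =
      ∑ m, christoffel g a i m x * christoffel g m j b x + christoffel g a i j x * pd b ρ x
        + christoffel g a i b x * pd j ρ x
        - g x j b * ∑ m, christoffel g a i m x * gradVec g ρ x m
      + delta a i * (∑ m, pd m ρ x * christoffel g m j b x + pd j ρ x * pd b ρ x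
        + pd b ρ x * pd j ρ x - g x j b * coordGradNormSq g ρ x)
      + pd i ρ x * (christoffel g a j b x + delta a j * pd b ρ x + delta a b * pd j ρ x
        - g x j b * gradVec g ρ x a)
      - gradVec g ρ x a * (∑ m, g x i m * christoffel g m j b x + g x i j * pd b ρ x
        + g x i b * pd j ρ x - g x j b * pd i ρ x) := by
    intro i j
    simp only [hg.christoffel_conformal hρ hgt hx]
    rw [sum_perturbed_mul, ← coordGradNormSq_eq, hg.sum_metric_mul_gradVec hx]
  have s1 : ∑ m, christoffel g m i j x * g x m b = ∑ m, christoffel g m j i x * g x m b :=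
    Finset.sum_congr rfl fun m _ => by rw [hg.christoffel_symm hx]
  have s2 : ∀ i, ∑ m, pd m ρ x * christoffel g m i b x =
      ∑ m, christoffel g m i b x * pd m ρ x := fun i => Finset.sum_congr rfl fun m _ => mul_comm _ _
  rw [curvature, curvature, Finset.sum_sub_distrib, Finset.sum_sub_distrib, hpd, hpd, hquad, hquad,
    s1, pd_comm hg.isOpen hρ hx i j, hg.christoffel_symm hx a i j, hg.apply_symm hx i j, s2, s2]
  ring

/-- The trace of the curvature over the last lower pair of indices is minus the Ricci tensor. -/
lemma trace_curvature (hg : IsMetricOn g Ω) (hx : x ∈ Ω) (a c : Fin n) :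
    ∑ i, ∑ j, (g x)⁻¹ i j * curvature g a j i c x = - ∑ b, (g x)⁻¹ a b * ricci g c b x := by
  -- Skew-symmetry of the curvature operator, with an index raised, exchanges the traced pair for
  -- the one that defines the Ricci tensor.
  have h : ∀ i, curvMat g i c x * (g x)⁻¹ = -((g x)⁻¹ * (curvMat g i c x).transpose) := by
    intro i
    have h0 := hg.curvMat_skew hx i c
    calc curvMat g i c x * (g x)⁻¹
        = (g x)⁻¹ * g x * curvMat g i c x * (g x)⁻¹ := by rw [hg.inv_mul hx, one_mul]
      _ = (g x)⁻¹ * ((curvMat g i c x).transpose * g x + g x * curvMat g i c x) * (g x)⁻¹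
            - (g x)⁻¹ * (curvMat g i c x).transpose * (g x * (g x)⁻¹) := by noncomm_ring
      _ = _ := by rw [h0, hg.mul_inv hx]; simp
  have h' : ∀ i, ∑ j, (g x)⁻¹ i j * curvature g a j i c x =
      - ∑ b, (g x)⁻¹ a b * curvature g i b i c x := by
    intro i
    have := congr_fun (congr_fun (h i) a) i
    simp only [Matrix.mul_apply, Matrix.neg_apply, Matrix.transpose_apply, curvMat,
      Matrix.of_apply] at this
    rw [← this]
    exact Finset.sum_congr rfl fun j _ => by rw [hg.inv_apply_symm hx i j]; ring
  simp only [h', ricci, Finset.sum_neg_distrib, Finset.mul_sum]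
  rw [Finset.sum_comm]

end IsMetricOn

end Conformal

end Biharm

end

noncomputable section

namespace Biharm

/-! ### The bitension field of the identity for a conformal change of the metric -/

section Bitension

variable {n : ℕ} {g gt : Coord n → Matrix (Fin n) (Fin n) ℝ} {ρ : Coord n → ℝ}
  {φ : Coord n → Coord n} {Ω : Set (Coord n)} {x : Coord n}

/-- The coordinate expression of the identity map of a manifold is the identity only on the target
of the chart, hence a general `φ` that agrees with it on `Ω`. -/
lemma pd_of_eq_id (hΩ : IsOpen Ω) (hφ : ∀ y ∈ Ω, φ y = y) (hx : x ∈ Ω) (i b : Fin n) :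
    pd i (fun y => φ y b) x = delta i b := by
  rw [pd_congr hΩ hx i (v := fun y => y b) fun y hy => by rw [hφ y hy], pd_coord, delta]

lemma pd_pd_of_eq_id (hΩ : IsOpen Ω) (hφ : ∀ y ∈ Ω, φ y = y) (hx : x ∈ Ω) (i j b : Fin n) :
    pd i (pd j (fun y => φ y b)) x = 0 := by
  rw [pd_congr hΩ hx i fun y hy => pd_of_eq_id hΩ hφ hy j b, pd_const]

lemma pullbackDeriv_of_eq_id (hΩ : IsOpen Ω) (hφ : ∀ y ∈ Ω, φ y = y) (hx : x ∈ Ω)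
    (V : Fin n → Coord n → ℝ) (i a : Fin n) :
    pullbackDeriv gt φ i V a x = pd i (V a) x + ∑ c, christoffel gt a i c x * V c x := by
  have h : ∀ b c, christoffel gt a b c (φ x) * (pd i (fun y => φ y b) x * V c x) =
      delta i b * (christoffel gt a b c x * V c x) := fun b c => by
    rw [pd_of_eq_id hΩ hφ hx, hφ x hx]; ring
  simp only [pullbackDeriv, h]
  rw [Finset.sum_comm]
  simp only [sum_delta_mul]

namespace IsMetricOn

lemma trace_delta_right (hg : IsMetricOn g Ω) (hx : x ∈ Ω) (a : Fin n) (X : Fin n → ℝ) :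
    ∑ i, ∑ j, (g x)⁻¹ i j * (delta a j * X i) = ∑ b, (g x)⁻¹ a b * X b := by
  refine Finset.sum_congr rfl fun i _ => ?_
  rw [hg.inv_apply_symm hx a i, ← sum_delta_mul a fun j => (g x)⁻¹ i j * X i]
  exact Finset.sum_congr rfl fun j _ => by ring

lemma trace_delta_left (hg : IsMetricOn g Ω) (hx : x ∈ Ω) (a : Fin n) (X : Fin n → ℝ) :
    ∑ i, ∑ j, (g x)⁻¹ i j * (delta a i * X j) = ∑ b, (g x)⁻¹ a b * X b := by
  rw [Finset.sum_comm, ← hg.trace_delta_right hx a X]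
  exact Finset.sum_congr rfl fun i _ => Finset.sum_congr rfl fun j _ => by
    rw [hg.inv_apply_symm hx]

lemma trace_metric (hg : IsMetricOn g Ω) (hx : x ∈ Ω) :
    ∑ i, ∑ j, (g x)⁻¹ i j * g x i j = n := by
  have h : ∀ i, ∑ j, (g x)⁻¹ i j * g x i j = 1 := fun i => by
    have := hg.sum_inv_mul hx i i
    rw [delta, if_pos rfl] at this
    rw [← this]
    exact Finset.sum_congr rfl fun j _ => by rw [hg.apply_symm hx]
  simp [h]

lemma trace_diff_mul (hg : IsMetricOn g Ω) (hx : x ∈ Ω) (u : Coord n → ℝ) (X : Fin n → ℝ) :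
    ∑ i, ∑ j, (g x)⁻¹ i j * (pd i u x * X j) = ∑ j, gradVec g u x j * X j := by
  rw [Finset.sum_comm]
  refine Finset.sum_congr rfl fun j _ => ?_
  simp only [gradVec, Matrix.mulVec, dotProduct, diffVec, Finset.sum_mul]
  exact Finset.sum_congr rfl fun i _ => by rw [hg.inv_apply_symm hx]; ring

lemma trace_hessVec (hg : IsMetricOn g Ω) (hx : x ∈ Ω) (u : Coord n → ℝ) :
    ∑ i, ∑ j, (g x)⁻¹ i j * hessVec g u j x i = - coordLaplacian g u x := by
  rw [coordLaplacian_eq, neg_neg, Finset.sum_comm]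
  refine Finset.sum_congr rfl fun j _ => ?_
  simp only [hessEnd, Matrix.mulVec, dotProduct]
  exact Finset.sum_congr rfl fun i _ => by rw [hg.inv_apply_symm hx]

lemma sum_diff_mul_hessEnd (hg : IsMetricOn g Ω) (hu : ContDiffOn ℝ ∞ ρ Ω) (hx : x ∈ Ω)
    (j : Fin n) :
    ∑ c, pd c ρ x * hessEnd g ρ j x c = (1 / 2) * pd j (coordGradNormSq g ρ) x := by
  have : ∑ c, pd c ρ x * hessEnd g ρ j x c = ∑ a, gradVec g ρ x a * hessVec g ρ j x a :=
    hg.dotProduct_raise hx (diffVec ρ x) (hessVec g ρ j x)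
  rw [this, hg.pd_coordGradNormSq hu hx]
  ring

/-- This is `∇_{grad ρ} grad ρ = ½ grad |dρ|²`, a consequence of the symmetry of the Hessian. -/
lemma sum_gradVec_mul_hessEnd (hg : IsMetricOn g Ω) (hu : ContDiffOn ℝ ∞ ρ Ω) (hx : x ∈ Ω)
    (a : Fin n) :
    ∑ j, gradVec g ρ x j * hessEnd g ρ j x a =
      ∑ b, (g x)⁻¹ a b * ((1 / 2) * pd b (coordGradNormSq g ρ) x) := by
  simp only [hg.pd_coordGradNormSq hu hx, hessEnd, Matrix.mulVec, dotProduct, Finset.mul_sum]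
  rw [Finset.sum_comm]
  refine Finset.sum_congr rfl fun b _ => Finset.sum_congr rfl fun j _ => ?_
  rw [hg.hessVec_symm hu hx j b]
  ring

/-- The tension field of the identity is `(2 - n) grad ρ`. -/
lemma tension_conformal (hg : IsMetricOn g Ω) (hρ : ContDiffOn ℝ ∞ ρ Ω)
    (hgt : ∀ y ∈ Ω, gt y = Real.exp (2 * ρ y) • g y) (hφ : ∀ y ∈ Ω, φ y = y) (hx : x ∈ Ω)
    (a : Fin n) : tension g gt φ a x = (2 - n) * gradVec g ρ x a := by
  have h : ∀ i j, pd i (pd j (fun y => φ y a)) x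
      - ∑ k, christoffel g k i j x * pd k (fun y => φ y a) x
      + ∑ b, ∑ c, christoffel gt a b c (φ x)
          * (pd i (fun y => φ y b) x * pd j (fun y => φ y c) x) =
      delta a i * pd j ρ x + delta a j * pd i ρ x - g x i j * gradVec g ρ x a := by
    intro i j
    have h1 : ∑ b, ∑ c, christoffel gt a b c x * (delta i b * delta j c) =
        christoffel gt a i j x := by
      have : ∀ b c, christoffel gt a b c x * (delta i b * delta j c) =
        delta i b * (delta j c * christoffel gt a b c x) := fun b c => by ring
      simp only [this, ← Finset.mul_sum, sum_delta_mul]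
    simp only [pd_pd_of_eq_id hg.isOpen hφ hx, pd_of_eq_id hg.isOpen hφ hx, hφ x hx, h1,
      sum_mul_delta']
    rw [hg.christoffel_conformal hρ hgt hx]
    ring
  have h2 : ∑ i, ∑ j, (g x)⁻¹ i j * (g x i j * gradVec g ρ x a) = n * gradVec g ρ x a := by
    simp only [← mul_assoc, ← Finset.sum_mul, hg.trace_metric hx]
  have h3 : ∑ b, (g x)⁻¹ a b * pd b ρ x = gradVec g ρ x a := rfl
  simp only [tension, h, mul_sub, mul_add, Finset.sum_sub_distrib, Finset.sum_add_distrib,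
    hg.trace_delta_left hx a fun j => pd j ρ x, hg.trace_delta_right hx a fun j => pd j ρ x, h2, h3]
  ring

/-- Applied to `grad ρ`, the conformal correction of the connection is `|dρ|²` times the identity,
because its other two terms, `± dρ ⊗ grad ρ`, cancel. -/
lemma pullbackDeriv_tension (hg : IsMetricOn g Ω) (hρ : ContDiffOn ℝ ∞ ρ Ω)
    (hgt : ∀ y ∈ Ω, gt y = Real.exp (2 * ρ y) • g y) (hφ : ∀ y ∈ Ω, φ y = y) (hx : x ∈ Ω)
    (i a : Fin n) :
    pullbackDeriv gt φ i (fun b => tension g gt φ b) a x =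
      (2 - n) * (hessEnd g ρ i x a + delta a i * coordGradNormSq g ρ x) := by
  have h1 : ∀ c, (christoffel g a i c x + delta a i * pd c ρ x + delta a c * pd i ρ x
      - g x i c * gradVec g ρ x a) * ((2 - n) * gradVec g ρ x c) =
      (2 - n) * (christoffel g a i c x * gradVec g ρ x c)
      + (2 - n) * delta a i * (pd c ρ x * gradVec g ρ x c)
      + (2 - n) * pd i ρ x * (delta a c * gradVec g ρ x c)
      - (2 - n) * gradVec g ρ x a * (g x i c * gradVec g ρ x c) := fun c => by ring
  have h2 : pd i (fun y => gradVec g ρ y a) x =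
      hessEnd g ρ i x a - ∑ m, christoffel g a i m x * gradVec g ρ x m :=
    eq_sub_of_add_eq (congr_fun (hg.covDeriv_gradVec hρ hx i) a)
  rw [pullbackDeriv_of_eq_id hg.isOpen hφ hx,
    pd_congr hg.isOpen hx i fun y hy => hg.tension_conformal hρ hgt hφ hy a,
    pd_const_mul i _ (differentiableAt_of_contDiffOn (hg.smooth_gradVec hρ a) hg.isOpen hx), h2]
  simp only [hg.tension_conformal hρ hgt hφ hx, hg.christoffel_conformal hρ hgt hx, h1,
    Finset.sum_add_distrib, Finset.sum_sub_distrib, ← Finset.mul_sum, sum_delta_mul,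
    ← coordGradNormSq_eq, hg.sum_metric_mul_gradVec hx]
  ring

/-- The Bochner formula handles the trace of `∇² grad ρ`. In the conformal corrections the
coefficient of `d|dρ|²` is `1 + ½ + ½ = 2`, that of `|dρ|² dρ` is `1 + 1 - n`, and the trace of the
Hessian supplies `Δρ dρ`. -/
lemma traceSecondDeriv_tension (hg : IsMetricOn g Ω) (hρ : ContDiffOn ℝ ∞ ρ Ω)
    (hgt : ∀ y ∈ Ω, gt y = Real.exp (2 * ρ y) • g y) (hφ : ∀ y ∈ Ω, φ y = y) (hx : x ∈ Ω)
    (a : Fin n) :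
    traceSecondDeriv g gt φ (fun b => tension g gt φ b) a x =
      (2 - n) * ∑ b, (g x)⁻¹ a b * (- pd b (coordLaplacian g ρ) x
        + ∑ k, ricci g b k x * gradVec g ρ x k + 2 * pd b (coordGradNormSq g ρ) x
        + (coordLaplacian g ρ x + (2 - n) * coordGradNormSq g ρ x) * pd b ρ x) := by
  set U := coordGradNormSq g ρ with hU
  have dU : DifferentiableAt ℝ U x :=
    differentiableAt_of_contDiffOn (hg.contDiffOn_coordGradNormSq hρ) hg.isOpen hx
  have h : ∀ i j, pullbackDeriv gt φ i
        (fun b => pullbackDeriv gt φ j (fun b => tension g gt φ b) b) a x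
      - ∑ k, christoffel g k i j x * pullbackDeriv gt φ k (fun b => tension g gt φ b) a x =
      (2 - n) * (secondCovDeriv g ρ i j x a + delta a j * pd i U x
        + delta a i * ((1 / 2) * pd j U x + U x * pd j ρ x)
        + pd i ρ x * hessEnd g ρ j x a + delta a j * (U x * pd i ρ x)
        - gradVec g ρ x a * hessVec g ρ j x i - gradVec g ρ x a * U x * g x i j) := by
    intro i j
    have dh := differentiableAt_of_contDiffOn (hg.smooth_hessEnd hρ j a) hg.isOpen hx
    have h1 : ∀ c, (christoffel g a i c x + delta a i * pd c ρ x + delta a c * pd i ρ x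
        - g x i c * gradVec g ρ x a) * ((2 - n) * (hessEnd g ρ j x c + delta c j * U x)) =
        (2 - n) * (christoffel g a i c x * hessEnd g ρ j x c)
        + (2 - n) * U x * (delta c j * christoffel g a i c x)
        + (2 - n) * delta a i * (pd c ρ x * hessEnd g ρ j x c)
        + (2 - n) * delta a i * U x * (delta c j * pd c ρ x)
        + (2 - n) * pd i ρ x * (delta a c * (hessEnd g ρ j x c + delta c j * U x))
        - (2 - n) * gradVec g ρ x a * (g x i c * hessEnd g ρ j x c)
        - (2 - n) * gradVec g ρ x a * U x * (delta c j * g x i c) := fun c => by ring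
    have h2 : ∀ k, christoffel g k i j x * ((2 - n) * (hessEnd g ρ k x a + delta a k * U x)) =
        (2 - n) * (christoffel g k i j x * hessEnd g ρ k x a)
        + (2 - n) * U x * (delta a k * christoffel g k i j x) := fun k => by ring
    have h3 : secondCovDeriv g ρ i j x a = pd i (fun y => hessEnd g ρ j y a) x
        + ∑ c, christoffel g a i c x * hessEnd g ρ j x c
        - ∑ k, christoffel g k i j x * hessEnd g ρ k x a := by
      simp only [secondCovDeriv, Pi.add_apply, Pi.sub_apply, Finset.sum_apply, Pi.smul_apply,
        smul_eq_mul]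
      rfl
    rw [pullbackDeriv_of_eq_id hg.isOpen hφ hx,
      pd_congr hg.isOpen hx i fun y hy => hg.pullbackDeriv_tension hρ hgt hφ hy j a,
      pd_const_mul i _ (dh.fun_add (dU.const_mul _)), pd_add i dh (dU.const_mul _),
      pd_const_mul i _ dU, h3]
    simp only [hg.pullbackDeriv_tension hρ hgt hφ hx, hg.christoffel_conformal hρ hgt hx,
      ← hU, h1, h2, Finset.sum_add_distrib, Finset.sum_sub_distrib, ← Finset.mul_sum,
      sum_delta_mul, sum_delta_mul', hg.sum_metric_mul_hessEnd hx,
      hg.sum_diff_mul_hessEnd hρ hx]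
    ring
  have e1 := hg.trace_secondCovDeriv hρ hx a
  have e2 := hg.trace_delta_right hx a fun i => pd i U x
  have e3 := hg.trace_delta_left hx a fun j => (1 / 2) * pd j U x + U x * pd j ρ x
  have e4 := hg.trace_diff_mul hx ρ fun j => hessEnd g ρ j x a
  rw [hg.sum_gradVec_mul_hessEnd hρ hx] at e4
  have e5 := hg.trace_delta_right hx a fun i => U x * pd i ρ x
  have e6 : ∑ i, ∑ j, (g x)⁻¹ i j * (gradVec g ρ x a * hessVec g ρ j x i) =
      - gradVec g ρ x a * coordLaplacian g ρ x := by
    rw [neg_mul, ← mul_neg, ← hg.trace_hessVec hx, Finset.mul_sum]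
    simp only [Finset.mul_sum]
    exact Finset.sum_congr rfl fun i _ => Finset.sum_congr rfl fun j _ => by ring
  have e7 : ∑ i, ∑ j, (g x)⁻¹ i j * (gradVec g ρ x a * U x * g x i j) =
      gradVec g ρ x a * U x * n := by
    rw [← hg.trace_metric hx, Finset.mul_sum]
    simp only [Finset.mul_sum]
    exact Finset.sum_congr rfl fun i _ => Finset.sum_congr rfl fun j _ => by ring
  have e8 : gradVec g ρ x a = ∑ b, (g x)⁻¹ a b * pd b ρ x := rfl
  have e9 : ∑ i, ∑ j, (g x)⁻¹ i j * (secondCovDeriv g ρ i j x a + delta a j * pd i U x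
        + delta a i * ((1 / 2) * pd j U x + U x * pd j ρ x)
        + pd i ρ x * hessEnd g ρ j x a + delta a j * (U x * pd i ρ x)
        - gradVec g ρ x a * hessVec g ρ j x i - gradVec g ρ x a * U x * g x i j) =
      ∑ b, (g x)⁻¹ a b * (- pd b (coordLaplacian g ρ) x
        + ∑ k, ricci g b k x * gradVec g ρ x k + 2 * pd b U x
        + (coordLaplacian g ρ x + (2 - n) * U x) * pd b ρ x) := by
    simp only [mul_add ((g x)⁻¹ _ _), mul_sub ((g x)⁻¹ _ _), Finset.sum_add_distrib,
      Finset.sum_sub_distrib] at e1 e2 e3 e4 e5 e6 e7 ⊢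
    have f1 : ∀ c : ℝ, ∑ b, (g x)⁻¹ a b * (c * pd b ρ x) = c * gradVec g ρ x a := fun c => by
      rw [e8, Finset.mul_sum]; exact Finset.sum_congr rfl fun b _ => by ring
    have f2 : ∀ c : ℝ, ∑ b, (g x)⁻¹ a b * (c * pd b U x) = c * ∑ b, (g x)⁻¹ a b * pd b U x :=
      fun c => by
        rw [Finset.mul_sum]; exact Finset.sum_congr rfl fun b _ => by ring
    rw [f2, f1] at e3
    rw [f2] at e4
    rw [f1] at e5
    rw [e1, e2, e3, e4, e5, e6, e7, f1, f2]
    ring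
  simp only [traceSecondDeriv, h]
  rw [← e9, Finset.mul_sum]
  refine Finset.sum_congr rfl fun i _ => ?_
  rw [Finset.mul_sum]
  exact Finset.sum_congr rfl fun j _ => by ring

/-- The curvature term of the bitension field of the identity. -/
lemma trace_curvature_tension (hg : IsMetricOn g Ω) (hρ : ContDiffOn ℝ ∞ ρ Ω)
    (hgt : ∀ y ∈ Ω, gt y = Real.exp (2 * ρ y) • g y) (hφ : ∀ y ∈ Ω, φ y = y) (hx : x ∈ Ω)
    (a : Fin n) :
    ∑ i, ∑ j, (g x)⁻¹ i j * ∑ b, ∑ c, ∑ d, curvature gt a d b c (φ x)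
        * (pd i (fun y => φ y b) x * tension g gt φ c x * pd j (fun y => φ y d) x) =
      (2 - n) * ∑ b, (g x)⁻¹ a b * (- ∑ k, ricci g k b x * gradVec g ρ x k
        - coordLaplacian g ρ x * pd b ρ x + ((n - 2) / 2) * pd b (coordGradNormSq g ρ) x) := by
  set U := coordGradNormSq g ρ with hU
  have h1 : ∀ i j, ∑ b, ∑ c, ∑ d, curvature gt a d b c (φ x)
        * (pd i (fun y => φ y b) x * tension g gt φ c x * pd j (fun y => φ y d) x) =
      (2 - n) * ∑ c, curvature gt a j i c x * gradVec g ρ x c := by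
    intro i j
    have : ∀ b c d, curvature gt a d b c x
        * (delta i b * ((2 - n) * gradVec g ρ x c) * delta j d) =
      delta i b * ((2 - n) * (delta j d * (curvature gt a d b c x * gradVec g ρ x c))) :=
      fun b c d => by ring
    simp only [hφ x hx, pd_of_eq_id hg.isOpen hφ hx, hg.tension_conformal hρ hgt hφ hx, this,
      ← Finset.mul_sum, sum_delta_mul]
  -- The part of the conformal curvature that is quadratic in `dρ` cancels entirely once contracted
  -- with `grad ρ`.
  have h2 : ∀ i j, ∑ c, curvature gt a j i c x * gradVec g ρ x c =
      ∑ c, curvature g a j i c x * gradVec g ρ x c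
      + gradVec g ρ x a * hessVec g ρ i x j - pd j ρ x * hessEnd g ρ i x a
      - delta a i * ((1 / 2) * pd j U x)
      + (∑ c, gradVec g ρ x c * hessEnd g ρ c x a) * g x i j := by
    intro i j
    have s1 : ∀ c, curvature gt a j i c x * gradVec g ρ x c =
        curvature g a j i c x * gradVec g ρ x c
        + hessVec g ρ i x j * (delta a c * gradVec g ρ x c)
        - hessEnd g ρ i x a * (g x j c * gradVec g ρ x c)
        - delta a i * (gradVec g ρ x c * hessVec g ρ j x c)
        + g x i j * (gradVec g ρ x c * hessEnd g ρ c x a)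
        + delta a i * pd j ρ x * (pd c ρ x * gradVec g ρ x c)
        - delta a i * U x * (g x j c * gradVec g ρ x c)
        - (pd i ρ x * pd j ρ x - g x i j * U x) * (delta a c * gradVec g ρ x c)
        + gradVec g ρ x a * pd i ρ x * (g x j c * gradVec g ρ x c)
        - gradVec g ρ x a * g x i j * (pd c ρ x * gradVec g ρ x c) := by
      intro c
      rw [hg.curvature_conformal hρ hgt hx, hg.hessVec_symm hρ hx c j, hg.apply_symm hx c j, ← hU]
      ring
    have s2 : ∑ c, gradVec g ρ x c * hessVec g ρ j x c = (1 / 2) * pd j U x := by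
      rw [hU, hg.pd_coordGradNormSq hρ hx]; ring
    simp only [s1, Finset.sum_add_distrib, Finset.sum_sub_distrib, ← Finset.mul_sum,
      sum_delta_mul, hg.sum_metric_mul_gradVec hx, ← coordGradNormSq_eq, s2, ← hU]
    ring
  have e1 : ∑ i, ∑ j, (g x)⁻¹ i j * ∑ c, curvature g a j i c x * gradVec g ρ x c =
      ∑ b, (g x)⁻¹ a b * (- ∑ k, ricci g k b x * gradVec g ρ x k) := by
    have : ∑ i, ∑ j, (g x)⁻¹ i j * ∑ c, curvature g a j i c x * gradVec g ρ x c =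
        ∑ c, (∑ i, ∑ j, (g x)⁻¹ i j * curvature g a j i c x) * gradVec g ρ x c := by
      simp only [Finset.mul_sum, Finset.sum_mul]
      rw [Finset.sum_comm_cycle]
      exact Finset.sum_congr rfl fun c _ => Finset.sum_congr rfl fun i _ =>
        Finset.sum_congr rfl fun j _ => by ring
    rw [this]
    simp only [hg.trace_curvature hx, Finset.mul_sum, Finset.sum_mul, ← Finset.sum_neg_distrib]
    rw [Finset.sum_comm]
    exact Finset.sum_congr rfl fun c _ => Finset.sum_congr rfl fun i _ => by ring
  have e2 : ∑ i, ∑ j, (g x)⁻¹ i j * (gradVec g ρ x a * hessVec g ρ i x j) =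
      - gradVec g ρ x a * coordLaplacian g ρ x := by
    rw [neg_mul, ← mul_neg, ← hg.trace_hessVec hx, Finset.mul_sum]
    simp only [Finset.mul_sum]
    exact Finset.sum_congr rfl fun i _ => Finset.sum_congr rfl fun j _ => by
      rw [hg.hessVec_symm hρ hx i j]; ring
  have e3 : ∑ i, ∑ j, (g x)⁻¹ i j * (pd j ρ x * hessEnd g ρ i x a) =
      ∑ b, (g x)⁻¹ a b * ((1 / 2) * pd b U x) := by
    rw [← hg.sum_gradVec_mul_hessEnd hρ hx, ← hg.trace_diff_mul hx, Finset.sum_comm]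
    exact Finset.sum_congr rfl fun i _ => Finset.sum_congr rfl fun j _ => by
      rw [hg.inv_apply_symm hx]
  have e4 := hg.trace_delta_left hx a fun j => (1 / 2) * pd j U x
  have e5 : ∑ i, ∑ j, (g x)⁻¹ i j * ((∑ c, gradVec g ρ x c * hessEnd g ρ c x a) * g x i j) =
      n * ∑ b, (g x)⁻¹ a b * ((1 / 2) * pd b U x) := by
    rw [← hg.sum_gradVec_mul_hessEnd hρ hx, ← hg.trace_metric hx, Finset.sum_mul]
    simp only [Finset.sum_mul _ _ (∑ c, gradVec g ρ x c * hessEnd g ρ c x a)]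
    exact Finset.sum_congr rfl fun i _ => Finset.sum_congr rfl fun j _ => by ring
  have e8 : gradVec g ρ x a = ∑ b, (g x)⁻¹ a b * pd b ρ x := rfl
  have f1 : ∀ c : ℝ, ∑ b, (g x)⁻¹ a b * (c * pd b ρ x) = c * gradVec g ρ x a := fun c => by
    rw [e8, Finset.mul_sum]; exact Finset.sum_congr rfl fun b _ => by ring
  have f2 : ∀ c : ℝ, ∑ b, (g x)⁻¹ a b * (c * pd b U x) = c * ∑ b, (g x)⁻¹ a b * pd b U x :=
    fun c => by
      rw [Finset.mul_sum]; exact Finset.sum_congr rfl fun b _ => by ring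
  have e9 : ∑ i, ∑ j, (g x)⁻¹ i j * ∑ c, curvature gt a j i c x * gradVec g ρ x c =
      ∑ b, (g x)⁻¹ a b * (- ∑ k, ricci g k b x * gradVec g ρ x k
        - coordLaplacian g ρ x * pd b ρ x + ((n - 2) / 2) * pd b U x) := by
    simp only [h2, mul_add ((g x)⁻¹ _ _), mul_sub ((g x)⁻¹ _ _), Finset.sum_add_distrib,
      Finset.sum_sub_distrib]
    rw [e1, e2, e3, e4, e5, f1, f2, f2]
    ring
  simp only [h1]
  rw [← e9, Finset.mul_sum]
  refine Finset.sum_congr rfl fun i _ => ?_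
  rw [Finset.mul_sum]
  exact Finset.sum_congr rfl fun j _ => by ring

/-- The bitension field of the identity for the metrics `g` and `e^{2ρ} g`. -/
theorem bitension_conformal (hg : IsMetricOn g Ω) (hρ : ContDiffOn ℝ ∞ ρ Ω)
    (hgt : ∀ y ∈ Ω, gt y = Real.exp (2 * ρ y) • g y) (hφ : ∀ y ∈ Ω, φ y = y) (hx : x ∈ Ω)
    (a : Fin n) :
    bitension g gt φ a x = (2 - n) * ∑ b, (g x)⁻¹ a b * (- pd b (coordLaplacian g ρ) x
      + ((6 - n) / 2) * pd b (coordGradNormSq g ρ) x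
      + (2 * coordLaplacian g ρ x + (2 - n) * coordGradNormSq g ρ x) * pd b ρ x
      + ∑ k, (ricci g b k x + ricci g k b x) * gradVec g ρ x k) := by
  -- The coefficient of `d|dρ|²` is `2 - (n - 2)/2 = (6 - n)/2`.
  rw [bitension, hg.traceSecondDeriv_tension hρ hgt hφ hx, hg.trace_curvature_tension hρ hgt hφ hx,
    ← mul_sub, ← Finset.sum_sub_distrib]
  congr 1
  refine Finset.sum_congr rfl fun b _ => ?_
  simp only [add_mul, Finset.sum_add_distrib]
  ring

/-- The components of the one-form whose vanishing expresses that the identity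
`(Ω, g) → (Ω, e^{2ρ} g)` is biharmonic, for an Einstein metric `g` with constant `c`. -/
def _root_.Biharm.conformalForm (g : Coord n → Matrix (Fin n) (Fin n) ℝ) (c : ℝ)
    (ρ : Coord n → ℝ) (b : Fin n) (x : Coord n) : ℝ :=
  - pd b (coordLaplacian g ρ) x + ((6 - n) / 2) * pd b (coordGradNormSq g ρ) x
    + (2 * coordLaplacian g ρ x + (2 - n) * coordGradNormSq g ρ x + 2 * c) * pd b ρ x

/-- Neither the factor `2 - n` nor the raising of an index loses information, as `n > 2` and the
metric is nondegenerate. -/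
theorem bitension_eq_zero_iff (hg : IsMetricOn g Ω) (hn : 2 < n) {c : ℝ}
    (hE : ∀ i j, ricci g i j x = c * g x i j) (hρ : ContDiffOn ℝ ∞ ρ Ω)
    (hgt : ∀ y ∈ Ω, gt y = Real.exp (2 * ρ y) • g y) (hφ : ∀ y ∈ Ω, φ y = y) (hx : x ∈ Ω) :
    (∀ a, bitension g gt φ a x = 0) ↔ ∀ b, conformalForm g c ρ b x = 0 := by
  have h1 : ∀ a, bitension g gt φ a x =
      (2 - n) * (g x)⁻¹.mulVec (fun b => conformalForm g c ρ b x) a := by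
    intro a
    rw [hg.bitension_conformal hρ hgt hφ hx]
    simp only [Matrix.mulVec, dotProduct]
    congr 1
    refine Finset.sum_congr rfl fun b _ => ?_
    -- The two trace formulas deliver `Ric` with opposite index orders; the Einstein equation
    -- evaluates both, so the symmetry of `Ric` need not be established separately.
    have : ∀ k, (ricci g b k x + ricci g k b x) * gradVec g ρ x k =
        2 * c * (g x b k * gradVec g ρ x k) := fun k => by
      rw [hE, hE, hg.apply_symm hx k b]; ring
    simp only [this, ← Finset.mul_sum, hg.sum_metric_mul_gradVec hx, conformalForm]
    ring
  have hn' : (2 - n : ℝ) ≠ 0 := by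
    have : (2 : ℝ) < n := by exact_mod_cast hn
    linarith
  constructor
  · intro h b
    have h2 : (g x)⁻¹.mulVec (fun b => conformalForm g c ρ b x) = 0 := by
      ext a
      simpa [h1, hn'] using h a
    have := hg.metric_mulVec_raise hx fun b => conformalForm g c ρ b x
    rw [h2, Matrix.mulVec_zero] at this
    exact (congr_fun this b).symm
  · intro h a
    rw [h1]
    simp [Matrix.mulVec, dotProduct, h]

end IsMetricOn

end Bitension

end Biharm

end

noncomputable section

namespace Biharm

/-! ### Change of coordinates -/

section ChangeOfCoordinates

variable {n : ℕ}

lemma pd_comp_map {ψ : Coord n → Coord n} {w : Coord n → ℝ} {x : Coord n}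
    (hψ : DifferentiableAt ℝ ψ x) (hw : DifferentiableAt ℝ w (ψ x)) (i : Fin n) :
    pd i (fun y => w (ψ y)) x = ∑ a, pd i (fun y => ψ y a) x * pd a w (ψ x) := by
  have h1 := (hw.hasFDerivAt.comp x hψ.hasFDerivAt).fderiv
  have h2 : pd i (fun y => w (ψ y)) x = fderiv ℝ w (ψ x) (fderiv ℝ ψ x
      (EuclideanSpace.single i 1)) := by
    rw [pd]
    erw [h1]
    rfl
  rw [h2, fderiv_eq_sum_pd]
  refine Finset.sum_congr rfl fun a _ => ?_
  have h3 := (((EuclideanSpace.proj a : Coord n →L[ℝ] ℝ).hasFDerivAt (x := ψ x)).comp x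
    hψ.hasFDerivAt).fderiv
  congr 1
  rw [pd]
  erw [h3]
  rfl

/-- The Jacobian matrix of `ψ`. -/
def jacobian (ψ : Coord n → Coord n) (x : Coord n) : Matrix (Fin n) (Fin n) ℝ :=
  Matrix.of fun a i => pd i (fun y => ψ y a) x

/-- `ψ` is a smooth map of `Ω` into `Ω'` with `ψ^* g' = g`. -/
structure IsIsometryOn (g g' : Coord n → Matrix (Fin n) (Fin n) ℝ) (ψ : Coord n → Coord n)
    (Ω Ω' : Set (Coord n)) : Prop where
  smooth : ContDiffOn ℝ ∞ ψ Ω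
  mapsTo : MapsTo ψ Ω Ω'
  pullback : ∀ y ∈ Ω, g y = (jacobian ψ y).transpose * g' (ψ y) * jacobian ψ y

variable {g g' : Coord n → Matrix (Fin n) (Fin n) ℝ} {ψ : Coord n → Coord n}
  {Ω Ω' : Set (Coord n)} {x : Coord n} {u u' : Coord n → ℝ}

/-- The Levi-Civita connection is the unique torsion free metric connection. -/
lemma IsMetricOn.connMat_unique (hg : IsMetricOn g Ω) (hx : x ∈ Ω)
    (C : Fin n → Matrix (Fin n) (Fin n) ℝ) (hsymm : ∀ i j a, C i a j = C j a i)
    (hC : ∀ i, pdMat i g x = (C i).transpose * g x + g x * C i) (i : Fin n) :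
    connMat g i x = C i := by
  -- With its upper index lowered, `C` is symmetric in the two lower indices; the Christoffel
  -- combination of derivatives of `g` then collapses to twice the lowered `C`, as in the Koszul
  -- formula.
  have hA : ∀ l i j, (g x * C i) l j = (g x * C j) l i := fun l i j => by
    simp only [Matrix.mul_apply, hsymm i j]
  have hpd : ∀ i a b, pd i (fun y => g y a b) x = (g x * C i) b a + (g x * C i) a b := by
    intro i a b
    have h1 : (g x * C i) b a = ((C i).transpose * g x) a b := by
      rw [← Matrix.transpose_apply (g x * C i), Matrix.transpose_mul, hg.symm x hx]
    rw [h1]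
    exact congr_fun (congr_fun (hC i) a) b
  ext k j
  have h2 : C i = (g x)⁻¹ * (g x * C i) := by rw [← mul_assoc, hg.inv_mul hx, one_mul]
  rw [h2, Matrix.mul_apply]
  simp only [connMat, Matrix.of_apply, christoffel, Finset.mul_sum]
  refine Finset.sum_congr rfl fun l _ => ?_
  rw [hpd, hpd, hpd, hA l j i, hA i j l, hA j i l]
  ring

namespace IsIsometryOn

lemma smooth_apply (h : IsIsometryOn g g' ψ Ω Ω') (a : Fin n) :
    ContDiffOn ℝ ∞ (fun y => ψ y a) Ω :=
  (EuclideanSpace.proj a : Coord n →L[ℝ] ℝ).contDiff.comp_contDiffOn h.smooth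

lemma smooth_jacobian (h : IsIsometryOn g g' ψ Ω Ω') (hΩ : IsOpen Ω) :
    SmoothMat (jacobian ψ) Ω := fun a i => contDiffOn_pd hΩ (h.smooth_apply a) i

lemma pd_comp (h : IsIsometryOn g g' ψ Ω Ω') (hΩ : IsOpen Ω) (hΩ' : IsOpen Ω')
    {w : Coord n → ℝ} (hw : ContDiffOn ℝ ∞ w Ω') (hx : x ∈ Ω) (i : Fin n) :
    pd i (fun y => w (ψ y)) x = ∑ a, jacobian ψ x a i * pd a w (ψ x) :=
  pd_comp_map (differentiableAt_of_contDiffOn h.smooth hΩ hx)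
    (differentiableAt_of_contDiffOn hw hΩ' (h.mapsTo hx)) i

lemma det_ne (h : IsIsometryOn g g' ψ Ω Ω') (hg : IsMetricOn g Ω) (hx : x ∈ Ω) :
    (jacobian ψ x).det ≠ 0 := by
  have := hg.det_ne x hx
  rw [h.pullback x hx, Matrix.det_mul] at this
  exact right_ne_zero_of_mul this

/-- The metric on the cotangent spaces is preserved. -/
lemma jacobian_mul_inv (h : IsIsometryOn g g' ψ Ω Ω') (hg : IsMetricOn g Ω) (hx : x ∈ Ω) :
    jacobian ψ x * (g x)⁻¹ * (jacobian ψ x).transpose = (g' (ψ x))⁻¹ := by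
  have hJ := (h.det_ne hg hx).isUnit
  have hJ' : IsUnit (jacobian ψ x).transpose.det := by rwa [Matrix.det_transpose]
  rw [h.pullback x hx, Matrix.mul_inv_rev, Matrix.mul_inv_rev]
  calc _ = (jacobian ψ x * (jacobian ψ x)⁻¹) * (g' (ψ x))⁻¹ *
        ((jacobian ψ x).transpose⁻¹ * (jacobian ψ x).transpose) := by simp only [mul_assoc]
    _ = _ := by rw [Matrix.mul_nonsing_inv _ hJ, Matrix.nonsing_inv_mul _ hJ', one_mul, mul_one]

lemma diffVec_eq (h : IsIsometryOn g g' ψ Ω Ω') (hΩ : IsOpen Ω) (hΩ' : IsOpen Ω')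
    (hu' : ContDiffOn ℝ ∞ u' Ω') (hu : ∀ y ∈ Ω, u y = u' (ψ y)) (hx : x ∈ Ω) :
    diffVec u x = (jacobian ψ x).transpose.mulVec (diffVec u' (ψ x)) := by
  ext i
  exact (pd_congr hΩ hx i hu).trans (h.pd_comp hΩ hΩ' hu' hx i)

lemma coordGradNormSq_eq (h : IsIsometryOn g g' ψ Ω Ω') (hg : IsMetricOn g Ω)
    (hg' : IsMetricOn g' Ω') (hu' : ContDiffOn ℝ ∞ u' Ω') (hu : ∀ y ∈ Ω, u y = u' (ψ y))
    (hx : x ∈ Ω) : coordGradNormSq g u x = coordGradNormSq g' u' (ψ x) := by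
  have h1 : coordGradNormSq g u x = dotProduct (diffVec u x) ((g x)⁻¹.mulVec (diffVec u x)) :=
    Biharm.coordGradNormSq_eq g u x
  have h2 : coordGradNormSq g' u' (ψ x) =
      dotProduct (diffVec u' (ψ x)) ((g' (ψ x))⁻¹.mulVec (diffVec u' (ψ x))) :=
    Biharm.coordGradNormSq_eq g' u' (ψ x)
  rw [h1, h2, ← h.jacobian_mul_inv hg hx, h.diffVec_eq hg.isOpen hg'.isOpen hu' hu hx,
    Matrix.mulVec_transpose, ← Matrix.dotProduct_mulVec, Matrix.mulVec_mulVec,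
    ← Matrix.mulVec_transpose, Matrix.mulVec_mulVec]

/-- The transformation law of the connection. -/
lemma jacobian_mul_connMat (h : IsIsometryOn g g' ψ Ω Ω') (hg : IsMetricOn g Ω)
    (hg' : IsMetricOn g' Ω') (hx : x ∈ Ω) (i : Fin n) :
    jacobian ψ x * connMat g i x =
      ∑ a, jacobian ψ x a i • (connMat g' a (ψ x) * jacobian ψ x) + pdMat i (jacobian ψ) x := by
  have hJ := (h.det_ne hg hx).isUnit
  have hJs := h.smooth_jacobian hg.isOpen
  set J := jacobian ψ x with hJdef
  -- The candidate `J⁻¹ D` is the pulled-back connection. It is torsion free and compatible with `g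
  -- = ψ^* g'`, so uniqueness identifies it with the Levi-Civita connection of `g`.
  let D : Fin n → Matrix (Fin n) (Fin n) ℝ := fun i =>
    ∑ a, J a i • (connMat g' a (ψ x) * J) + pdMat i (jacobian ψ) x
  have hDs : ∀ i j a, D i a j = D j a i := by
    intro i j b
    have h1 : pdMat i (jacobian ψ) x b j = pdMat j (jacobian ψ) x b i :=
      pd_comm hg.isOpen (h.smooth_apply b) hx i j
    simp only [D, Matrix.add_apply, Matrix.sum_apply, Matrix.smul_apply, Matrix.mul_apply,
      smul_eq_mul, Finset.mul_sum, h1]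
    congr 1
    rw [Finset.sum_comm]
    refine Finset.sum_congr rfl fun a _ => Finset.sum_congr rfl fun c _ => ?_
    simp only [connMat, Matrix.of_apply]
    rw [hg'.christoffel_symm (h.mapsTo hx) b c a]
    ring
  have hgs : SmoothMat (fun y => g' (ψ y)) Ω := fun a b =>
    (hg'.smooth a b).comp h.smooth h.mapsTo
  have hpg : ∀ i, pdMat i (fun y => g' (ψ y)) x = ∑ a, J a i •
      ((connMat g' a (ψ x)).transpose * g' (ψ x) + g' (ψ x) * connMat g' a (ψ x)) := by
    intro i
    ext b c
    simp only [← hg'.pdMat_metric (h.mapsTo hx), Matrix.sum_apply, Matrix.smul_apply, smul_eq_mul]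
    exact h.pd_comp hg.isOpen hg'.isOpen (hg'.smooth b c) hx i
  have hC : ∀ i, pdMat i g x = (J⁻¹ * D i).transpose * g x + g x * (J⁻¹ * D i) := by
    intro i
    have e1 : g x * (J⁻¹ * D i) = J.transpose * g' (ψ x) * D i := by
      rw [h.pullback x hx, ← hJdef, mul_assoc _ J, ← mul_assoc J, Matrix.mul_nonsing_inv _ hJ,
        one_mul]
    have e2 : (J⁻¹ * D i).transpose * g x = (D i).transpose * g' (ψ x) * J := by
      rw [← Matrix.transpose_transpose ((J⁻¹ * D i).transpose * g x), Matrix.transpose_mul,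
        Matrix.transpose_transpose, hg.symm x hx, e1, Matrix.transpose_mul, Matrix.transpose_mul,
        Matrix.transpose_transpose, hg'.symm _ (h.mapsTo hx), mul_assoc]
    have e3 : pdMat i (fun y => (jacobian ψ y).transpose) x =
      (pdMat i (jacobian ψ) x).transpose := rfl
    rw [e1, e2, pdMat_congr hg.isOpen hx i h.pullback,
      pdMat_mul hg.isOpen hx i (hJs.transpose.mul hgs) hJs,
      pdMat_mul hg.isOpen hx i hJs.transpose hgs, hpg, e3, ← hJdef]
    simp only [D, Matrix.transpose_add, Matrix.transpose_sum, Matrix.transpose_smul,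
      Matrix.transpose_mul, add_mul, mul_add, Finset.sum_mul, Finset.mul_sum, smul_add,
      Finset.sum_add_distrib, smul_mul_assoc, mul_smul_comm, ← mul_assoc]
    abel
  have hu := hg.connMat_unique hx (fun i => J⁻¹ * D i) (fun i j a => by
    simp only [Matrix.mul_apply, hDs i j]) hC i
  rw [hu, ← mul_assoc, Matrix.mul_nonsing_inv _ hJ, one_mul]

/-- The second derivatives of `ψ`, which appear on differentiating `Jᵀ du'`, cancel against the
inhomogeneous term in the transformation law of the connection. -/
lemma hessVec_eq (h : IsIsometryOn g g' ψ Ω Ω') (hg : IsMetricOn g Ω)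
    (hg' : IsMetricOn g' Ω') (hu' : ContDiffOn ℝ ∞ u' Ω') (hu : ∀ y ∈ Ω, u y = u' (ψ y))
    (hx : x ∈ Ω) (i : Fin n) :
    hessVec g u i x =
      (jacobian ψ x).transpose.mulVec (∑ a, jacobian ψ x a i • hessVec g' u' a (ψ x)) := by
  have hJs := h.smooth_jacobian hg.isOpen
  have hds : SmoothVec (fun y => diffVec u' (ψ y)) Ω := fun a =>
    (smooth_diffVec hg'.isOpen hu' a).comp h.smooth h.mapsTo
  have e1 : pdVec i (fun y => diffVec u' (ψ y)) x =
      ∑ a, jacobian ψ x a i • pdVec a (diffVec u') (ψ x) := by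
    ext b
    simp only [Finset.sum_apply, Pi.smul_apply, smul_eq_mul]
    exact h.pd_comp hg.isOpen hg'.isOpen (smooth_diffVec hg'.isOpen hu' b) hx i
  have e3 : pdMat i (fun y => (jacobian ψ y).transpose) x =
    (pdMat i (jacobian ψ) x).transpose := rfl
  rw [hessVec, pdVec_congr hg.isOpen hx i fun y hy =>
      h.diffVec_eq hg.isOpen hg'.isOpen hu' hu hy,
    pdVec_mulVec hg.isOpen hx i hJs.transpose hds, e1, e3,
    h.diffVec_eq hg.isOpen hg'.isOpen hu' hu hx, Matrix.mulVec_mulVec, ← Matrix.transpose_mul,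
    h.jacobian_mul_connMat hg hg' hx]
  simp only [hessVec, Matrix.transpose_add, Matrix.transpose_sum, Matrix.transpose_smul,
    Matrix.transpose_mul, Matrix.add_mulVec, smul_sub, Finset.sum_sub_distrib, Matrix.mulVec_sub,
    Matrix.sum_mulVec, Matrix.mulVec_sum, Matrix.smul_mulVec, Matrix.mulVec_smul,
    Matrix.mulVec_mulVec]
  abel

lemma coordLaplacian_eq (h : IsIsometryOn g g' ψ Ω Ω') (hg : IsMetricOn g Ω)
    (hg' : IsMetricOn g' Ω') (hu' : ContDiffOn ℝ ∞ u' Ω') (hu : ∀ y ∈ Ω, u y = u' (ψ y))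
    (hx : x ∈ Ω) : coordLaplacian g u x = coordLaplacian g' u' (ψ x) := by
  rw [Biharm.coordLaplacian_eq, Biharm.coordLaplacian_eq]
  congr 1
  simp only [hessEnd, h.hessVec_eq hg hg' hu' hu hx, ← h.jacobian_mul_inv hg hx,
    Matrix.mulVec_mulVec]
  simp only [Matrix.mulVec, dotProduct, Finset.sum_apply, Pi.smul_apply, smul_eq_mul,
    Matrix.mul_assoc, Matrix.mul_apply (M := jacobian ψ x), Finset.mul_sum, Finset.sum_mul]
  calc _ = ∑ i, ∑ a, ∑ b, ((g x)⁻¹ * (jacobian ψ x).transpose) i b *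
        (jacobian ψ x a i * hessVec g' u' a (ψ x) b) :=
        Finset.sum_congr rfl fun i _ => Finset.sum_comm
    _ = ∑ a, ∑ i, ∑ b, ((g x)⁻¹ * (jacobian ψ x).transpose) i b *
        (jacobian ψ x a i * hessVec g' u' a (ψ x) b) := Finset.sum_comm
    _ = _ := Finset.sum_congr rfl fun a _ => by
        rw [Finset.sum_comm]
        exact Finset.sum_congr rfl fun b _ => Finset.sum_congr rfl fun i _ => by ring

end IsIsometryOn

end ChangeOfCoordinates

end Biharm

end

noncomputable section

namespace Biharm

/-! ### Charts of a Riemannian manifold -/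

section Charts

variable {n : ℕ} {N : Type*} [TopologicalSpace N] [ChartedSpace (Coord n) N]
  [IsManifold (𝓡 n) ∞ N]

lemma mdifferentiableAt_extChartAt_symm (p₀ : N) {x : Coord n}
    (hx : x ∈ (extChartAt (𝓡 n) p₀).target) :
    MDifferentiableAt 𝓘(ℝ, Coord n) (𝓡 n) (extChartAt (𝓡 n) p₀).symm x :=
  ((contMDiffOn_extChartAt_symm (n := ∞) p₀).contMDiffAt
    ((isOpen_extChartAt_target p₀).mem_nhds hx)).mdifferentiableAt (by simp)

/-- The field is the image of a constant section under the tangent map of the inverse chart. -/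
lemma contMDiffOn_coordVector (p₀ : N) (i : Fin n) :
    ContMDiffOn 𝓘(ℝ, Coord n) (𝓡 n).tangent ∞
      (fun x => Bundle.TotalSpace.mk' (Coord n) (E := fun p : N => TangentSpace (𝓡 n) p)
        ((extChartAt (𝓡 n) p₀).symm x) (coordVector p₀ i x)) (extChartAt (𝓡 n) p₀).target := by
  have hT : IsOpen (extChartAt (𝓡 n) p₀).target := isOpen_extChartAt_target p₀
  have h1 : ContMDiffOn 𝓘(ℝ, Coord n) 𝓘(ℝ, Coord n).tangent ∞
      (fun x : Coord n => (⟨x, (EuclideanSpace.single i 1 : Coord n)⟩ :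
        TangentBundle 𝓘(ℝ, Coord n) (Coord n))) (extChartAt (𝓡 n) p₀).target :=
    contMDiffOn_vectorSpace_iff_contDiffOn.2 contDiffOn_const
  have h2 := (contMDiffOn_extChartAt_symm (I := 𝓡 n) (n := ∞)
    p₀).contMDiffOn_tangentMapWithin (m := ∞) (by simp) hT.uniqueMDiffOn
  refine (h2.comp h1 fun x hx => hx).congr fun x hx => ?_
  simp only [Function.comp_apply]
  rw [tangentMapWithin_eq_tangentMap (hT.uniqueMDiffOn _ hx)
    (mdifferentiableAt_extChartAt_symm p₀ hx)]
  rfl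

lemma smooth_components (h : Metric n N) (p₀ : N) :
    SmoothMat (components h p₀) (extChartAt (𝓡 n) p₀).target := by
  intro i j
  have h1 := h.contMDiff.comp_contMDiffOn (contMDiffOn_extChartAt_symm (I := 𝓡 n) (n := ∞) p₀)
  have h2 : ContMDiffOn 𝓘(ℝ, Coord n) ((𝓡 n).prod 𝓘(ℝ, ℝ)) ∞
      (fun x => Bundle.TotalSpace.mk' ℝ (E := Bundle.Trivial N ℝ) ((extChartAt (𝓡 n) p₀).symm x)
        (h.inner ((extChartAt (𝓡 n) p₀).symm x) (coordVector p₀ i x) (coordVector p₀ j x)))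
      (extChartAt (𝓡 n) p₀).target := by
    apply ContMDiffOn.clm_bundle_apply₂ (F₁ := Coord n) (F₂ := Coord n)
    · exact h1
    · exact contMDiffOn_coordVector p₀ i
    · exact contMDiffOn_coordVector p₀ j
  have h3 : ContMDiffOn 𝓘(ℝ, Coord n) 𝓘(ℝ, ℝ) ∞ (fun x => components h p₀ x i j)
      (extChartAt (𝓡 n) p₀).target := fun x hx => by
    have := h2 x hx
    simp only [Bundle.contMDiffWithinAt_totalSpace] at this
    exact this.2
  exact h3.contDiffOn

lemma mfderiv_extChartAt_symm_injective (p₀ : N) {x : Coord n}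
    (hx : x ∈ (extChartAt (𝓡 n) p₀).target) :
    Function.Injective (mfderiv 𝓘(ℝ, Coord n) (𝓡 n) (extChartAt (𝓡 n) p₀).symm x) := by
  have h := isInvertible_mfderivWithin_extChartAt_symm (I := 𝓡 n) (x := p₀) hx
  have : range (𝓡 n) = univ := by simp
  rw [this, mfderivWithin_univ] at h
  obtain ⟨e, he⟩ := h
  rw [← he]
  exact e.injective

lemma sum_smul_coordVector (p₀ : N) (x w : Coord n) :
    ∑ i, w i • coordVector p₀ i x =
      mfderiv 𝓘(ℝ, Coord n) (𝓡 n) (extChartAt (𝓡 n) p₀).symm x w := by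
  have : (w : TangentSpace 𝓘(ℝ, Coord n) x) =
      ∑ i, w i • (EuclideanSpace.single i (1 : ℝ) : Coord n) := by
    ext j; simp [Pi.single_apply]
  conv_rhs => rw [this]
  erw [map_sum]
  refine Finset.sum_congr rfl fun i _ => ?_
  erw [map_smul]
  rfl

/-- The quadratic form is the metric evaluated on `∑ wᵢ ∂ᵢ`, which is nonzero because the inverse
chart has injective differential. -/
lemma components_pos (h : Metric n N) (p₀ : N) {x : Coord n}
    (hx : x ∈ (extChartAt (𝓡 n) p₀).target) {w : Fin n → ℝ} (hw : w ≠ 0) :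
    0 < dotProduct w ((components h p₀ x).mulVec w) := by
  have h1 : dotProduct w ((components h p₀ x).mulVec w) =
      h.inner _ (∑ i, w i • coordVector p₀ i x) (∑ j, w j • coordVector p₀ j x) := by
    simp only [dotProduct, Matrix.mulVec, components, Matrix.of_apply, map_sum, map_smul,
      sum_apply, smul_apply, smul_eq_mul, Finset.mul_sum]
    rw [Finset.sum_comm]
    exact Finset.sum_congr rfl fun j _ => Finset.sum_congr rfl fun i _ => by ring
  have h2 := sum_smul_coordVector p₀ x (WithLp.toLp 2 w)
  simp only at h2
  rw [h1, h2]
  refine h.pos _ _ fun h3 => hw ?_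
  have h4 : (WithLp.toLp 2 w : Coord n) = 0 :=
    mfderiv_extChartAt_symm_injective p₀ hx (h3.trans (map_zero _).symm)
  simpa using h4

lemma isMetricOn_components (h : Metric n N) (p₀ : N) :
    IsMetricOn (components h p₀) (extChartAt (𝓡 n) p₀).target where
  isOpen := isOpen_extChartAt_target p₀
  smooth := smooth_components h p₀
  symm x _ := by
    ext i j
    exact h.symm _ _ _
  det_ne x hx := by
    intro h0
    obtain ⟨w, hw, hw0⟩ := Matrix.exists_mulVec_eq_zero_iff.2 h0
    have h1 := components_pos h p₀ hx hw
    rw [hw0, dotProduct_zero] at h1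
    exact h1.false

lemma components_conformal (h : Metric n N) (ρ : C^∞⟮𝓡 n, N; ℝ⟯) (p₀ : N) (x : Coord n) :
    components (conformal h ρ) p₀ x =
      Real.exp (2 * ρ ((extChartAt (𝓡 n) p₀).symm x)) • components h p₀ x := rfl

/-- The domain of the change of coordinates between the charts around `p₀` and `p₁`. -/
def overlap (n : ℕ) {N : Type*} [TopologicalSpace N] [ChartedSpace (Coord n) N] (p₀ p₁ : N) :
    Set (Coord n) :=
  (extChartAt (𝓡 n) p₀).target ∩ (extChartAt (𝓡 n) p₀).symm ⁻¹' (extChartAt (𝓡 n) p₁).source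

lemma isOpen_overlap (p₀ p₁ : N) : IsOpen (overlap n p₀ p₁) :=
  (continuousOn_extChartAt_symm p₀).isOpen_inter_preimage (isOpen_extChartAt_target p₀)
    (isOpen_extChartAt_source p₁)

/-- Both matrices describe the same metric, and the chain rule expresses one coordinate frame
through the other by the Jacobian. -/
lemma isIsometryOn_overlap (h : Metric n N) (p₀ p₁ : N) :
    IsIsometryOn (components h p₀) (components h p₁)
      (fun x => extChartAt (𝓡 n) p₁ ((extChartAt (𝓡 n) p₀).symm x)) (overlap n p₀ p₁)
      (extChartAt (𝓡 n) p₁).target where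
  smooth := by
    have h1 : ContMDiffOn 𝓘(ℝ, Coord n) 𝓘(ℝ, Coord n) ∞
        (fun x => extChartAt (𝓡 n) p₁ ((extChartAt (𝓡 n) p₀).symm x)) (overlap n p₀ p₁) :=
      (contMDiffOn_extChartAt (I := 𝓡 n) (x := p₁)).comp
        ((contMDiffOn_extChartAt_symm (I := 𝓡 n) p₀).mono inter_subset_left)
        (fun x hx => by simpa using hx.2)
    exact h1.contDiffOn
  mapsTo x hx := (extChartAt (𝓡 n) p₁).map_source hx.2
  pullback x hx := by
    set ψ : Coord n → Coord n := fun x => extChartAt (𝓡 n) p₁ ((extChartAt (𝓡 n) p₀).symm x)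
      with hψ
    have hO := isOpen_overlap (n := n) p₀ p₁
    have hψx : ψ x ∈ (extChartAt (𝓡 n) p₁).target := (extChartAt (𝓡 n) p₁).map_source hx.2
    have hd : DifferentiableAt ℝ ψ x := by
      have h1 : ContMDiffOn 𝓘(ℝ, Coord n) 𝓘(ℝ, Coord n) ∞ ψ (overlap n p₀ p₁) :=
        (contMDiffOn_extChartAt (I := 𝓡 n) (x := p₁)).comp
          ((contMDiffOn_extChartAt_symm (I := 𝓡 n) p₀).mono inter_subset_left)
          (fun x hx => by simpa using hx.2)
      exact differentiableAt_of_contDiffOn h1.contDiffOn hO hx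
    have hpt : (extChartAt (𝓡 n) p₁).symm (ψ x) = (extChartAt (𝓡 n) p₀).symm x :=
      (extChartAt (𝓡 n) p₁).left_inv hx.2
    have hev : (extChartAt (𝓡 n) p₀).symm =ᶠ[𝓝 x] (extChartAt (𝓡 n) p₁).symm ∘ ψ :=
      Filter.eventuallyEq_of_mem (hO.mem_nhds hx) fun y hy =>
        ((extChartAt (𝓡 n) p₁).left_inv hy.2).symm
    have hcv : ∀ i, (coordVector p₀ i x : Coord n) =
        ∑ a, jacobian ψ x a i • (coordVector p₁ a (ψ x) : Coord n) := by
      intro i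
      have e1 : (fderiv ℝ ψ x (EuclideanSpace.single i 1)) =
          WithLp.toLp 2 fun a => jacobian ψ x a i := by
        ext a
        have h3 := (((EuclideanSpace.proj a : Coord n →L[ℝ] ℝ).hasFDerivAt (x := ψ x)).comp x
          hd.hasFDerivAt).fderiv
        simp only [jacobian, Matrix.of_apply, pd]
        erw [h3]
        rfl
      have e2 : (coordVector p₀ i x : Coord n) =
          mfderiv 𝓘(ℝ, Coord n) (𝓡 n) (extChartAt (𝓡 n) p₁).symm (ψ x)
            (fderiv ℝ ψ x (EuclideanSpace.single i 1)) := by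
        have h4 := mfderiv_comp x (mdifferentiableAt_extChartAt_symm p₁ hψx)
          hd.mdifferentiableAt
        unfold coordVector
        rw [hev.mfderiv_eq, h4, mfderiv_eq_fderiv]
        rfl
      have e3 := sum_smul_coordVector p₁ (ψ x) (WithLp.toLp 2 fun a => jacobian ψ x a i)
      rw [e2, e1]
      exact e3.symm
    -- The two base points are equal but not definitionally so; all vectors are viewed in the common
    -- model space `Coord n` to allow the rewriting.
    have hin : ∀ v w : Coord n, h.inner ((extChartAt (𝓡 n) p₀).symm x) v w =
        h.inner ((extChartAt (𝓡 n) p₁).symm (ψ x)) v w := by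
      intro v w
      rw [hpt]
    ext i j
    have e4 : components h p₀ x i j = h.inner ((extChartAt (𝓡 n) p₁).symm (ψ x))
        (∑ a, jacobian ψ x a i • (coordVector p₁ a (ψ x)))
        (∑ b, jacobian ψ x b j • (coordVector p₁ b (ψ x))) := by
      refine (hin _ _).trans ?_
      rw [hcv i, hcv j]
    rw [e4]
    simp only [Matrix.mul_apply, Matrix.transpose_apply, components, Matrix.of_apply, map_sum,
      map_smul, sum_apply, smul_apply, smul_eq_mul,
      Finset.sum_mul]
    refine Finset.sum_congr rfl fun b _ => ?_
    rw [Finset.mul_sum]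
    exact Finset.sum_congr rfl fun a _ =>
      (by intros; ring : ∀ s t v : ℝ, s * (t * v) = t * v * s) _ _ _

lemma IsMetricOn.mono {g : Coord n → Matrix (Fin n) (Fin n) ℝ} {Ω Ω' : Set (Coord n)}
    (hg : IsMetricOn g Ω) (hΩ' : IsOpen Ω') (hsub : Ω' ⊆ Ω) : IsMetricOn g Ω' where
  isOpen := hΩ'
  smooth a b := (hg.smooth a b).mono hsub
  symm y hy := hg.symm y (hsub hy)
  det_ne y hy := hg.det_ne y (hsub hy)

lemma contDiffOn_comp_extChartAt_symm {f : N → ℝ} {U : Set N} (hf : ContMDiffOn (𝓡 n) 𝓘(ℝ, ℝ) ∞ f U)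
    (p₀ : N) : ContDiffOn ℝ ∞ (f ∘ (extChartAt (𝓡 n) p₀).symm)
      ((extChartAt (𝓡 n) p₀).target ∩ (extChartAt (𝓡 n) p₀).symm ⁻¹' U) := by
  have h1 : ContMDiffOn 𝓘(ℝ, Coord n) 𝓘(ℝ, ℝ) ∞ (f ∘ (extChartAt (𝓡 n) p₀).symm)
      ((extChartAt (𝓡 n) p₀).target ∩ (extChartAt (𝓡 n) p₀).symm ⁻¹' U) :=
    hf.comp ((contMDiffOn_extChartAt_symm (I := 𝓡 n) p₀).mono inter_subset_left) fun x hx => hx.2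
  exact h1.contDiffOn

lemma contDiffOn_comp_symm (f : C^∞⟮𝓡 n, N; ℝ⟯) (p₀ : N) :
    ContDiffOn ℝ ∞ (f ∘ (extChartAt (𝓡 n) p₀).symm) (extChartAt (𝓡 n) p₀).target := by
  simpa using contDiffOn_comp_extChartAt_symm (f.contMDiff.contMDiffOn (s := univ)) p₀

section Invariance

variable (h : Metric n N) (f : C^∞⟮𝓡 n, N; ℝ⟯) {p₀ p : N}

lemma extChartAt_mem_overlap (hp : p ∈ (extChartAt (𝓡 n) p₀).source) :
    extChartAt (𝓡 n) p p ∈ overlap n p p₀ :=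
  ⟨mem_extChartAt_target p, by simpa using hp⟩

/-- `|df|²` can be computed in any chart. -/
lemma gradNormSq_eq (hp : p ∈ (extChartAt (𝓡 n) p₀).source) :
    gradNormSq h f p = coordGradNormSq (components h p₀) (f ∘ (extChartAt (𝓡 n) p₀).symm)
      (extChartAt (𝓡 n) p₀ p) := by
  have := (isIsometryOn_overlap h p p₀).coordGradNormSq_eq
    ((isMetricOn_components h p).mono (isOpen_overlap p p₀) inter_subset_left)
    (isMetricOn_components h p₀) (contDiffOn_comp_symm f p₀)
    (u := f ∘ (extChartAt (𝓡 n) p).symm)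
    (fun y hy => by simp only [Function.comp_apply]; rw [(extChartAt (𝓡 n) p₀).left_inv hy.2])
    (extChartAt_mem_overlap hp)
  rw [gradNormSq, this]
  simp

/-- The Laplacian can be computed in any chart. -/
lemma laplacian_eq (hp : p ∈ (extChartAt (𝓡 n) p₀).source) :
    laplacian h f p = coordLaplacian (components h p₀) (f ∘ (extChartAt (𝓡 n) p₀).symm)
      (extChartAt (𝓡 n) p₀ p) := by
  have := (isIsometryOn_overlap h p p₀).coordLaplacian_eq
    ((isMetricOn_components h p).mono (isOpen_overlap p p₀) inter_subset_left)
    (isMetricOn_components h p₀) (contDiffOn_comp_symm f p₀)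
    (u := f ∘ (extChartAt (𝓡 n) p).symm)
    (fun y hy => by simp only [Function.comp_apply]; rw [(extChartAt (𝓡 n) p₀).left_inv hy.2])
    (extChartAt_mem_overlap hp)
  rw [laplacian, this]
  simp

lemma gradNormSq_symm {x : Coord n} (hx : x ∈ (extChartAt (𝓡 n) p₀).target) :
    gradNormSq h f ((extChartAt (𝓡 n) p₀).symm x) =
      coordGradNormSq (components h p₀) (f ∘ (extChartAt (𝓡 n) p₀).symm) x := by
  rw [gradNormSq_eq h f ((extChartAt (𝓡 n) p₀).map_target hx),
    (extChartAt (𝓡 n) p₀).right_inv hx]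

lemma laplacian_symm {x : Coord n} (hx : x ∈ (extChartAt (𝓡 n) p₀).target) :
    laplacian h f ((extChartAt (𝓡 n) p₀).symm x) =
      coordLaplacian (components h p₀) (f ∘ (extChartAt (𝓡 n) p₀).symm) x := by
  rw [laplacian_eq h f ((extChartAt (𝓡 n) p₀).map_target hx),
    (extChartAt (𝓡 n) p₀).right_inv hx]

end Invariance

/-- The differential vanishes if and only if it vanishes in a chart. -/
lemma mfderiv_ne_zero_iff (f : C^∞⟮𝓡 n, N; ℝ⟯) {p₀ p : N} (hp : p ∈ (extChartAt (𝓡 n) p₀).source) :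
    mfderiv (𝓡 n) 𝓘(ℝ, ℝ) f p ≠ 0 ↔
      fderiv ℝ (f ∘ (extChartAt (𝓡 n) p₀).symm) (extChartAt (𝓡 n) p₀ p) ≠ 0 := by
  set x := extChartAt (𝓡 n) p₀ p with hxdef
  have hx : x ∈ (extChartAt (𝓡 n) p₀).target := (extChartAt (𝓡 n) p₀).map_source hp
  have hpx : (extChartAt (𝓡 n) p₀).symm x = p := (extChartAt (𝓡 n) p₀).left_inv hp
  have hf : ∀ q, MDifferentiableAt (𝓡 n) 𝓘(ℝ, ℝ) f q := fun q =>
    f.contMDiff.mdifferentiable (by simp) q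
  refine not_congr ⟨fun h0 => ?_, fun h0 => ?_⟩
  · have h1 := mfderiv_comp x (hf ((extChartAt (𝓡 n) p₀).symm x))
      (mdifferentiableAt_extChartAt_symm p₀ hx)
    rw [← mfderiv_eq_fderiv, h1, hpx, h0]
    exact ContinuousLinearMap.zero_comp _
  · have hd : MDifferentiableAt 𝓘(ℝ, Coord n) 𝓘(ℝ, ℝ) (f ∘ (extChartAt (𝓡 n) p₀).symm)
        (extChartAt (𝓡 n) p₀ p) :=
      (differentiableAt_of_contDiffOn (contDiffOn_comp_symm f p₀)
        (isOpen_extChartAt_target p₀) hx).mdifferentiableAt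
    have he : MDifferentiableAt (𝓡 n) 𝓘(ℝ, Coord n) (extChartAt (𝓡 n) p₀) p :=
      mdifferentiableAt_extChartAt (by simpa using hp)
    have h1 := mfderiv_comp p hd he
    have hev : (f : N → ℝ) =ᶠ[𝓝 p] (f ∘ (extChartAt (𝓡 n) p₀).symm) ∘ extChartAt (𝓡 n) p₀ :=
      Filter.eventuallyEq_of_mem ((isOpen_extChartAt_source p₀).mem_nhds hp) fun q hq => by
        simp only [Function.comp_apply]
        rw [(extChartAt (𝓡 n) p₀).left_inv hq]
    rw [hev.mfderiv_eq, h1, mfderiv_eq_fderiv, ← hxdef, h0]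
    exact ContinuousLinearMap.zero_comp _

end Charts

end Biharm

end

noncomputable section

namespace Biharm

/-! ### Functions of a function -/

lemma hasFDerivAt_apply_sub {E : Type*} [NormedAddCommGroup E] [NormedSpace ℝ E] (ℓ : E →L[ℝ] ℝ)
    (a z : E) : HasFDerivAt (fun x => ℓ (x - a)) ℓ z := by
  simpa only [map_sub] using ℓ.hasFDerivAt.sub_const (ℓ a)

section Factorization

variable {E : Type*} [NormedAddCommGroup E] [NormedSpace ℝ E] [CompleteSpace E]
  {Ω : Set E} {x₀ : E} {ρ : E → ℝ}

/-- Near a regular point of `ρ`, smooth coordinates can be introduced in which `ρ` is affine. -/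
lemma exists_straightening (hΩ : IsOpen Ω) (hx₀ : x₀ ∈ Ω) (hρ : ContDiffOn ℝ ∞ ρ Ω)
    (h0 : fderiv ℝ ρ x₀ ≠ 0) :
    ∃ (Φ Ψ : E → E) (ℓ : E →L[ℝ] ℝ) (w : E) (δ : ℝ), 0 < δ ∧ ℓ w = 1 ∧ ContinuousAt Φ x₀ ∧
      Φ x₀ = x₀ ∧ ContDiffOn ℝ ∞ Ψ (Metric.ball x₀ δ) ∧ MapsTo Ψ (Metric.ball x₀ δ) Ω ∧
      (∀ z ∈ Metric.ball x₀ δ, ρ (Ψ z) = ρ x₀ + ℓ (z - x₀)) ∧ (∀ᶠ x in 𝓝 x₀, Ψ (Φ x) = x) ∧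
      ∀ x, ℓ (Φ x - x₀) = ρ x - ρ x₀ := by
  set ℓ := fderiv ℝ ρ x₀ with hℓ
  obtain ⟨w₀, hw₀⟩ : ∃ w, ℓ w ≠ 0 := by
    by_contra! h
    exact h0 (ContinuousLinearMap.ext h)
  set w : E := (ℓ w₀)⁻¹ • w₀ with hw
  have hw1 : ℓ w = 1 := by simp [hw, hw₀]
  -- Shifting along `w`, where `ℓ w = 1`, replaces the affine approximation of `ρ` by `ρ` itself.
  -- The shift vanishes to first order at `x₀`, so `Φ` has the identity as differential there.
  let Φ : E → E := fun x => x + (ρ x - ρ x₀ - ℓ (x - x₀)) • w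
  have hΦs : ContDiffOn ℝ ∞ Φ Ω := contDiffOn_id.add
    (((hρ.sub contDiffOn_const).sub
      (ℓ.contDiff.comp_contDiffOn (contDiffOn_id.sub contDiffOn_const))).smul contDiffOn_const)
  have hΦx : Φ x₀ = x₀ := by simp [Φ]
  have hΦℓ : ∀ x, ℓ (Φ x - x₀) = ρ x - ρ x₀ := fun x => by
    simp only [Φ, map_sub, map_add, map_smul, smul_eq_mul, hw1]
    ring
  have hΦa : ContDiffAt ℝ ∞ Φ x₀ := hΦs.contDiffAt (hΩ.mem_nhds hx₀)
  have hΦd : HasFDerivAt Φ ((ContinuousLinearEquiv.refl ℝ E : E ≃L[ℝ] E) : E →L[ℝ] E) x₀ := by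
    have h1 : HasFDerivAt ρ ℓ x₀ := (differentiableAt_of_contDiffOn hρ hΩ hx₀).hasFDerivAt
    have h2 : HasFDerivAt (fun x => ℓ (x - x₀)) ℓ x₀ :=
      hasFDerivAt_apply_sub ℓ x₀ x₀
    have h3 := (hasFDerivAt_id x₀).add (((h1.sub_const (ρ x₀)).sub h2).smul_const w)
    refine h3.congr_fderiv ?_
    ext v
    simp
  let e := hΦa.toOpenPartialHomeomorph Φ hΦd (by simp)
  have hes : x₀ ∈ e.source := hΦa.mem_toOpenPartialHomeomorph_source hΦd (by simp)
  have hec : ∀ x, e x = Φ x := fun _ => rfl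
  have het : x₀ ∈ e.target := by
    have := e.map_source hes
    rwa [hec, hΦx] at this
  have hesx : e.symm x₀ = x₀ := by
    have := e.left_inv hes
    rwa [hec, hΦx] at this
  -- Smoothness of the inverse on a whole ball needs `dΦ` to be invertible at nearby points too;
  -- invertible operators form an open set.
  have hinv : ∀ᶠ x in 𝓝 x₀, x ∈ Ω ∧ fderiv ℝ Φ x ∈ range ((↑) : (E ≃L[ℝ] E) → E →L[ℝ] E) := by
    refine (hΩ.eventually_mem hx₀).and ?_
    have hc : ContinuousAt (fderiv ℝ Φ) x₀ :=
      (hΦs.continuousOn_fderiv_of_isOpen hΩ (by simp)).continuousAt (hΩ.mem_nhds hx₀)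
    exact hc.eventually_mem
      (by rw [hΦd.fderiv]; exact ContinuousLinearEquiv.nhds (ContinuousLinearEquiv.refl ℝ E))
  have hball : ∀ᶠ z in 𝓝 x₀, z ∈ e.target ∧ e.symm z ∈ Ω ∧
      fderiv ℝ Φ (e.symm z) ∈ range ((↑) : (E ≃L[ℝ] E) → E →L[ℝ] E) := by
    refine (e.open_target.eventually_mem het).and ?_
    have hc := e.continuousAt_symm het
    exact hc.eventually (by rw [hesx]; exact hinv)
  obtain ⟨δ, hδ, hB⟩ := Metric.eventually_nhds_iff_ball.1 hball
  refine ⟨Φ, e.symm, ℓ, w, δ, hδ, hw1, hΦa.continuousAt, hΦx, ?_, fun z hz => (hB z hz).2.1, ?_,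
    ?_, hΦℓ⟩
  · intro z hz
    obtain ⟨h1, h2, e', he'⟩ := hB z hz
    refine (e.contDiffAt_symm h1 (f₀' := e') ?_ ?_).contDiffWithinAt
    · rw [he']
      exact (differentiableAt_of_contDiffOn hΦs hΩ h2).hasFDerivAt
    · exact hΦs.contDiffAt (hΩ.mem_nhds h2)
  · intro z hz
    have h1 : Φ (e.symm z) = z := e.right_inv (hB z hz).1
    have h2 := hΦℓ (e.symm z)
    rw [h1] at h2
    rw [h2]
    ring
  · filter_upwards [e.open_source.mem_nhds hes] with x hx using e.left_inv hx

/-- Near a regular point of `ρ`, every function whose differential is a multiple of `dρ` is a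
smooth function of `ρ`. -/
theorem exists_factorization (hΩ : IsOpen Ω) (hx₀ : x₀ ∈ Ω) (hρ : ContDiffOn ℝ ∞ ρ Ω)
    (h0 : fderiv ℝ ρ x₀ ≠ 0) :
    ∃ (O : Set E) (V : Set ℝ) (κ : ℝ → E), IsOpen O ∧ x₀ ∈ O ∧ O ⊆ Ω ∧ IsOpen V ∧ MapsTo ρ O V ∧
      ContDiffOn ℝ ∞ κ V ∧ MapsTo κ V Ω ∧ ∀ u : E → ℝ, ContDiffOn ℝ ∞ u Ω →
        (∀ x ∈ Ω, ∀ v, fderiv ℝ ρ x v = 0 → fderiv ℝ u x v = 0) → ∀ x ∈ O, u x = u (κ (ρ x)) := by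
  obtain ⟨Φ, Ψ, ℓ, w, δ, hδ, hw, hΦc, hΦx, hΨ, hΨm, hρΨ, hΨΦ, hΦℓ⟩ :=
    exists_straightening hΩ hx₀ hρ h0
  set B := Metric.ball x₀ δ with hBdef
  -- A line transversal to the straightened levels: `Ψ ∘ c` is a smooth section of `ρ`, meeting the
  -- level `t` at parameter `t`.
  let c : ℝ → E := fun t => x₀ + (t - ρ x₀) • w
  have hc : ContDiff ℝ ∞ c :=
    contDiff_const.add ((contDiff_id.sub contDiff_const).smul contDiff_const)
  let V : Set ℝ := c ⁻¹' B
  have hV : IsOpen V := Metric.isOpen_ball.preimage hc.continuous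
  have hx₀V : ρ x₀ ∈ V := by simp [V, c, hBdef, hδ]
  have hρc : ContinuousAt ρ x₀ := (differentiableAt_of_contDiffOn hρ hΩ hx₀).continuousAt
  have hev : ∀ᶠ x in 𝓝 x₀, x ∈ Ω ∧ Φ x ∈ B ∧ ρ x ∈ V ∧ Ψ (Φ x) = x :=
    (hΩ.eventually_mem hx₀).and
      ((hΦc.eventually_mem (by rw [hΦx]; exact Metric.ball_mem_nhds x₀ hδ)).and
        ((hρc.eventually_mem (hV.mem_nhds hx₀V)).and hΨΦ))
  obtain ⟨O, hO, hOo, hxO⟩ := eventually_nhds_iff.1 hev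
  refine ⟨O, V, Ψ ∘ c, hOo, hxO, fun x hx => (hO x hx).1, hV, fun x hx => (hO x hx).2.2.1,
    hΨ.comp hc.contDiffOn fun t ht => ht, fun t ht => hΨm ht, fun u hu hdu x hx => ?_⟩
  obtain ⟨-, hxB, hxV, hxΨ⟩ := hO x hx
  have hker : ℓ (Φ x - c (ρ x)) = 0 := by
    have h1 : Φ x - c (ρ x) = (Φ x - x₀) - (ρ x - ρ x₀) • w := by simp only [c]; abel
    rw [h1, map_sub, hΦℓ, map_smul, hw]
    simp
  have hd : ∀ z ∈ B, HasFDerivWithinAt (u ∘ Ψ) ((fderiv ℝ u (Ψ z)).comp (fderiv ℝ Ψ z)) B z := by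
    intro z hz
    have h1 := differentiableAt_of_contDiffOn hu hΩ (hΨm hz)
    have h2 := differentiableAt_of_contDiffOn hΨ Metric.isOpen_ball hz
    exact (h1.hasFDerivAt.comp z h2.hasFDerivAt).hasFDerivWithinAt
  -- The segment from `c (ρ x)` to `Φ x` stays in the ball and its direction lies in `ker ℓ`, along
  -- which `ρ ∘ Ψ` is constant; the mean value theorem then shows that `u ∘ Ψ` has equal values at
  -- its ends.
  obtain ⟨z, hz, hmv⟩ := domain_mvt hd (convex_ball x₀ δ) (show c (ρ x) ∈ B from hxV) hxB
  have hzB : z ∈ B := (convex_ball x₀ δ).segment_subset hxV hxB hz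
  have h3 : fderiv ℝ ρ (Ψ z) (fderiv ℝ Ψ z (Φ x - c (ρ x))) = 0 := by
    have h1 := differentiableAt_of_contDiffOn hρ hΩ (hΨm hzB)
    have h2 := differentiableAt_of_contDiffOn hΨ Metric.isOpen_ball hzB
    have h4 : HasFDerivAt (ρ ∘ Ψ) ℓ z := by
      have h5 : HasFDerivAt (fun z => ρ x₀ + ℓ (z - x₀)) ℓ z :=
        (hasFDerivAt_apply_sub ℓ x₀ z).const_add (ρ x₀)
      exact h5.congr_of_eventuallyEq
        (Filter.eventuallyEq_of_mem (Metric.isOpen_ball.mem_nhds hzB) hρΨ)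
    have h6 := (h1.hasFDerivAt.comp z h2.hasFDerivAt).unique h4
    rw [← hker, ← h6]
    rfl
  have h7 := hdu _ (hΨm hzB) _ h3
  have h8 : u (Ψ (Φ x)) - u (Ψ (c (ρ x))) = 0 := hmv.trans h7
  rw [hxΨ] at h8
  exact sub_eq_zero.1 h8

/-- A function maps neighbourhoods of a regular point onto neighbourhoods of its value. -/
lemma image_mem_nhds_of_fderiv_ne_zero (hΩ : IsOpen Ω) (hx₀ : x₀ ∈ Ω) (hρ : ContDiffOn ℝ ∞ ρ Ω)
    (h0 : fderiv ℝ ρ x₀ ≠ 0) {O : Set E} (hO : O ∈ 𝓝 x₀) : ρ '' O ∈ 𝓝 (ρ x₀) := by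
  have hs : HasStrictFDerivAt ρ (fderiv ℝ ρ x₀) x₀ :=
    (hρ.contDiffAt (hΩ.mem_nhds hx₀)).hasStrictFDerivAt (by simp)
  have hr : (fderiv ℝ ρ x₀).range = ⊤ := by
    refine LinearMap.range_eq_top.2 (LinearMap.surjective ?_)
    intro h
    exact h0 (ContinuousLinearMap.coe_injective h)
  rw [← hs.map_nhds_eq_of_surj hr]
  exact Filter.image_mem_map hO

end Factorization

/-! ### The equation of biharmonicity for functions of a function -/

section Coordinates

variable {n : ℕ} {g : Coord n → Matrix (Fin n) (Fin n) ℝ} {Ω : Set (Coord n)} {x : Coord n}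

namespace IsMetricOn

/-- If the one-form of biharmonicity vanishes, then the differentials of `|dρ|²` and of `Δρ` are
proportional to `dρ`. -/
lemma pd_mul_pd_of_conformalForm (hg : IsMetricOn g Ω) (hn4 : n ≠ 4) {c : ℝ} {ρ : Coord n → ℝ}
    (hρ : ContDiffOn ℝ ∞ ρ Ω) (h : ∀ y ∈ Ω, ∀ b, conformalForm g c ρ b y = 0) (hx : x ∈ Ω)
    (a b : Fin n) :
    pd a (coordGradNormSq g ρ) x * pd b ρ x = pd b (coordGradNormSq g ρ) x * pd a ρ x ∧
      pd a (coordLaplacian g ρ) x * pd b ρ x = pd b (coordLaplacian g ρ) x * pd a ρ x := by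
  set U := coordGradNormSq g ρ
  set D := coordLaplacian g ρ
  have hU : ContDiffOn ℝ ∞ U Ω := hg.contDiffOn_coordGradNormSq hρ
  have hD : ContDiffOn ℝ ∞ D Ω := hg.contDiffOn_coordLaplacian hρ
  have dU := differentiableAt_of_contDiffOn hU hg.isOpen hx
  have dD := differentiableAt_of_contDiffOn hD hg.isOpen hx
  have d1 := fun a => differentiableAt_of_contDiffOn (contDiffOn_pd hg.isOpen hρ a) hg.isOpen hx
  have d2 := fun a => differentiableAt_of_contDiffOn (contDiffOn_pd hg.isOpen hU a) hg.isOpen hx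
  have hform : ∀ y ∈ Ω, ∀ b, pd b D y = ((6 - n) / 2) * pd b U y
      + (2 * D y + (2 - n) * U y + 2 * c) * pd b ρ y := fun y hy b => by
    have := h y hy b
    rw [conformalForm] at this
    linear_combination -this
  -- The derivatives whose antisymmetrisation is the exterior derivative of the one-form.
  have hdiff : ∀ a b, pd a (pd b D) x = ((6 - n) / 2) * pd a (pd b U) x
      + ((2 * pd a D x + (2 - n) * pd a U x) * pd b ρ x
        + (2 * D x + (2 - n) * U x + 2 * c) * pd a (pd b ρ) x) := by
    intro a b
    have dQ1 : DifferentiableAt ℝ (fun y => 2 * D y + (2 - n) * U y) x :=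
      (dD.const_mul _).fun_add (dU.const_mul _)
    have dQ : DifferentiableAt ℝ (fun y => 2 * D y + (2 - n) * U y + 2 * c) x :=
      dQ1.fun_add (differentiableAt_const _)
    rw [pd_congr hg.isOpen hx a fun y hy => hform y hy b,
      pd_add a ((d2 b).const_mul _) (dQ.fun_mul (d1 b)), pd_const_mul a _ (d2 b),
      pd_mul a dQ (d1 b), pd_add a dQ1 (differentiableAt_const _),
      pd_add a (dD.const_mul _) (dU.const_mul _), pd_const_mul a _ dD, pd_const_mul a _ dU, pd_const]
    ring
  have h1 := hdiff a b
  have h2 := hdiff b a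
  rw [pd_comm hg.isOpen hD hx b a, pd_comm hg.isOpen hU hx b a, pd_comm hg.isOpen hρ hx b a] at h2
  have h3 := hform x hx a
  have h4 := hform x hx b
  have hn : (8 - 2 * n : ℝ) ≠ 0 := by
    intro h0
    apply hn4
    have : (n : ℝ) = 4 := by linarith
    exact_mod_cast this
  have h5 : pd a U x * pd b ρ x = pd b U x * pd a ρ x := by
    -- `h1` and `h2` encode the exterior derivative, `h3` and `h4` the wedge product with `dρ`; the
    -- coefficient is `(2 - n) + (6 - n)`.
    have : (8 - 2 * n : ℝ) * (pd a U x * pd b ρ x - pd b U x * pd a ρ x) = 0 := by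
      linear_combination h2 - h1 - 2 * pd b ρ x * h3 + 2 * pd a ρ x * h4
    exact sub_eq_zero.1 ((mul_eq_zero.1 this).resolve_left hn)
  refine ⟨h5, ?_⟩
  linear_combination pd b ρ x * h3 - pd a ρ x * h4 + ((6 - n) / 2) * h5

end IsMetricOn

/-- If `du ∧ dρ = 0` and `dρ ≠ 0`, then `du` is a multiple of `dρ` and so vanishes on its kernel. -/
lemma fderiv_eq_zero_of_pd_mul_pd {ρ u : Coord n → ℝ} (h0 : fderiv ℝ ρ x ≠ 0)
    (h : ∀ a b, pd a u x * pd b ρ x = pd b u x * pd a ρ x) (v : Coord n)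
    (hv : fderiv ℝ ρ x v = 0) : fderiv ℝ u x v = 0 := by
  obtain ⟨b, hb⟩ : ∃ b, pd b ρ x ≠ 0 := by
    by_contra! h1
    exact h0 (ContinuousLinearMap.ext fun w => by rw [fderiv_eq_sum_pd]; simp [h1])
  have h2 : fderiv ℝ u x v * pd b ρ x = 0 := by
    rw [← mul_zero (pd b u x), ← hv, fderiv_eq_sum_pd, fderiv_eq_sum_pd, Finset.sum_mul,
      Finset.mul_sum]
    exact Finset.sum_congr rfl fun a _ => by rw [mul_assoc, h a b]; ring
  exact (mul_eq_zero.1 h2).resolve_right hb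

namespace IsMetricOn

variable {f : Coord n → ℝ} {r : ℝ → ℝ}

lemma coordGradNormSq_comp (hg : IsMetricOn g Ω) (hf : ContDiffOn ℝ ∞ f Ω) (hr : ContDiff ℝ ∞ r)
    (hx : x ∈ Ω) :
    coordGradNormSq g (fun y => r (f y)) x = deriv r (f x) ^ 2 * coordGradNormSq g f x := by
  have df := differentiableAt_of_contDiffOn hf hg.isOpen hx
  have dr := hr.differentiable (by simp) (f x)
  simp only [coordGradNormSq, pd_comp _ dr df, Finset.mul_sum]
  exact Finset.sum_congr rfl fun i _ => Finset.sum_congr rfl fun j _ => by ring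

lemma coordLaplacian_comp (hg : IsMetricOn g Ω) (hf : ContDiffOn ℝ ∞ f Ω) (hr : ContDiff ℝ ∞ r)
    (hx : x ∈ Ω) :
    coordLaplacian g (fun y => r (f y)) x =
      deriv r (f x) * coordLaplacian g f x - deriv (deriv r) (f x) * coordGradNormSq g f x := by
  have df : ∀ {y}, y ∈ Ω → DifferentiableAt ℝ f y := differentiableAt_of_contDiffOn hf hg.isOpen
  have dr := hr.differentiable (by simp)
  have hr' : ContDiff ℝ ∞ (deriv r) := (contDiff_infty_iff_deriv.1 hr).2
  have dr' := hr'.differentiable (by simp)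
  have h1 : ∀ i j, pd i (pd j (fun y => r (f y))) x =
      deriv (deriv r) (f x) * (pd i f x * pd j f x) + deriv r (f x) * pd i (pd j f) x := by
    intro i j
    have d1 := differentiableAt_of_contDiffOn (contDiffOn_pd hg.isOpen hf j) hg.isOpen hx
    have d2 : DifferentiableAt ℝ (fun y => deriv r (f y)) x := (dr' (f x)).comp x (df hx)
    rw [pd_congr hg.isOpen hx i fun y hy => pd_comp j (dr (f y)) (df hy), pd_mul i d2 d1,
      pd_comp i (dr' (f x)) (df hx)]
    ring
  have h2 : ∀ i j, (g x)⁻¹ i j * (pd i (pd j (fun y => r (f y))) x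
      - ∑ k, christoffel g k i j x * pd k (fun y => r (f y)) x) =
      deriv (deriv r) (f x) * ((g x)⁻¹ i j * (pd i f x * pd j f x))
      + deriv r (f x) * ((g x)⁻¹ i j * (pd i (pd j f) x
        - ∑ k, christoffel g k i j x * pd k f x)) := by
    intro i j
    have : ∑ k, christoffel g k i j x * (deriv r (f x) * pd k f x) =
        deriv r (f x) * ∑ k, christoffel g k i j x * pd k f x := by
      rw [Finset.mul_sum]
      exact Finset.sum_congr rfl fun k _ => by ring
    simp only [h1, pd_comp _ (dr (f x)) (df hx), this]
    ring
  simp only [coordLaplacian, coordGradNormSq, h2, Finset.sum_add_distrib, ← Finset.mul_sum]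
  ring

/-- The one-form of biharmonicity for a function of a function `f` with `|df|² = γ ∘ f` and
`Δf = σ ∘ f`. -/
theorem conformalForm_comp (hg : IsMetricOn g Ω) (hf : ContDiffOn ℝ ∞ f Ω) (hr : ContDiff ℝ ∞ r)
    {γ σ : ℝ → ℝ} (hγ : ∀ y ∈ Ω, coordGradNormSq g f y = γ (f y))
    (hσ : ∀ y ∈ Ω, coordLaplacian g f y = σ (f y)) (hx : x ∈ Ω)
    (dγ : DifferentiableAt ℝ γ (f x)) (dσ : DifferentiableAt ℝ σ (f x)) (c : ℝ) (b : Fin n) :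
    conformalForm g c (fun y => r (f y)) b x =
      (deriv (deriv (deriv r)) (f x) * γ (f x) + deriv (deriv r) (f x) * deriv γ (f x)
        - deriv σ (f x) * deriv r (f x) - σ (f x) * deriv (deriv r) (f x)
        + ((6 - n) / 2) * (2 * deriv r (f x) * deriv (deriv r) (f x) * γ (f x)
          + deriv r (f x) ^ 2 * deriv γ (f x))
        + (2 * (deriv r (f x) * σ (f x) - deriv (deriv r) (f x) * γ (f x))
          + (2 - n) * (deriv r (f x) ^ 2 * γ (f x)) + 2 * c) * deriv r (f x)) * pd b f x := by
  have df : ∀ {y}, y ∈ Ω → DifferentiableAt ℝ f y := differentiableAt_of_contDiffOn hf hg.isOpen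
  have dr := hr.differentiable (by simp)
  have hr' : ContDiff ℝ ∞ (deriv r) := (contDiff_infty_iff_deriv.1 hr).2
  have dr' := hr'.differentiable (by simp)
  have hr'' : ContDiff ℝ ∞ (deriv (deriv r)) := (contDiff_infty_iff_deriv.1 hr').2
  have dr'' := hr''.differentiable (by simp)
  have hU : ∀ y ∈ Ω, coordGradNormSq g (fun y => r (f y)) y =
      (fun t => deriv r t ^ 2 * γ t) (f y) := fun y hy => by
    rw [hg.coordGradNormSq_comp hf hr hy, hγ y hy]
  have hD : ∀ y ∈ Ω, coordLaplacian g (fun y => r (f y)) y =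
      (fun t => deriv r t * σ t - deriv (deriv r) t * γ t) (f y) := fun y hy => by
    rw [hg.coordLaplacian_comp hf hr hy, hγ y hy, hσ y hy]
  have h1 := (((dr' (f x)).hasDerivAt.fun_pow 2).fun_mul dγ.hasDerivAt)
  have h2 := ((dr' (f x)).hasDerivAt.fun_mul dσ.hasDerivAt).fun_sub
    ((dr'' (f x)).hasDerivAt.fun_mul dγ.hasDerivAt)
  rw [conformalForm, pd_congr hg.isOpen hx b hU, pd_congr hg.isOpen hx b hD,
    pd_comp b h1.differentiableAt (df hx), pd_comp b h2.differentiableAt (df hx), h1.deriv, h2.deriv,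
    hU x hx, hD x hx, pd_comp b (dr (f x)) (df hx)]
  simp only [Nat.cast_ofNat, Nat.add_one_sub_one, pow_one]
  ring

end IsMetricOn

end Coordinates

end Biharm

end

noncomputable section

namespace Biharm

/-! ### Smooth solutions of ordinary differential equations -/

section ODE

/-- Integral curves of a smooth vector field are smooth. -/
lemma contDiffOn_of_hasDerivAt {E : Type*} [NormedAddCommGroup E] [NormedSpace ℝ E] {F : E → E}
    {W : Set E} (hF : ContDiffOn ℝ ∞ F W) {α : ℝ → E} {I : Set ℝ} (hI : IsOpen I)
    (hα : ∀ t ∈ I, HasDerivAt α (F (α t)) t) (hm : MapsTo α I W) : ContDiffOn ℝ ∞ α I := by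
  rw [contDiffOn_infty]
  intro k
  -- Bootstrapping: if `α` is `C^k`, so is its derivative `F ∘ α`, and hence `α` is `C^{k+1}`.
  induction k with
  | zero => exact contDiffOn_zero.2 fun t ht => (hα t ht).continuousAt.continuousWithinAt
  | succ k ih =>
    have h := (contDiffOn_succ_iff_deriv_of_isOpen (n := (k : WithTop ℕ∞)) (f := α) hI).2
      ⟨fun t ht => (hα t ht).differentiableAt.differentiableWithinAt, by simp,
        ((hF.of_le (by exact_mod_cast le_top)).comp ih hm).congr fun t ht => (hα t ht).deriv⟩
    exact_mod_cast h

/-- A smooth function on a neighbourhood of a point agrees near this point with a smooth function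
on the line. -/
lemma exists_contDiff_eqOn {r : ℝ → ℝ} {t₀ ε : ℝ} (hε : 0 < ε)
    (hr : ContDiffOn ℝ ∞ r (Ioo (t₀ - ε) (t₀ + ε))) :
    ∃ r' : ℝ → ℝ, ContDiff ℝ ∞ r' ∧ EqOn r' r (Ioo (t₀ - ε / 3) (t₀ + ε / 3)) := by
  -- The outer radius `ε / 2` is less than `ε`, so the cut-off product is zero near every point
  -- where `r` might fail to be smooth.
  let χ : ContDiffBump t₀ := ⟨ε / 3, ε / 2, by positivity, by linarith⟩
  refine ⟨fun t => χ t * r t, ?_, fun t ht => ?_⟩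
  · rw [contDiff_iff_contDiffAt]
    intro t
    by_cases ht : t ∈ Ioo (t₀ - ε) (t₀ + ε)
    · exact χ.contDiff.contDiffAt.mul (hr.contDiffAt (isOpen_Ioo.mem_nhds ht))
    · have h0 : ∀ᶠ s in 𝓝 t, χ s * r s = 0 := by
        have hclosed : IsOpen (Metric.closedBall t₀ (ε / 2))ᶜ := Metric.isClosed_closedBall.isOpen_compl
        have htc : t ∈ (Metric.closedBall t₀ (ε / 2))ᶜ := by
          intro h
          rw [Metric.mem_closedBall, Real.dist_eq, abs_le] at h
          exact ht ⟨by linarith, by linarith⟩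
        filter_upwards [hclosed.mem_nhds htc] with s hs
        rw [χ.zero_of_le_dist (not_le.1 fun h => hs (Metric.mem_closedBall.2 h)).le, zero_mul]
      exact contDiffAt_const.congr_of_eventuallyEq h0
  · have : t ∈ Metric.closedBall t₀ (ε / 3) := by
      rw [Metric.mem_closedBall, Real.dist_eq, abs_le]
      exact ⟨by linarith [ht.1], by linarith [ht.2]⟩
    simp only [χ.one_of_mem_closedBall this, one_mul]

/-- Local solvability of `y'' = F(t, y, y')` for the derivative `y` of a smooth function `r`
on the line, with `y` nowhere zero. -/
theorem exists_contDiff_deriv_eq {S : Set ℝ} (hS : IsOpen S) {t₀ : ℝ} (ht₀ : t₀ ∈ S)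
    {F : ℝ × ℝ × ℝ → ℝ} (hF : ContDiffOn ℝ ∞ F (S ×ˢ univ)) :
    ∃ (ε : ℝ) (r : ℝ → ℝ), 0 < ε ∧ ContDiff ℝ ∞ r ∧ ∀ t ∈ Ioo (t₀ - ε) (t₀ + ε), t ∈ S ∧
      deriv r t ≠ 0 ∧ deriv (deriv (deriv r)) t = F (t, deriv r t, deriv (deriv r) t) := by
  -- The equation as an autonomous first-order system for `(t, r, r', r'')`; carrying `r` along
  -- avoids a separate integration of `r'`.
  let X : ℝ × ℝ × ℝ × ℝ → ℝ × ℝ × ℝ × ℝ := fun p => (1, p.2.2.1, p.2.2.2, F (p.1, p.2.2))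
  let W : Set (ℝ × ℝ × ℝ × ℝ) := S ×ˢ (univ ×ˢ ({0}ᶜ ×ˢ univ))
  have hW : IsOpen W := hS.prod (isOpen_univ.prod (isOpen_compl_singleton.prod isOpen_univ))
  have hX : ContDiffOn ℝ ∞ X W := by
    have h1 : ContDiffOn ℝ ∞ (fun p : ℝ × ℝ × ℝ × ℝ => F (p.1, p.2.2)) W :=
      hF.comp (g := F) (f := fun p : ℝ × ℝ × ℝ × ℝ => (p.1, p.2.2)) (by fun_prop)
        fun p hp => ⟨hp.1, trivial⟩
    exact contDiffOn_const.prodMk ((by fun_prop : ContDiff ℝ ∞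
      fun p : ℝ × ℝ × ℝ × ℝ => p.2.2.1).contDiffOn.prodMk ((by fun_prop : ContDiff ℝ ∞
      fun p : ℝ × ℝ × ℝ × ℝ => p.2.2.2).contDiffOn.prodMk h1))
  -- The initial value `1` for `r'` is an arbitrary nonzero choice; `W` excludes `r' = 0`, and the
  -- solution stays in `W` for a short time.
  let p₀ : ℝ × ℝ × ℝ × ℝ := (t₀, 0, 1, 0)
  have hp₀ : p₀ ∈ W := ⟨ht₀, trivial, by simp [p₀], trivial⟩
  obtain ⟨α, hα₀, ε₁, hε₁, hα⟩ :=
    ((hX.contDiffAt (hW.mem_nhds hp₀)).of_le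
      (by simp)).exists_forall_mem_closedBall_exists_eq_forall_mem_Ioo_hasDerivAt₀ t₀
  have hαc : ContinuousAt α t₀ := (hα t₀ ⟨by linarith, by linarith⟩).continuousAt
  obtain ⟨ε₂, hε₂, hα₂⟩ := Metric.eventually_nhds_iff_ball.1
    (hαc.eventually_mem (by rw [hα₀]; exact hW.mem_nhds hp₀))
  set ε := min ε₁ ε₂ with hε
  have hε0 : 0 < ε := lt_min hε₁ hε₂
  set I := Ioo (t₀ - ε) (t₀ + ε) with hI
  have ht₀I : t₀ ∈ I := ⟨by linarith, by linarith⟩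
  have hd : ∀ t ∈ I, HasDerivAt α (X (α t)) t := fun t ht =>
    hα t ⟨by linarith [ht.1, min_le_left ε₁ ε₂], by linarith [ht.2, min_le_left ε₁ ε₂]⟩
  have hm : MapsTo α I W := fun t ht => hα₂ t (by
    rw [Metric.mem_ball, Real.dist_eq, abs_lt]
    exact ⟨by linarith [ht.1, min_le_right ε₁ ε₂], by linarith [ht.2, min_le_right ε₁ ε₂]⟩)
  have hαs : ContDiffOn ℝ ∞ α I := contDiffOn_of_hasDerivAt hX isOpen_Ioo hd hm
  have d1 : ∀ t ∈ I, HasDerivAt (fun s => (α s).1) 1 t := fun t ht => (hd t ht).fst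
  have d2 : ∀ t ∈ I, HasDerivAt (fun s => (α s).2.1) (α t).2.2.1 t := fun t ht => (hd t ht).snd.fst
  have d3 : ∀ t ∈ I, HasDerivAt (fun s => (α s).2.2.1) (α t).2.2.2 t :=
    fun t ht => (hd t ht).snd.snd.fst
  have d4 : ∀ t ∈ I, HasDerivAt (fun s => (α s).2.2.2) (F ((α t).1, (α t).2.2)) t :=
    fun t ht => (hd t ht).snd.snd.snd
  have hfst : ∀ t ∈ I, (α t).1 = t := by
    intro t ht
    have h1 : ∀ s ∈ I, HasDerivWithinAt (fun s => (α s).1 - s) 0 I s := fun s hs => by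
      simpa using ((d1 s hs).fun_sub (hasDerivAt_id s)).hasDerivWithinAt
    have h2 := (convex_Ioo (t₀ - ε) (t₀ + ε)).is_const_of_fderivWithin_eq_zero (𝕜 := ℝ)
      (fun s hs => (h1 s hs).differentiableWithinAt) (fun s hs =>
        ((h1 s hs).hasFDerivWithinAt.fderivWithin (isOpen_Ioo.uniqueDiffWithinAt hs)).trans
          (by ext; simp)) ht ht₀I
    simp only [hα₀, p₀, sub_self] at h2
    linarith
  obtain ⟨r, hr, hrα⟩ := exists_contDiff_eqOn hε0 (r := fun s => (α s).2.1)
    (contDiff_fst.comp_contDiffOn (contDiff_snd.comp_contDiffOn hαs))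
  refine ⟨ε / 3, r, by positivity, hr, ?_⟩
  set J := Ioo (t₀ - ε / 3) (t₀ + ε / 3) with hJ
  have hJI : ∀ t ∈ J, t ∈ I := fun t ht => ⟨by linarith [ht.1], by linarith [ht.2]⟩
  have hev : ∀ {a b : ℝ → ℝ}, EqOn a b J → ∀ t ∈ J, a =ᶠ[𝓝 t] b := fun h t ht =>
    Filter.eventuallyEq_of_mem (isOpen_Ioo.mem_nhds ht) h
  have e1 : EqOn (deriv r) (fun s => (α s).2.2.1) J := fun t ht =>
    (hev hrα t ht).deriv_eq.trans (d2 t (hJI t ht)).deriv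
  have e2 : EqOn (deriv (deriv r)) (fun s => (α s).2.2.2) J := fun t ht =>
    (hev e1 t ht).deriv_eq.trans (d3 t (hJI t ht)).deriv
  have e3 : ∀ t ∈ J, deriv (deriv (deriv r)) t = F ((α t).1, (α t).2.2) := fun t ht =>
    (hev e2 t ht).deriv_eq.trans (d4 t (hJI t ht)).deriv
  intro t ht
  have hWt := hm (hJI t ht)
  refine ⟨?_, ?_, ?_⟩
  · rw [← hfst t (hJI t ht)]
    exact hWt.1
  · rw [e1 ht]
    exact hWt.2.2.1
  · rw [e3 t ht, e1 ht, e2 ht, hfst t (hJI t ht)]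

end ODE

end Biharm

end

noncomputable section

namespace Biharm

/-! ### Biharmonicity of the identity on an Einstein manifold -/

section Einstein

variable {n : ℕ} {N : Type*} [TopologicalSpace N] [ChartedSpace (Coord n) N]
  [IsManifold (𝓡 n) ∞ N] {h : Metric n N} {c : ℝ}

/-- Biharmonicity of the identity, expressed in charts. -/
theorem isBiharmonicOn_conformal_iff (hn2 : 2 < n) (hE : IsEinsteinWith h c)
    (ρ : C^∞⟮𝓡 n, N; ℝ⟯) (U : Set N) :
    IsBiharmonicOn h (conformal h ρ) (id : N → N) U ↔
      ∀ p₀ ∈ U, ∀ p ∈ U, p ∈ (extChartAt (𝓡 n) p₀).source → ∀ b,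
        conformalForm (components h p₀) c (ρ ∘ (extChartAt (𝓡 n) p₀).symm) b
          (extChartAt (𝓡 n) p₀ p) = 0 := by
  have key : ∀ p₀ p : N, p ∈ (extChartAt (𝓡 n) p₀).source →
      ((∀ a, bitension (components h p₀) (components (conformal h ρ) p₀)
        (writtenInExtChartAt (𝓡 n) (𝓡 n) p₀ (id : N → N)) a (extChartAt (𝓡 n) p₀ p) = 0) ↔
      ∀ b, conformalForm (components h p₀) c (ρ ∘ (extChartAt (𝓡 n) p₀).symm) b
          (extChartAt (𝓡 n) p₀ p) = 0) := by
    intro p₀ p hp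
    have hx := (extChartAt (𝓡 n) p₀).map_source hp
    exact (isMetricOn_components h p₀).bitension_eq_zero_iff hn2 (hE p₀ _ hx)
      (contDiffOn_comp_symm ρ p₀) (fun y _ => components_conformal h ρ p₀ y)
      (fun y hy => (extChartAt (𝓡 n) p₀).right_inv hy) hx
  constructor
  · rintro ⟨-, H⟩ p₀ hp₀ p hp hps
    exact (key p₀ p hps).1 (H p₀ hp₀ p hp hps hps)
  · intro H
    exact ⟨contMDiffOn_id, fun p₀ hp₀ p hp hps _ => (key p₀ p hps).2 (H p₀ hp₀ p hp hps)⟩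

lemma mem_regularPoints_iff (f : C^∞⟮𝓡 n, N; ℝ⟯) {U : Set N} {p₀ p : N}
    (hp : p ∈ (extChartAt (𝓡 n) p₀).source) :
    p ∈ regularPoints n f U ↔
      p ∈ U ∧ fderiv ℝ (f ∘ (extChartAt (𝓡 n) p₀).symm) (extChartAt (𝓡 n) p₀ p) ≠ 0 :=
  and_congr_right fun _ => mfderiv_ne_zero_iff f hp

lemma isOpen_regularPoints (f : C^∞⟮𝓡 n, N; ℝ⟯) {U : Set N} (hU : IsOpen U) :
    IsOpen (regularPoints n f U) := by
  rw [isOpen_iff_mem_nhds]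
  intro q hq
  have hqs := mem_extChartAt_source (I := 𝓡 n) q
  have hc : ContinuousAt (fun p => fderiv ℝ (f ∘ (extChartAt (𝓡 n) q).symm)
      (extChartAt (𝓡 n) q p)) q := by
    refine ContinuousAt.comp (g := fderiv ℝ (f ∘ (extChartAt (𝓡 n) q).symm)) ?_
      (continuousAt_extChartAt q)
    exact ((contDiffOn_comp_symm f q).continuousOn_fderiv_of_isOpen (isOpen_extChartAt_target q)
      (by simp)).continuousAt (extChartAt_target_mem_nhds q)
  filter_upwards [hU.mem_nhds hq.1, (isOpen_extChartAt_source q).mem_nhds hqs,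
    hc.eventually_ne ((mem_regularPoints_iff f hqs).1 hq).2] with p h1 h2 h3
  exact (mem_regularPoints_iff f h2).2 ⟨h1, h3⟩

/-- A function maps neighbourhoods of a regular point onto neighbourhoods of its value. -/
lemma image_mem_nhds_of_mem_regularPoints (f : C^∞⟮𝓡 n, N; ℝ⟯) {U : Set N} {q : N}
    (hq : q ∈ regularPoints n f U) {O : Set N} (hO : O ∈ 𝓝 q) : f '' O ∈ 𝓝 (f q) := by
  have hqs := mem_extChartAt_source (I := 𝓡 n) q
  have hO' : (extChartAt (𝓡 n) q).symm ⁻¹' O ∈ 𝓝 (extChartAt (𝓡 n) q q) := by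
    refine (continuousAt_extChartAt_symm q).preimage_mem_nhds ?_
    rwa [extChartAt_to_inv]
  have h1 := image_mem_nhds_of_fderiv_ne_zero (isOpen_extChartAt_target q)
    (mem_extChartAt_target q) (contDiffOn_comp_symm f q) ((mem_regularPoints_iff f hqs).1 hq).2 hO'
  rw [Function.comp_apply, extChartAt_to_inv] at h1
  refine Filter.mem_of_superset h1 ?_
  rintro _ ⟨x, hx, rfl⟩
  exact ⟨_, hx, rfl⟩

lemma isOpen_image_regularPoints (f : C^∞⟮𝓡 n, N; ℝ⟯) {U : Set N} (hU : IsOpen U) :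
    IsOpen (f '' regularPoints n f U) := by
  rw [isOpen_iff_mem_nhds]
  rintro _ ⟨q, hq, rfl⟩
  exact image_mem_nhds_of_mem_regularPoints f hq ((isOpen_regularPoints f hU).mem_nhds hq)

/-- Near a regular point, `|dρ|²` and `Δρ` are functions of `ρ` if the identity is biharmonic. -/
theorem exists_local_isoparametric (hn2 : 2 < n) (hn4 : n ≠ 4) (hE : IsEinsteinWith h c)
    (ρ : C^∞⟮𝓡 n, N; ℝ⟯) (hρ : IsBiharmonic h (conformal h ρ) (id : N → N)) {q : N}
    (hq : q ∈ regularPoints n ρ univ) :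
    ∃ (O : Set N) (V : Set ℝ) (γ σ : ℝ → ℝ), IsOpen O ∧ q ∈ O ∧ O ⊆ regularPoints n ρ univ ∧
      IsOpen V ∧ MapsTo ρ O V ∧ ContDiffOn ℝ ∞ γ V ∧ ContDiffOn ℝ ∞ σ V ∧
      ∀ p ∈ O, gradNormSq h ρ p = γ (ρ p) ∧ laplacian h ρ p = σ (ρ p) := by
  have hqs := mem_extChartAt_source (I := 𝓡 n) q
  set T := (extChartAt (𝓡 n) q).target with hT
  set ρ' : Coord n → ℝ := ρ ∘ (extChartAt (𝓡 n) q).symm with hρ'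
  have hTo : IsOpen T := isOpen_extChartAt_target q
  have hρs : ContDiffOn ℝ ∞ ρ' T := contDiffOn_comp_symm ρ q
  have hg := isMetricOn_components h q
  -- Proportionality to `dρ` controls kernels only where `dρ ≠ 0`.
  let Ω : Set (Coord n) := T ∩ fderiv ℝ ρ' ⁻¹' {0}ᶜ
  have hΩ : IsOpen Ω := (hρs.continuousOn_fderiv_of_isOpen hTo (by simp)).isOpen_inter_preimage hTo
    isOpen_compl_singleton
  have hΩT : Ω ⊆ T := inter_subset_left
  have hform : ∀ y ∈ T, ∀ b, conformalForm (components h q) c ρ' b y = 0 := by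
    intro y hy b
    have h1 := (isBiharmonicOn_conformal_iff hn2 hE ρ univ).1 hρ q trivial
      ((extChartAt (𝓡 n) q).symm y) trivial ((extChartAt (𝓡 n) q).map_target hy) b
    rwa [(extChartAt (𝓡 n) q).right_inv hy] at h1
  have hx₀ : extChartAt (𝓡 n) q q ∈ Ω :=
    ⟨mem_extChartAt_target q, ((mem_regularPoints_iff ρ hqs).1 hq).2⟩
  obtain ⟨O, V, κ, hO, hqO, hOΩ, hV, hOV, hκ, hκΩ, H⟩ :=
    exists_factorization hΩ hx₀ (hρs.mono hΩT) hx₀.2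
  have hU := hg.contDiffOn_coordGradNormSq hρs
  have hD := hg.contDiffOn_coordLaplacian hρs
  have hUO := H _ (hU.mono hΩT) fun x hx => fderiv_eq_zero_of_pd_mul_pd hx.2 fun a b =>
    (hg.pd_mul_pd_of_conformalForm hn4 hρs hform hx.1 a b).1
  have hDO := H _ (hD.mono hΩT) fun x hx => fderiv_eq_zero_of_pd_mul_pd hx.2 fun a b =>
    (hg.pd_mul_pd_of_conformalForm hn4 hρs hform hx.1 a b).2
  have hρx : ∀ p ∈ (extChartAt (𝓡 n) q).source, ρ' (extChartAt (𝓡 n) q p) = ρ p := fun p hp => by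
    simp only [hρ', Function.comp_apply]
    rw [(extChartAt (𝓡 n) q).left_inv hp]
  refine ⟨(extChartAt (𝓡 n) q).source ∩ extChartAt (𝓡 n) q ⁻¹' O, V,
    -- The values along the section `κ` of `ρ` serve as `γ` and `σ`, which are therefore smooth.
    fun t => coordGradNormSq (components h q) ρ' (κ t),
    fun t => coordLaplacian (components h q) ρ' (κ t),
    (continuousOn_extChartAt q).isOpen_inter_preimage (isOpen_extChartAt_source q) hO,
    ⟨hqs, hqO⟩, fun p hp => (mem_regularPoints_iff ρ hp.1).2 ⟨trivial, (hOΩ hp.2).2⟩, hV,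
    fun p hp => ?_, hU.comp hκ fun t ht => hΩT (hκΩ ht), hD.comp hκ fun t ht => hΩT (hκΩ ht),
    fun p hp => ⟨?_, ?_⟩⟩
  · rw [← hρx p hp.1]
    exact hOV hp.2
  · rw [gradNormSq_eq h ρ hp.1, ← hρx p hp.1]
    exact hUO _ hp.2
  · rw [laplacian_eq h ρ hp.1, ← hρx p hp.1]
    exact hDO _ hp.2

/-- A function on the regular points which is locally a smooth function of `ρ` is globally a
smooth function of `ρ` if the levels are connected. -/
theorem exists_global_factorization (ρ : C^∞⟮𝓡 n, N; ℝ⟯) (u : N → ℝ)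
    (hloc : ∀ q ∈ regularPoints n ρ univ, ∃ (O : Set N) (V : Set ℝ) (γ : ℝ → ℝ), IsOpen O ∧ q ∈ O ∧
      O ⊆ regularPoints n ρ univ ∧ IsOpen V ∧ MapsTo ρ O V ∧ ContDiffOn ℝ ∞ γ V ∧
      ∀ p ∈ O, u p = γ (ρ p))
    (hconn : ∀ t : ℝ, IsPreconnected {p : N | p ∈ regularPoints n ρ univ ∧ ρ p = t}) :
    ∃ γ : ℝ → ℝ, ContDiffOn ℝ ∞ γ (ρ '' regularPoints n ρ univ) ∧
      ∀ p ∈ regularPoints n ρ univ, u p = γ (ρ p) := by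
  classical
  have hconst : ∀ p ∈ regularPoints n ρ univ, ∀ p' ∈ regularPoints n ρ univ, ρ p' = ρ p →
      u p' = u p := by
    intro p hp p' hp' hpp
    -- By the local factorization, `u` is locally constant on the regular part of a level, hence
    -- constant since that part is preconnected.
    refine (hconn (ρ p)).induction₂ (fun x y => u x = u y) ?_ (fun x y z _ _ _ h1 h2 => h1.trans h2)
      (fun x y _ _ h1 => h1.symm) ⟨hp', hpp⟩ ⟨hp, rfl⟩
    intro x hx
    obtain ⟨O, V, γ, hO, hxO, -, -, -, -, hu⟩ := hloc x hx.1
    filter_upwards [mem_nhdsWithin_of_mem_nhds (hO.mem_nhds hxO), self_mem_nhdsWithin] with y h1 h2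
    rw [hu x hxO, hu y h1, hx.2, h2.2]
  let γ : ℝ → ℝ := fun t =>
    if ht : ∃ p, p ∈ regularPoints n ρ univ ∧ ρ p = t then u ht.choose else 0
  have hγ : ∀ p ∈ regularPoints n ρ univ, u p = γ (ρ p) := by
    intro p hp
    have ht : ∃ p', p' ∈ regularPoints n ρ univ ∧ ρ p' = ρ p := ⟨p, hp, rfl⟩
    simp only [γ, dif_pos ht]
    exact (hconst p hp _ ht.choose_spec.1 ht.choose_spec.2).symm
  refine ⟨γ, ?_, hγ⟩
  rintro _ ⟨q, hq, rfl⟩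
  obtain ⟨O, V, γ', hO, hqO, hOr, hV, hOV, hγ', hu⟩ := hloc q hq
  -- The global function agrees with the local one on `ρ(O)`, a neighbourhood of `ρ q` because `ρ`
  -- is a submersion at `q`.
  refine (((hγ'.contDiffAt (hV.mem_nhds (hOV hqO)))).congr_of_eventuallyEq ?_).contDiffWithinAt
  filter_upwards [image_mem_nhds_of_mem_regularPoints ρ hq (hO.mem_nhds hqO)]
  rintro _ ⟨p, hp, rfl⟩
  rw [← hγ p (hOr hp), hu p hp]

/-- Biharmonicity of the identity for `ρ = r ∘ f` is an ordinary differential equation for `r`. -/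
theorem isBiharmonicOn_comp_iff (hn2 : 2 < n) (hE : IsEinsteinWith h c) (f : C^∞⟮𝓡 n, N; ℝ⟯)
    (r : C^∞⟮𝓘(ℝ, ℝ), ℝ; ℝ⟯) {W : Set N} {γ σ : ℝ → ℝ} (hW : IsOpen W)
    (hreg : W ⊆ regularPoints n f univ) (hγ : ∀ p ∈ W, DifferentiableAt ℝ γ (f p))
    (hσ : ∀ p ∈ W, DifferentiableAt ℝ σ (f p))
    (hf : ∀ p ∈ W, gradNormSq h f p = γ (f p) ∧ laplacian h f p = σ (f p)) :
    IsBiharmonicOn h (conformal h (r.comp f)) (id : N → N) W ↔ ∀ p ∈ W,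
      deriv (deriv (deriv r)) (f p) * γ (f p) + deriv (deriv r) (f p) * deriv γ (f p)
        - deriv σ (f p) * deriv r (f p) - σ (f p) * deriv (deriv r) (f p)
        + ((6 - n) / 2) * (2 * deriv r (f p) * deriv (deriv r) (f p) * γ (f p)
          + deriv r (f p) ^ 2 * deriv γ (f p))
        + (2 * (deriv r (f p) * σ (f p) - deriv (deriv r) (f p) * γ (f p))
          + (2 - n) * (deriv r (f p) ^ 2 * γ (f p)) + 2 * c) * deriv r (f p) = 0 := by
  rw [isBiharmonicOn_conformal_iff hn2 hE]
  have key : ∀ p₀ : N, ∀ p ∈ W, p ∈ (extChartAt (𝓡 n) p₀).source → ∀ b,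
      conformalForm (components h p₀) c ((r.comp f) ∘ (extChartAt (𝓡 n) p₀).symm) b
        (extChartAt (𝓡 n) p₀ p) =
      (deriv (deriv (deriv r)) (f p) * γ (f p) + deriv (deriv r) (f p) * deriv γ (f p)
        - deriv σ (f p) * deriv r (f p) - σ (f p) * deriv (deriv r) (f p)
        + ((6 - n) / 2) * (2 * deriv r (f p) * deriv (deriv r) (f p) * γ (f p)
          + deriv r (f p) ^ 2 * deriv γ (f p))
        + (2 * (deriv r (f p) * σ (f p) - deriv (deriv r) (f p) * γ (f p))
          + (2 - n) * (deriv r (f p) ^ 2 * γ (f p)) + 2 * c) * deriv r (f p)) *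
        pd b (f ∘ (extChartAt (𝓡 n) p₀).symm) (extChartAt (𝓡 n) p₀ p) := by
    intro p₀ p hp hps b
    let Ω := (extChartAt (𝓡 n) p₀).target ∩ (extChartAt (𝓡 n) p₀).symm ⁻¹' W
    have hΩ : IsOpen Ω :=
      (continuousOn_extChartAt_symm p₀).isOpen_inter_preimage (isOpen_extChartAt_target p₀) hW
    have hps' : (extChartAt (𝓡 n) p₀).symm (extChartAt (𝓡 n) p₀ p) = p :=
      (extChartAt (𝓡 n) p₀).left_inv hps
    have hx : extChartAt (𝓡 n) p₀ p ∈ Ω :=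
      ⟨(extChartAt (𝓡 n) p₀).map_source hps, by rw [mem_preimage, hps']; exact hp⟩
    have h1 := ((isMetricOn_components h p₀).mono hΩ inter_subset_left).conformalForm_comp
      ((contDiffOn_comp_symm f p₀).mono inter_subset_left) r.contMDiff.contDiff (γ := γ) (σ := σ)
      (fun y hy => by rw [← gradNormSq_symm h f hy.1, (hf _ hy.2).1]; rfl)
      (fun y hy => by rw [← laplacian_symm h f hy.1, (hf _ hy.2).2]; rfl) hx
      (by rw [Function.comp_apply, hps']; exact hγ p hp)
      (by rw [Function.comp_apply, hps']; exact hσ p hp) c b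
    simp only [Function.comp_apply, hps'] at h1
    exact h1
  constructor
  · intro H p hp
    have hps := mem_extChartAt_source (I := 𝓡 n) p
    -- The one-form is the scalar expression times `df`; a nonzero component of `df` allows
    -- division.
    obtain ⟨b, hb⟩ : ∃ b, pd b (f ∘ (extChartAt (𝓡 n) p).symm) (extChartAt (𝓡 n) p p) ≠ 0 := by
      by_contra! h1
      exact ((mem_regularPoints_iff f hps).1 (hreg hp)).2
        (ContinuousLinearMap.ext fun w => by
          rw [fderiv_eq_sum_pd]
          exact Finset.sum_eq_zero fun i _ => by rw [h1, mul_zero])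
    have h1 := H p hp p hp hps b
    rw [key p p hp hps b] at h1
    exact (mul_eq_zero.1 h1).resolve_right hb
  · intro H p₀ _ p hp hps b
    rw [key p₀ p hp hps b, H p hp, zero_mul]

lemma gradNormSq_eq_zero (f : C^∞⟮𝓡 n, N; ℝ⟯) {p : N}
    (hp : fderiv ℝ (f ∘ (extChartAt (𝓡 n) p).symm) (extChartAt (𝓡 n) p p) = 0) :
    gradNormSq h f p = 0 := by
  simp only [gradNormSq, coordGradNormSq, pd, hp]
  simp

/-- Here `|df|²` is the metric evaluated on the nonzero gradient. This positivity makes the leading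
coefficient of the differential equation invertible. -/
lemma gradNormSq_pos (h : Metric n N) (f : C^∞⟮𝓡 n, N; ℝ⟯) {U : Set N} {p : N}
    (hp : p ∈ regularPoints n f U) : 0 < gradNormSq h f p := by
  have hx := mem_extChartAt_target (I := 𝓡 n) p
  have hg := isMetricOn_components h p
  have h0 := ((mem_regularPoints_iff f (mem_extChartAt_source p)).1 hp).2
  have hv := hg.metric_mulVec_raise hx
    (diffVec (f ∘ (extChartAt (𝓡 n) p).symm) (extChartAt (𝓡 n) p p))
  rw [gradNormSq, coordGradNormSq_eq]
  have h1 := components_pos h p hx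
    (w := gradVec (components h p) (f ∘ (extChartAt (𝓡 n) p).symm) (extChartAt (𝓡 n) p p)) ?_
  · rw [gradVec, hv, dotProduct_comm] at h1
    exact h1
  · intro h2
    rw [← gradVec, h2, Matrix.mulVec_zero] at hv
    exact h0 (ContinuousLinearMap.ext fun w => by
      rw [fderiv_eq_sum_pd]
      exact Finset.sum_eq_zero fun i _ => by
        rw [show pd i _ _ = 0 from (congr_fun hv i).symm, mul_zero])

end Einstein

end Biharm

end

/-! ### Proof of the three statements -/

theorem mainTheorem3 {n : ℕ} (hn2 : 2 < n) (hn4 : n ≠ 4)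
    {N : Type*} [TopologicalSpace N] [T2Space N] [SecondCountableTopology N]
    [ChartedSpace (Biharm.Coord n) N] [IsManifold (𝓡 n) ∞ N]
    (h : Biharm.Metric n N) (c : ℝ) (hE : Biharm.IsEinsteinWith h c) :
    (∀ ρ : C^∞⟮𝓡 n, N; ℝ⟯,
      Biharm.IsBiharmonic h (Biharm.conformal h ρ) (id : N → N) →
        (∀ q : N, mfderiv (𝓡 n) 𝓘(ℝ, ℝ) ρ q ≠ 0 →
          ∃ U : Set N, IsOpen U ∧ q ∈ U ∧ Biharm.IsIsoparametricOn h ρ U) ∧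
        ((∀ t : ℝ, IsPreconnected {p : N | p ∈ Biharm.regularPoints n ρ univ ∧ ρ p = t}) →
          Biharm.IsIsoparametricOn h ρ univ)) ∧
    (∀ (f : C^∞⟮𝓡 n, N; ℝ⟯) (U : Set N), IsOpen U → Biharm.IsIsoparametricOn h f U →
      ∀ q ∈ Biharm.regularPoints n f U,
        ∃ (ε : ℝ) (r : C^∞⟮𝓘(ℝ, ℝ), ℝ; ℝ⟯), 0 < ε ∧
          (∀ t ∈ Ioo (f q - ε) (f q + ε), deriv r t ≠ 0) ∧
          Biharm.IsBiharmonicOn h (Biharm.conformal h (r.comp f)) (id : N → N)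
            {p | p ∈ Biharm.regularPoints n f U ∧ f p ∈ Ioo (f q - ε) (f q + ε)}) ∧
    (∀ (s : C^∞⟮𝓡 n, N; ℝ⟯) (U : Set N) (σ : ℝ → ℝ), IsOpen U →
      ContDiffOn ℝ ∞ σ (s '' U) →
      (∀ p ∈ U, Biharm.gradNormSq h s p = 1 ∧ Biharm.laplacian h s p = σ (s p)) →
      ∀ r : C^∞⟮𝓘(ℝ, ℝ), ℝ; ℝ⟯,
        Biharm.IsBiharmonicOn h (Biharm.conformal h (r.comp s)) (id : N → N) U ↔
          ∀ t ∈ s '' U,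
            deriv (deriv (deriv r)) t - σ t * deriv (deriv r) t
              + (4 - (n : ℝ)) * deriv r t * deriv (deriv r) t
              + (2 * c - deriv σ t) * deriv r t + 2 * σ t * deriv r t ^ 2
              + (2 - (n : ℝ)) * deriv r t ^ 3 = 0) := by
  refine ⟨fun ρ hρ => ⟨fun q hq => ?_, fun hconn => ?_⟩, fun f U hU hf q hq => ?_,
    fun s U σ hU hσ hs r => ?_⟩
  · obtain ⟨O, V, γ, σ, hO, hqO, -, -, hOV, hγ, hσ, H⟩ :=
      Biharm.exists_local_isoparametric hn2 hn4 hE ρ hρ (q := q) ⟨trivial, hq⟩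
    have hsub : ρ '' Biharm.regularPoints n ρ O ⊆ V := by
      rintro _ ⟨p, hp, rfl⟩
      exact hOV hp.1
    exact ⟨O, hO, hqO, γ, σ, hγ.mono hsub, hσ.mono hsub, fun p hp => H p hp.1⟩
  · obtain ⟨γ, hγ, hγ'⟩ := Biharm.exists_global_factorization ρ (Biharm.gradNormSq h ρ)
      (fun q hq => by
        obtain ⟨O, V, γ, σ, hO, hqO, hOr, hV, hOV, hγ, -, H⟩ :=
          Biharm.exists_local_isoparametric hn2 hn4 hE ρ hρ hq
        exact ⟨O, V, γ, hO, hqO, hOr, hV, hOV, hγ, fun p hp => (H p hp).1⟩) hconn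
    obtain ⟨σ, hσ, hσ'⟩ := Biharm.exists_global_factorization ρ (Biharm.laplacian h ρ)
      (fun q hq => by
        obtain ⟨O, V, γ, σ, hO, hqO, hOr, hV, hOV, -, hσ, H⟩ :=
          Biharm.exists_local_isoparametric hn2 hn4 hE ρ hρ hq
        exact ⟨O, V, σ, hO, hqO, hOr, hV, hOV, hσ, fun p hp => (H p hp).2⟩) hconn
    exact ⟨γ, σ, hγ, hσ, fun p hp => ⟨hγ' p hp, hσ' p hp⟩⟩
  · obtain ⟨γ, σ, hγ, hσ, H⟩ := hf
    set S := f '' Biharm.regularPoints n f U with hSdef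
    have hS : IsOpen S := Biharm.isOpen_image_regularPoints f hU
    have hγ0 : ∀ t ∈ S, γ t ≠ 0 := by
      rintro _ ⟨p, hp, rfl⟩
      rw [← (H p hp).1]
      exact (Biharm.gradNormSq_pos h f hp).ne'
    have hdγ : ContDiffOn ℝ ∞ (deriv γ) S := hγ.deriv_of_isOpen hS (by simp)
    have hdσ : ContDiffOn ℝ ∞ (deriv σ) S := hσ.deriv_of_isOpen hS (by simp)
    -- The equation of `isBiharmonicOn_comp_iff` solved for `r'''`, with `p = (t, r', r'')`.
    let F : ℝ × ℝ × ℝ → ℝ := fun p => -(p.2.2 * deriv γ p.1 - deriv σ p.1 * p.2.1 - σ p.1 * p.2.2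
      + ((6 - n) / 2) * (2 * p.2.1 * p.2.2 * γ p.1 + p.2.1 ^ 2 * deriv γ p.1)
      + (2 * (p.2.1 * σ p.1 - p.2.2 * γ p.1) + (2 - n) * (p.2.1 ^ 2 * γ p.1) + 2 * c) * p.2.1)
        / γ p.1
    have hF : ContDiffOn ℝ ∞ F (S ×ˢ univ) := by
      have hm : MapsTo (Prod.fst : ℝ × ℝ × ℝ → ℝ) (S ×ˢ univ) S := fun p hp => hp.1
      have e1 := hγ.comp contDiffOn_fst hm
      have e2 := hσ.comp contDiffOn_fst hm
      have e3 := hdγ.comp contDiffOn_fst hm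
      have e4 := hdσ.comp contDiffOn_fst hm
      simp only [Function.comp_def] at e1 e2 e3 e4
      have aux : ∀ G A G' A' : ℝ × ℝ × ℝ → ℝ, ContDiffOn ℝ ∞ G (S ×ˢ univ) →
          ContDiffOn ℝ ∞ A (S ×ˢ univ) → ContDiffOn ℝ ∞ G' (S ×ˢ univ) →
          ContDiffOn ℝ ∞ A' (S ×ˢ univ) → ContDiffOn ℝ ∞ (fun p : ℝ × ℝ × ℝ =>
            -(p.2.2 * G' p - A' p * p.2.1 - A p * p.2.2
              + ((6 - (n : ℝ)) / 2) * (2 * p.2.1 * p.2.2 * G p + p.2.1 ^ 2 * G' p)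
              + (2 * (p.2.1 * A p - p.2.2 * G p) + (2 - (n : ℝ)) * (p.2.1 ^ 2 * G p) + 2 * c)
                * p.2.1)) (S ×ˢ univ) := by
        intro G A G' A' h1 h2 h3 h4
        fun_prop
      exact (aux _ _ _ _ e1 e2 e3 e4).div e1 fun p hp => hγ0 _ hp.1
    obtain ⟨ε, r, hε, hr, hode⟩ := Biharm.exists_contDiff_deriv_eq hS (mem_image_of_mem f hq) hF
    refine ⟨ε, ⟨r, hr.contMDiff⟩, hε, fun t ht => (hode t ht).2.1, ?_⟩
    refine (Biharm.isBiharmonicOn_comp_iff hn2 hE f ⟨r, hr.contMDiff⟩ (γ := γ) (σ := σ)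
      ((Biharm.isOpen_regularPoints f hU).inter (isOpen_Ioo.preimage f.contMDiff.continuous))
      (fun p hp => ⟨trivial, hp.1.2⟩)
      (fun p hp => Biharm.differentiableAt_of_contDiffOn hγ hS (mem_image_of_mem f hp.1))
      (fun p hp => Biharm.differentiableAt_of_contDiffOn hσ hS (mem_image_of_mem f hp.1))
      (fun p hp => H p hp.1)).2 fun p hp => ?_
    obtain ⟨hpS, -, h3⟩ := hode (f p) hp.2
    have h4 : deriv (deriv (deriv r)) (f p) * γ (f p) = _ :=
      (eq_div_iff (hγ0 _ hpS)).1 h3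
    simp only [ContMDiffMap.coeFn_mk]
    rw [h4]
    ring
  -- Since `|ds| = 1`, every point of `U` is regular. Hence `s '' U` is open, which makes `σ`
  -- differentiable at its points.
  · have hreg : U ⊆ Biharm.regularPoints n s univ := by
      intro p hp
      refine (Biharm.mem_regularPoints_iff s (mem_extChartAt_source p)).2 ⟨trivial, fun h0 => ?_⟩
      have h1 := (hs p hp).1
      rw [Biharm.gradNormSq_eq_zero s h0] at h1
      exact zero_ne_one h1
    have hrU : Biharm.regularPoints n s U = U := by
      ext p
      exact ⟨fun hp => hp.1, fun hp => ⟨hp, (hreg hp).2⟩⟩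
    have hS : IsOpen (s '' U) := by
      have := Biharm.isOpen_image_regularPoints s hU
      rwa [hrU] at this
    rw [Biharm.isBiharmonicOn_comp_iff hn2 hE s r (γ := fun _ => 1) (σ := σ) hU hreg
      (fun p _ => differentiableAt_const _)
      (fun p hp => Biharm.differentiableAt_of_contDiffOn hσ hS (mem_image_of_mem s hp)) hs,
      forall_mem_image]
    -- For `γ = 1` the terms with `γ'` vanish, and the coefficient of `r' r''` becomes `(6 - n) - 2
    -- = 4 - n`.
    refine forall₂_congr fun p _ => Eq.congr_left ?_
    simp only [deriv_const]
    ring
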